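/- Let $p,q$ be odd integers and let $r=2m$ with $m$ a non-zero integer, such that $$\frac1{|p|}+\frac1{|q|}+\frac1{|m|}\le 1 .$$ Let $K\subset S^3$ be a $(p,q,r)$ pretzel knot (knots are considered up to homeomorphism of $S^3$; in particular a knot is not distinguished from its mirror image), with complement $M=S^3\setminus K$. Let $\mu$ be a meridian and $\lambda$ the preferred (null-homologous in $M$) longitude of $K$, and for coprime integers $\alpha,\beta$ let $M(\alpha/\beta)$ denote the Dehn filling of $M$ along the slope $\alpha\mu+\beta\lambda$. If $a,b$ are integers with $b$ odd and $\gcd(2a,b)=1$, then the fundamental group of $M(2a/b)$ is infinite. -/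

import Mathlib

noncomputable section

/-- Euclidean 3-space. -/
abbrev Space3 : Type := EuclideanSpace ℝ (Fin 3)

/-- The 3-sphere, as the unit sphere of Euclidean 4-space. -/
abbrev Sphere3 : Type := Metric.sphere (0 : EuclideanSpace ℝ (Fin 4)) 1

/-- A vertical column of `|n|` crossings: two strands forming a double helix of radius 1 around the
vertical line through `(c, 0, 0)`, for heights `-1 ≤ t ≤ 1`, making `n` half twists in total. The
sign of `n` is the handedness of the twisting. Both at the bottom and at the top the four ends lie
over the points `(c - 1, 0)` and `(c + 1, 0)`. Projected along the second coordinate, the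
strands cross exactly `|n|` times. -/
def twistColumn (c : ℝ) (n : ℤ) : Set Space3 :=
  {P | ∃ t ∈ Set.Icc (-1 : ℝ) 1, ∃ ε ∈ ({1, -1} : Set ℝ),
    P = !₂[c + ε * Real.cos (Real.pi * n * (t + 1) / 2),
           ε * Real.sin (Real.pi * n * (t + 1) / 2), t]}

/-- The arcs joining the ends of the three columns at height `e` (used with `e = 1` for the top
and `e = -1` for the bottom): the right end of each column is joined to the left end of the next
one by a horizontal segment, and the right end of the last column is joined to the left end
of the first by an arc passing above (for `e = 1`) or below (for `e = -1`) everything else. -/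
def closingArcs (e : ℝ) : Set Space3 :=
  segment ℝ !₂[-2, 0, e] !₂[-1, 0, e] ∪ segment ℝ !₂[1, 0, e] !₂[2, 0, e] ∪
  segment ℝ !₂[-4, 0, e] !₂[-4, 0, 2 * e] ∪ segment ℝ !₂[-4, 0, 2 * e] !₂[4, 0, 2 * e] ∪
  segment ℝ !₂[4, 0, 2 * e] !₂[4, 0, e]

/-- The standard `(p, q, r)` pretzel link in 3-space: three twisted columns with `p`, `q`, `r`
half twists, side by side, closed up at the top and at the bottom. -/
def standardPretzel (p q r : ℤ) : Set Space3 :=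
  twistColumn (-3) p ∪ twistColumn 0 q ∪ twistColumn 3 r ∪ closingArcs 1 ∪ closingArcs (-1)

/-- `K` is a `(p, q, r)` pretzel link in the 3-sphere: some homeomorphism from the one-point
compactification of 3-space to the 3-sphere carries the standard one onto `K`. (No orientation is
imposed on the homeomorphism: a knot and its mirror image are identified.) -/
def IsPretzel (p q r : ℤ) (K : Set Sphere3) : Prop :=
  ∃ Φ : OnePoint Space3 ≃ₜ Sphere3,
    Φ '' ((fun P : Space3 => (P : OnePoint Space3)) '' standardPretzel p q r) = K

/-- An open tubular neighbourhood of a knot `K`, parametrized by `S¹ × ℂ` with core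
`S¹ × {0}` going onto `K`. -/
structure TubularNbhd (K : Set Sphere3) where
  /-- The parametrization. -/
  toFun : Circle × ℂ → Sphere3
  isOpenEmbedding : Topology.IsOpenEmbedding toFun
  image_core : toFun '' {w | w.2 = 0} = K

namespace TubularNbhd

variable {K : Set Sphere3}

theorem notMem (N : TubularNbhd K) (w : Circle × ℂ) (hw : w.2 ≠ 0) : N.toFun w ∈ Kᶜ := by
  intro h
  obtain ⟨w', hw', e⟩ := N.image_core.symm.subset h
  exact hw (N.isOpenEmbedding.injective e ▸ hw')

/-- The longitude `s ↦ N (e^{2πis}, 1)` of the tubular neighbourhood, a loop in the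
knot complement. -/
def longitude (N : TubularNbhd K) :
    Path (⟨N.toFun (1, 1), N.notMem _ one_ne_zero⟩ : ↥Kᶜ)
      (⟨N.toFun (1, 1), N.notMem _ one_ne_zero⟩ : ↥Kᶜ) where
  toFun s := ⟨N.toFun (Circle.exp (2 * Real.pi * (s : ℝ)), 1), N.notMem _ one_ne_zero⟩
  continuous_toFun := by
    refine Continuous.subtype_mk (N.isOpenEmbedding.continuous.comp ?_) _
    fun_prop
  source' := by simp
  target' := by simp

/-- The tubular neighbourhood has the preferred framing: its longitude is null-homologous in the
knot complement, i.e. it is trivial in the abelianized fundamental group. -/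
def IsPreferred (N : TubularNbhd K) : Prop :=
  Abelianization.of (FundamentalGroup.fromPath (Path.Homotopic.Quotient.mk N.longitude)) = 1

/-- The identifications made in Dehn filling. The solid torus `S¹ × ℂ`, with its core `S¹ × {0}`
removed, is glued to the tubular neighbourhood with the knot removed, by the identity in the
radial coordinate `t` and by the linear map with matrix `![![α, γ], ![β, δ]]`
on tori, in (meridian, longitude) coordinates. The meridian `v ↦ (u, t v)` of the solid torus goes
to a curve that runs `α` times along the meridian and `β` times along the longitude of the knot. -/
inductive FillingRel (N : TubularNbhd K) (α β γ δ : ℤ) :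
    ↥Kᶜ ⊕ Circle × ℂ → ↥Kᶜ ⊕ Circle × ℂ → Prop
  | glue (u v : Circle) (t : ℝ) (ht : 0 < t) (x : ↥Kᶜ)
      (hx : (x : Sphere3) = N.toFun (u ^ δ * v ^ β, (t : ℂ) * ((u ^ γ * v ^ α : Circle) : ℂ))) :
      FillingRel N α β γ δ (Sum.inl x) (Sum.inr (u, (t : ℂ) * (v : ℂ)))

/-- The Dehn filling `M(α/β)` of the knot complement `M = S³ ∖ K`, with the quotient
topology: the knot complement and an open solid torus, glued along the punctured tubular
neighbourhood so that the meridian of the solid torus has slope `α/β`. It is meant for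
`α * δ - β * γ = 1` and a tubular neighbourhood with the preferred framing. The pair `(γ, δ)` only
affects the parametrization of the solid torus, not the resulting manifold. -/
def DehnFilling (N : TubularNbhd K) (α β γ δ : ℤ) : Type :=
  Quot (FillingRel N α β γ δ)

instance (N : TubularNbhd K) (α β γ δ : ℤ) : TopologicalSpace (DehnFilling N α β γ δ) :=
  inferInstanceAs (TopologicalSpace (Quot (FillingRel N α β γ δ)))

end TubularNbhd

end

/-! The inequality says that a triangle with angles π/|p|, π/|q|, π/|m| is Euclidean or hyperbolic,
so its reflections g₀, g₁, g₂, with (g₀g₁)^p = (g₁g₂)^q = (g₂g₀)^m = 1, generate an infinite group.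
The knot group is represented in it so that the filling slope acts trivially.

The representation is of Dehn type: passing from the front to the back of the plane of projection
costs g₀, g₁, g₂ through the outer, left and right regions, and nothing through the inner one. A
column with n half twists between generators x and y imposes only (x y)^n = 1. Meridians of the arcs
become reflections, so the square of a meridian acts trivially.

For the longitude, follow the knot. The alternating word of an odd column conjugates the reflection
on one side into the one on the other. The word of the even column is (g₂g₀)^m = 1; this is why m
rather than r counts. So cosets of H = ⟨g₁⟩ can be carried consistently around the knot, and the
peripheral holonomy reduces to H, which has order two and is detected by the sign. The longitude is
null-homologous, hence of sign 1, hence trivial; so μ^{2a} λ^b acts trivially.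

Instead of presentations of fundamental groups, the proof uses local systems and their coverings.
The system on the complement is `Pretzel.localSystem` (by `Pretzel.eventually_gauge`), its reduction
near the knot is `Pretzel.eventually_nearSection` with `Pretzel.exists_isCompatible`, and
`TubularNbhd.exists_extension` extends it over the filling. Explicit paths
(`Pretzel.joined_pt_of_mem_closure`) join infinitely many points of one fibre, because the group of
`TriangleGroup.exists_reflection_group` is infinite; `LocalSystem.infinite_fundamentalGroup`
concludes. -/

open Topology Filter

/-! ### Local systems in gauge form and their coverings -/

/-- A local system with structure group `G` on `B`, in gauge form: an open cover by charts and
functions `gauge i : B → G`, not necessarily continuous, such that the transition functions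
`(gauge j)⁻¹ * gauge i` are locally constant on the overlaps of the charts. -/
structure LocalSystem (ι B G : Type*) [TopologicalSpace B] [Group G] where
  /-- The charts. -/
  chart : ι → Set B
  isOpen_chart : ∀ i, IsOpen (chart i)
  exists_mem_chart : ∀ b, ∃ i, b ∈ chart i
  /-- The gauge of each chart. -/
  gauge : ι → B → G
  eventually_transition : ∀ i j b, b ∈ chart i → b ∈ chart j →
    ∀ᶠ b' in 𝓝 b, (gauge j b')⁻¹ * gauge i b' = (gauge j b)⁻¹ * gauge i b

namespace LocalSystem

variable {ι B G : Type*} [TopologicalSpace B] [Group G] (L : LocalSystem ι B G)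
variable {A : Type*} [TopologicalSpace A]

/-- A function with values in a `G`-set, over a map `f` to the base, is flat at `a` if it is locally
constant in each chart. -/
def FlatAt {S : Type*} [MulAction G S] (f : A → B) (h : A → S) (a : A) : Prop :=
  ∀ i, f a ∈ L.chart i →
    ∀ᶠ a' in 𝓝 a, (L.gauge i (f a'))⁻¹ • h a' = (L.gauge i (f a))⁻¹ • h a

variable {L}

/-- Transition functions are locally constant, so flatness can be tested in a single chart around `f
a`. -/
theorem FlatAt.of_chart {S : Type*} [MulAction G S] {f : A → B} {h : A → S} {a : A}
    (hf : ContinuousAt f a) {i : ι} (hi : f a ∈ L.chart i)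
    (H : ∀ᶠ a' in 𝓝 a, (L.gauge i (f a'))⁻¹ • h a' = (L.gauge i (f a))⁻¹ • h a) :
    L.FlatAt f h a := by
  intro j hj
  filter_upwards [H, hf.eventually (L.eventually_transition i j _ hi hj)] with a' h1 h2
  have e : ∀ b s, (L.gauge j b)⁻¹ • (s : S) =
      ((L.gauge j b)⁻¹ * L.gauge i b) • (L.gauge i b)⁻¹ • s := fun b s => by
    rw [mul_smul, smul_inv_smul]
  rw [e, e (f a), h1, h2]

theorem FlatAt.comp {S : Type*} [MulAction G S] {A' : Type*} [TopologicalSpace A'] {f : A → B}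
    {h : A → S} {k : A' → A} {a : A'} (H : L.FlatAt f h (k a)) (hk : ContinuousAt k a) :
    L.FlatAt (f ∘ k) (h ∘ k) a :=
  fun i hi => hk.eventually (H i hi)

theorem FlatAt.congr {S : Type*} [MulAction G S] {f f' : A → B}
    {h h' : A → S} {a : A} (H : L.FlatAt f h a) (hf : f =ᶠ[𝓝 a] f') (hh : h =ᶠ[𝓝 a] h') :
    L.FlatAt f' h' a := by
  intro i hi
  rw [← hf.eq_of_nhds] at hi
  filter_upwards [H i hi, hf, hh] with a' h1 h2 h3
  rw [← h2, ← h3, h1, hf.eq_of_nhds, hh.eq_of_nhds]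

/-- Two flat `G`-valued functions differ locally by a constant on the right. -/
theorem FlatAt.eventually_inv_mul {f : A → B} {g g' : A → G} {a : A} (h : L.FlatAt f g a)
    (h' : L.FlatAt f g' a) : ∀ᶠ a' in 𝓝 a, (g a')⁻¹ * g' a' = (g a)⁻¹ * g' a := by
  obtain ⟨i, hi⟩ := L.exists_mem_chart (f a)
  filter_upwards [h i hi, h' i hi] with a' h1 h2
  simp only [smul_eq_mul] at h1 h2
  have e : ∀ x : A, (g x)⁻¹ * g' x =
      ((L.gauge i (f x))⁻¹ * g x)⁻¹ * ((L.gauge i (f x))⁻¹ * g' x) := fun x => by group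
  rw [e, e a, h1, h2]

/-- The local constants agree on a connected domain. Applied to translates of a flat function on a
universal cover, this produces its periods. -/
theorem exists_eq_mul_of_flat [PreconnectedSpace A] {f : A → B} {g g' : A → G}
    (h : ∀ a, L.FlatAt f g a) (h' : ∀ a, L.FlatAt f g' a) : ∃ c, ∀ a, g' a = g a * c := by
  have hl : IsLocallyConstant fun a => (g a)⁻¹ * g' a :=
    (IsLocallyConstant.iff_eventually_eq _).2 fun a => (h a).eventually_inv_mul (h' a)
  rcases isEmpty_or_nonempty A with hA | ⟨⟨a₀⟩⟩
  · exact ⟨1, fun a => (IsEmpty.false a).elim⟩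
  · refine ⟨(g a₀)⁻¹ * g' a₀, fun a => ?_⟩
    have : (g a)⁻¹ * g' a = (g a₀)⁻¹ * g' a₀ := hl.apply_eq_of_preconnectedSpace _ _
    rw [← this, mul_inv_cancel_left]

variable (L)

/-- The change of the structure group along a homomorphism. -/
def map {G' : Type*} [Group G'] (φ : G →* G') : LocalSystem ι B G' where
  chart := L.chart
  isOpen_chart := L.isOpen_chart
  exists_mem_chart := L.exists_mem_chart
  gauge i b := φ (L.gauge i b)
  eventually_transition i j b hi hj := by
    filter_upwards [L.eventually_transition i j b hi hj] with b' h
    simp only [← map_inv, ← map_mul, h]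

/-- The fibre of the covering associated with a local system, a discrete copy of `G`. -/
@[nolint unusedArguments]
def Fib (_L : LocalSystem ι B G) : Type _ := G

instance : TopologicalSpace L.Fib := ⊥

instance : DiscreteTopology L.Fib := ⟨rfl⟩

/-- The identification of the fibre with `G`. -/
def toFib : G ≃ L.Fib := Equiv.refl G

theorem eventually_eq_of_continuousAt {f : A → L.Fib} {a : A} (hf : ContinuousAt f a) :
    ∀ᶠ a' in 𝓝 a, f a' = f a := by
  have : {f a} ∈ 𝓝 (f a) := by rw [nhds_discrete]; rfl
  exact hf.eventually this

/-- The fibre bundle with discrete fibre defined by a local system. -/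
noncomputable def core : FiberBundleCore ι B L.Fib where
  baseSet := L.chart
  isOpen_baseSet := L.isOpen_chart
  indexAt b := (L.exists_mem_chart b).choose
  mem_baseSet_at b := (L.exists_mem_chart b).choose_spec
  coordChange i j b v := L.toFib ((L.gauge j b)⁻¹ * L.gauge i b * L.toFib.symm v)
  coordChange_self i b _ v := by
    simp
  continuousOn_coordChange i j := by
    rintro ⟨b, v⟩ ⟨⟨hi, hj⟩, -⟩
    refine ContinuousAt.continuousWithinAt ?_
    refine (continuousAt_const (y := L.toFib ((L.gauge j b)⁻¹ * L.gauge i b * L.toFib.symm v))).congr ?_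
    have h1 : ∀ᶠ p : B × L.Fib in 𝓝 (b, v), p.2 = v :=
      L.eventually_eq_of_continuousAt continuousAt_snd
    have h2 := (continuousAt_fst (p := (b, v))).eventually
      (L.eventually_transition i j b hi hj)
    filter_upwards [h1, h2] with p e1 e2
    rw [e2, e1]
  coordChange_comp i j k b _ v := by
    simp [mul_assoc]

/-- The covering space associated with a local system. -/
abbrev Total : Type _ := L.core.TotalSpace

theorem isCoveringMap : IsCoveringMap L.core.proj :=
  FiberBundle.isCoveringMap (F := L.Fib) (E := L.core.Fiber)

/-- The point over `b` with gauge value `g`. -/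
noncomputable def pt (b : B) (g : G) : L.Total :=
  ⟨b, L.toFib ((L.gauge (L.core.indexAt b) b)⁻¹ * g)⟩

/-- The gauge value of a point of the covering. -/
noncomputable def val (e : L.Total) : G := L.gauge (L.core.indexAt e.1) e.1 * L.toFib.symm e.2

@[simp] theorem val_pt (b : B) (g : G) : L.val (L.pt b g) = g := by
  simp [val, pt]

@[simp] theorem pt_proj_val (e : L.Total) : L.pt (L.core.proj e) (L.val e) = e := by
  obtain ⟨b, v⟩ := e
  exact congrArg (Bundle.TotalSpace.mk b) (inv_mul_cancel_left (L.gauge _ b) (L.toFib.symm v))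

theorem localTriv_apply_snd (i : ι) (e : L.Total) :
    (L.core.localTriv i e).2 = L.toFib ((L.gauge i e.1)⁻¹ * L.val e) :=
  congrArg L.toFib (mul_assoc _ _ _)

variable {L}

/-- Together with `flatAt_val` this is the dictionary between maps into the covering and maps into
the base equipped with a flat function. -/
theorem continuous_pt {f : A → B} {g : A → G} (hf : Continuous f) (h : ∀ a, L.FlatAt f g a) :
    Continuous fun a => L.pt (f a) (g a) := by
  refine continuous_iff_continuousAt.2 fun a => ?_
  obtain ⟨i, hi⟩ := L.exists_mem_chart (f a)
  have hS : L.pt (f a) (g a) ∈ (L.core.localTriv i).source := (L.core.mem_localTriv_source i _).2 hi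
  have hN : {a' | L.pt (f a') (g a') ∈ (L.core.localTriv i).source} ∈ 𝓝 a :=
    (hf.continuousAt.eventually ((L.isOpen_chart i).mem_nhds hi))
  refine ((L.core.localTriv i).toOpenPartialHomeomorph.continuousAt_iff_continuousAt_comp_left
    hN).2 ?_
  have e1 : ∀ a', (L.core.localTriv i) (L.pt (f a') (g a')) =
      (f a', L.toFib ((L.gauge i (f a'))⁻¹ * g a')) := fun a' =>
    Prod.ext rfl (by rw [localTriv_apply_snd, val_pt]; rfl)
  have e2 : ContinuousAt (fun a' => (f a', L.toFib ((L.gauge i (f a'))⁻¹ * g a'))) a := by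
    refine hf.continuousAt.prodMk ?_
    refine (continuousAt_const (y := L.toFib ((L.gauge i (f a))⁻¹ * g a))).congr ?_
    filter_upwards [h a i hi] with a' h'
    exact congrArg L.toFib h'.symm
  exact e2.congr (Eventually.of_forall fun a' => (e1 a').symm)

theorem flatAt_val {F : A → L.Total} (hF : Continuous F) (a : A) :
    L.FlatAt (fun a => L.core.proj (F a)) (fun a => L.val (F a)) a := by
  intro i hi
  have hc : ContinuousAt (fun a' => (L.core.localTriv i (F a')).2) a := by
    refine ContinuousAt.comp (g := Prod.snd) continuousAt_snd ?_
    exact ((L.core.localTriv i).continuousOn_toFun.continuousAt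
      ((L.core.localTriv i).open_source.mem_nhds
        ((L.core.mem_localTriv_source i _).2 hi))).comp hF.continuousAt
  have : ∀ᶠ a' in 𝓝 a, (L.core.localTriv i (F a')).2 = (L.core.localTriv i (F a)).2 :=
    L.eventually_eq_of_continuousAt hc
  filter_upwards [this] with a' h
  rw [localTriv_apply_snd, localTriv_apply_snd] at h
  exact L.toFib.injective h

/-- Lift `f` to the covering, which simple connectedness permits, and read off the gauge values. -/
theorem exists_flat [SimplyConnectedSpace A] [LocallyPathConnectedSpace A] {f : A → B}
    (hf : Continuous f) : ∃ g : A → G, ∀ a, L.FlatAt f g a := by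
  obtain ⟨a₀⟩ : Nonempty A := inferInstance
  obtain ⟨F, ⟨-, hF⟩, -⟩ := L.isCoveringMap.existsUnique_continuousMap_lifts ⟨f, hf⟩ a₀
    (L.pt (f a₀) 1) rfl
  refine ⟨fun a => L.val (F a), fun a => ?_⟩
  have := flatAt_val F.continuous a
  exact this.congr (Eventually.of_forall fun a' => congrFun hF a') (Eventually.of_forall fun _ => rfl)

/-- Parallel transport along a loop which is trivial in the abelianized fundamental group is
trivial, if the structure group has order two. -/
theorem eq_of_flat_of_abelianization {B : Type*} [TopologicalSpace B] {L : LocalSystem ι B ℤˣ}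
    {b : B} (γ : Path b b)
    (hγ : Abelianization.of (FundamentalGroup.fromPath (Path.Homotopic.Quotient.mk γ)) = 1)
    {g : unitInterval → ℤˣ} (hg : ∀ t, L.FlatAt γ g t) : g 1 = g 0 := by
  -- The fibre has two points, so its permutations commute and the monodromy factors through the
  -- abelianization.
  have hker : ∀ σ τ : Equiv.Perm (L.core.proj ⁻¹' {b}), σ * τ = τ * σ := by
    let e : (L.core.proj ⁻¹' {b}) ≃ ℤˣ :=
      { toFun := fun x => L.val x.1
        invFun := fun v => ⟨L.pt b v, rfl⟩
        left_inv := fun x => Subtype.ext (by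
          have := L.pt_proj_val x.1
          rwa [show L.core.proj x.1 = b from x.2] at this)
        right_inv := fun v => L.val_pt b v }
    have h2 : ∀ σ τ : Equiv.Perm ℤˣ, σ * τ = τ * σ := by decide
    intro σ τ
    have := h2 (e.permCongrHom σ) (e.permCongrHom τ)
    rw [← map_mul, ← map_mul] at this
    exact e.permCongrHom.injective this
  let : CommGroup (Equiv.Perm (L.core.proj ⁻¹' {b})) :=
    { (inferInstance : Group (Equiv.Perm (L.core.proj ⁻¹' {b}))) with mul_comm := hker }
  have h1 : L.isCoveringMap.monodromyPerm b
      (FundamentalGroup.fromPath (Path.Homotopic.Quotient.mk γ)) = 1 := by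
    rw [← Abelianization.lift_apply_of (L.isCoveringMap.monodromyPerm b), hγ, map_one]
  have h3 := congrArg (fun σ : Equiv.Perm _ => (σ ⟨L.pt b (g 0), rfl⟩ : L.core.proj ⁻¹' {b}).1) h1
  let Γ : Path (L.pt b (g 0)) (L.pt b (g 1)) :=
    { toFun := fun t => L.pt (γ t) (g t)
      continuous_toFun := continuous_pt γ.continuous hg
      source' := by rw [γ.source]
      target' := by rw [γ.target] }
  have h4 := L.isCoveringMap.monodromy_map (Path.Homotopic.Quotient.mk Γ)
  have h5 : (Path.Homotopic.Quotient.mk Γ).map ⟨_, L.isCoveringMap.continuous⟩ =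
      Path.Homotopic.Quotient.mk γ := rfl
  rw [h5] at h4
  have h6 : L.pt b (g 1) = L.pt b (g 0) := (congrArg Subtype.val h4).symm.trans h3
  simpa using congrArg L.val h6

/-- A local system whose covering has infinitely many points of a fibre in one path component has
a base with infinite fundamental group. -/
theorem infinite_fundamentalGroup (b : B) {s : Set G} (hs : s.Infinite)
    (h : ∀ g ∈ s, Joined (L.pt b 1) (L.pt b g)) : Infinite (FundamentalGroup B b) := by
  by_contra hfin
  rw [not_infinite_iff_finite] at hfin
  -- The monodromy orbit of `L.pt b 1` is an image of the fundamental group and contains `L.pt b g`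
  -- for every `g ∈ s`.
  refine hs ((Set.finite_range fun γ : FundamentalGroup B b =>
    L.val (L.isCoveringMap.monodromy γ ⟨L.pt b 1, rfl⟩).1).subset fun g hg => ?_)
  obtain ⟨Γ⟩ := h g hg
  refine ⟨FundamentalGroup.fromPath
    ((Path.Homotopic.Quotient.mk Γ).map ⟨_, L.isCoveringMap.continuous⟩), ?_⟩
  have h4 := L.isCoveringMap.monodromy_map (Path.Homotopic.Quotient.mk Γ)
  exact (congrArg (fun e => L.val e.1) h4).trans (L.val_pt b g)

/-- Right translates of the gauge are flat inside its own chart, so they lift paths contained in it.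
-/
theorem joined_pt_of_chart {b b' : B} (γ : Path b b') {i : ι} (hγ : ∀ t, γ t ∈ L.chart i) (v : G) :
    Joined (L.pt b (L.gauge i b * v)) (L.pt b' (L.gauge i b' * v)) := by
  refine ⟨⟨⟨fun t => L.pt (γ t) (L.gauge i (γ t) * v), continuous_pt γ.continuous fun t => ?_⟩,
    by simp, by simp⟩⟩
  refine FlatAt.of_chart γ.continuous.continuousAt (hγ t) (Eventually.of_forall fun t' => ?_)
  simp

end LocalSystem

/-! ### Linear maps of the punctured solid torus -/

/-- The direction of a complex number, an element of the unit circle. -/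
noncomputable def phase (w : ℂ) : Circle := Circle.exp (Complex.arg w)

theorem norm_mul_phase (w : ℂ) : (‖w‖ : ℂ) * (phase w : ℂ) = w := by
  rw [phase, Circle.coe_exp, Complex.norm_mul_exp_arg_mul_I]

theorem phase_mul {t : ℝ} (ht : 0 < t) (v : Circle) : phase ((t : ℂ) * v) = v := by
  rw [phase, Complex.arg_real_mul _ ht]
  exact Circle.exp_arg v

theorem phase_exp (z : ℂ) : phase (Complex.exp z) = Circle.exp z.im := by
  have h : Complex.exp z = ((Real.exp z.re : ℝ) : ℂ) * (Circle.exp z.im : ℂ) := by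
    rw [Circle.coe_exp, Complex.ofReal_exp, ← Complex.exp_add, Complex.re_add_im]
  rw [h, phase_mul (Real.exp_pos _)]

theorem continuousAt_phase {w : ℂ} (hw : w ≠ 0) : ContinuousAt phase w := by
  have h : ∀ w : ℂ, w ≠ 0 → (phase w : ℂ) = w / ‖w‖ := fun w hw => by
    rw [eq_div_iff (by simpa using hw), mul_comm, norm_mul_phase]
  have hi : IsInducing fun z : Circle => (z : ℂ) := ⟨rfl⟩
  rw [hi.continuousAt_iff]
  refine ContinuousAt.congr (f := fun w : ℂ => w / ‖w‖) ?_ ?_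
  · exact continuousAt_id.div (Complex.continuous_ofReal.comp continuous_norm).continuousAt
      (by simpa using hw)
  · filter_upwards [isOpen_ne.mem_nhds hw] with w' hw'
    exact (h w' hw').symm

/-- The self-map of the solid torus `S¹ × ℂ` which is the identity in the radial coordinate and
linear on the tori. -/
noncomputable def twistedTorusMap (k l m n : ℤ) (x : Circle × ℂ) : Circle × ℂ :=
  (x.1 ^ k * phase x.2 ^ l, (‖x.2‖ : ℂ) * ((x.1 ^ m * phase x.2 ^ n : Circle) : ℂ))

theorem norm_twistedTorusMap (k l m n : ℤ) (x : Circle × ℂ) : ‖(twistedTorusMap k l m n x).2‖ = ‖x.2‖ := by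
  have : ‖((x.1 ^ m * phase x.2 ^ n : Circle) : ℂ)‖ = 1 := Circle.norm_coe _
  rw [twistedTorusMap, norm_mul, this, mul_one, Complex.norm_real, norm_norm]

theorem twistedTorusMap_ne_zero (k l m n : ℤ) {x : Circle × ℂ} (hx : x.2 ≠ 0) :
    (twistedTorusMap k l m n x).2 ≠ 0 := by
  rw [← norm_ne_zero_iff, norm_twistedTorusMap]
  exact norm_ne_zero_iff.2 hx

/-- The hypotheses say that the two integer matrices are inverse to each other; off the core the
maps compose as their matrices do. -/
theorem twistedTorusMap_twistedTorusMap {k l m n k' l' m' n' : ℤ} (h1 : k' * k + l' * m = 1)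
    (h2 : k' * l + l' * n = 0) (h3 : m' * k + n' * m = 0) (h4 : m' * l + n' * n = 1)
    {x : Circle × ℂ} (hx : x.2 ≠ 0) : twistedTorusMap k' l' m' n' (twistedTorusMap k l m n x) = x := by
  have hp : phase (twistedTorusMap k l m n x).2 = x.1 ^ m * phase x.2 ^ n :=
    phase_mul (norm_pos_iff.2 hx) _
  have e : ∀ (u v : Circle) (i j : ℤ), (u ^ k * v ^ l) ^ i * (u ^ m * v ^ n) ^ j =
      u ^ (i * k + j * m) * v ^ (i * l + j * n) := fun u v i j => by
    simp only [mul_zpow, ← zpow_mul, zpow_add]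
    rw [mul_comm k i, mul_comm l i, mul_comm m j, mul_comm n j]
    exact mul_mul_mul_comm _ _ _ _
  refine Prod.ext ?_ ?_
  · change (x.1 ^ k * phase x.2 ^ l) ^ k' * phase (twistedTorusMap k l m n x).2 ^ l' = x.1
    rw [hp, e, h1, h2, zpow_one, zpow_zero, mul_one]
  · change (‖(twistedTorusMap k l m n x).2‖ : ℂ) * (((x.1 ^ k * phase x.2 ^ l) ^ m' *
      phase (twistedTorusMap k l m n x).2 ^ n' : Circle) : ℂ) = x.2
    rw [hp, e, h3, h4, zpow_one, zpow_zero, one_mul, norm_twistedTorusMap, norm_mul_phase]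

theorem continuousAt_twistedTorusMap (k l m n : ℤ) {x : Circle × ℂ} (hx : x.2 ≠ 0) :
    ContinuousAt (twistedTorusMap k l m n) x := by
  have h1 : ContinuousAt (fun x : Circle × ℂ => phase x.2) x :=
    (continuousAt_phase hx).comp continuousAt_snd
  refine ContinuousAt.prodMk ((continuousAt_fst.zpow k).mul (h1.zpow l)) ?_
  refine ContinuousAt.mul ?_ ?_
  · exact (Complex.continuous_ofReal.comp (continuous_norm.comp continuous_snd)).continuousAt
  · exact (by fun_prop : Continuous fun z : Circle => (z : ℂ)).continuousAt.comp
      ((continuousAt_fst.zpow m).mul (h1.zpow n))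

/-- In logarithmic coordinates the map is linear in the two angles, which is how periods are carried
through the gluing. -/
theorem twistedTorusMap_exp (k l m n : ℤ) (t : ℝ) (z : ℂ) :
    twistedTorusMap k l m n (Circle.exp t, Complex.exp z) =
      (Circle.exp (k * t + l * z.im),
        Complex.exp (z.re + (m * t + n * z.im : ℝ) * Complex.I)) := by
  have e : ∀ (i j : ℤ) (s t : ℝ), Circle.exp s ^ i * Circle.exp t ^ j =
      Circle.exp (i * s + j * t) := fun i j s t => by
    rw [Circle.exp_add, ← zsmul_eq_mul, ← zsmul_eq_mul, Circle.exp_zsmul, Circle.exp_zsmul]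
  refine Prod.ext ?_ ?_
  · change Circle.exp t ^ k * phase (Complex.exp z) ^ l = _
    rw [phase_exp, e]
  · change (‖Complex.exp z‖ : ℂ) * ((Circle.exp t ^ m * phase (Complex.exp z) ^ n : Circle) : ℂ) = _
    rw [phase_exp, e, Circle.coe_exp, Complex.norm_exp, Complex.ofReal_exp, ← Complex.exp_add]

/-! ### Topology of the Dehn filling -/

namespace TubularNbhd

variable {K : Set Sphere3} (N : TubularNbhd K)

/-- The parametrization of the punctured tubular neighbourhood by a punctured solid torus,
with values in the knot complement (and with a junk value on the core). -/
noncomputable def punctured (x : Circle × ℂ) : ↥Kᶜ :=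
  ⟨N.toFun (x.1, if x.2 = 0 then 1 else x.2), N.notMem _ (by dsimp only; split_ifs <;> simp [*])⟩

theorem coe_punctured {x : Circle × ℂ} (hx : x.2 ≠ 0) : (N.punctured x : Sphere3) = N.toFun x := by
  simp only [punctured, if_neg hx]

theorem continuousAt_punctured {x : Circle × ℂ} (hx : x.2 ≠ 0) : ContinuousAt N.punctured x := by
  rw [IsInducing.subtypeVal.continuousAt_iff]
  refine N.isOpenEmbedding.continuous.continuousAt.congr ?_
  filter_upwards [continuousAt_snd.eventually (isOpen_ne.mem_nhds hx)] with x' hx'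
  exact (N.coe_punctured hx').symm

theorem punctured_injOn {x y : Circle × ℂ} (hx : x.2 ≠ 0) (hy : y.2 ≠ 0)
    (h : N.punctured x = N.punctured y) : x = y := by
  apply N.isOpenEmbedding.injective
  rw [← N.coe_punctured hx, ← N.coe_punctured hy, h]

theorem isOpen_image_punctured {s : Set (Circle × ℂ)} (hs : IsOpen s) (h : ∀ x ∈ s, x.2 ≠ 0) :
    IsOpen (N.punctured '' s) := by
  have : N.punctured '' s = Subtype.val ⁻¹' (N.toFun '' s) := by
    ext y
    constructor
    · rintro ⟨x, hx, rfl⟩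
      exact ⟨x, hx, (N.coe_punctured (h x hx)).symm⟩
    · rintro ⟨x, hx, e⟩
      exact ⟨x, hx, Subtype.ext ((N.coe_punctured (h x hx)).trans e)⟩
  rw [this]
  exact (N.isOpenEmbedding.isOpenMap _ hs).preimage continuous_subtype_val

/-- The gluing map of the Dehn filling, from the punctured solid torus to the knot complement. -/
noncomputable def gluing (α β γ δ : ℤ) (x : Circle × ℂ) : ↥Kᶜ :=
  N.punctured (twistedTorusMap δ β γ α x)

section

variable {α β γ δ : ℤ}

/-- Polar coordinates turn the relation into the graph of `gluing` off the core. -/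
theorem fillingRel_iff {y z : ↥Kᶜ ⊕ Circle × ℂ} : N.FillingRel α β γ δ y z ↔
    ∃ x : Circle × ℂ, x.2 ≠ 0 ∧ y = Sum.inl (N.gluing α β γ δ x) ∧ z = Sum.inr x := by
  constructor
  · rintro ⟨u, v, t, ht, y, hy⟩
    have hv : (t : ℂ) * (v : ℂ) ≠ 0 :=
      mul_ne_zero (Complex.ofReal_ne_zero.2 ht.ne') (Circle.coe_ne_zero v)
    refine ⟨(u, t * v), hv, congrArg Sum.inl (Subtype.ext ?_), rfl⟩
    rw [hy, gluing, coe_punctured _ (twistedTorusMap_ne_zero _ _ _ _ hv), twistedTorusMap]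
    simp only [phase_mul ht]
    rw [norm_mul, Circle.norm_coe, mul_one, Complex.norm_real, Real.norm_of_nonneg ht.le]
  · rintro ⟨⟨u, w⟩, hw, rfl, rfl⟩
    have h := FillingRel.glue (N := N) (α := α) (β := β) (γ := γ) (δ := δ) u (phase w) ‖w‖
      (norm_pos_iff.2 hw) (N.gluing α β γ δ (u, w)) (by
        rw [gluing, coe_punctured _ (twistedTorusMap_ne_zero _ _ _ _ hw), twistedTorusMap])
    rwa [norm_mul_phase] at h

variable (hdet : α * δ - β * γ = 1)

include hdet in
theorem gluing_injOn {x y : Circle × ℂ} (hx : x.2 ≠ 0) (hy : y.2 ≠ 0)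
    (h : N.gluing α β γ δ x = N.gluing α β γ δ y) : x = y := by
  have h' := N.punctured_injOn (twistedTorusMap_ne_zero _ _ _ _ hx)
    (twistedTorusMap_ne_zero _ _ _ _ hy) h
  have e : ∀ {z : Circle × ℂ}, z.2 ≠ 0 →
      twistedTorusMap α (-β) (-γ) δ (twistedTorusMap δ β γ α z) = z := fun hz =>
    twistedTorusMap_twistedTorusMap (by linarith) (by ring) (by ring) (by linarith) hz
  rw [← e hx, h', e hy]

theorem continuousAt_gluing {x : Circle × ℂ} (hx : x.2 ≠ 0) :
    ContinuousAt (N.gluing α β γ δ) x :=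
  (N.continuousAt_punctured (twistedTorusMap_ne_zero _ _ _ _ hx)).comp
    (continuousAt_twistedTorusMap _ _ _ _ hx)

include hdet in
theorem isOpen_image_gluing {s : Set (Circle × ℂ)} (hs : IsOpen s) (h : ∀ x ∈ s, x.2 ≠ 0) :
    IsOpen (N.gluing α β γ δ '' s) := by
  have e : N.gluing α β γ δ '' s =
      N.punctured '' ({x | x.2 ≠ 0} ∩ twistedTorusMap α (-β) (-γ) δ ⁻¹' s) := by
    ext y
    constructor
    · rintro ⟨x, hx, rfl⟩
      refine ⟨_, ⟨twistedTorusMap_ne_zero _ _ _ _ (h x hx), ?_⟩, rfl⟩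
      rw [Set.mem_preimage, twistedTorusMap_twistedTorusMap (by linarith) (by ring) (by ring)
        (by linarith) (h x hx)]
      exact hx
    · rintro ⟨x, ⟨hx, hxs⟩, rfl⟩
      refine ⟨_, hxs, ?_⟩
      rw [gluing, twistedTorusMap_twistedTorusMap (by linarith) (by ring) (by ring) (by linarith) hx]
  rw [e]
  refine N.isOpen_image_punctured ?_ fun x hx => hx.1
  refine ContinuousOn.isOpen_inter_preimage (fun x hx =>
    (continuousAt_twistedTorusMap _ _ _ _ hx).continuousWithinAt) ?_ hs
  exact isOpen_ne.preimage continuous_snd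

variable (α β γ δ)

/-- The inclusion of the knot complement in the Dehn filling. -/
def inc (x : ↥Kᶜ) : N.DehnFilling α β γ δ := Quot.mk _ (Sum.inl x)

/-- The map of the solid torus to the Dehn filling. -/
def solid (x : Circle × ℂ) : N.DehnFilling α β γ δ := Quot.mk _ (Sum.inr x)

theorem continuous_inc : Continuous (N.inc α β γ δ) := continuous_quot_mk.comp continuous_inl

theorem continuous_solid : Continuous (N.solid α β γ δ) := continuous_quot_mk.comp continuous_inr

theorem inc_gluing {x : Circle × ℂ} (hx : x.2 ≠ 0) :
    N.inc α β γ δ (N.gluing α β γ δ x) = N.solid α β γ δ x :=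
  Quot.sound (N.fillingRel_iff.2 ⟨x, hx, rfl, rfl⟩)

theorem isOpen_iff {s : Set (N.DehnFilling α β γ δ)} : IsOpen s ↔
    IsOpen (N.inc α β γ δ ⁻¹' s) ∧ IsOpen (N.solid α β γ δ ⁻¹' s) :=
  (isQuotientMap_quot_mk (r := N.FillingRel α β γ δ)).isOpen_preimage.symm.trans isOpen_sum_iff

open Classical in
/-- The inverse of the inclusion of the knot complement. -/
noncomputable def toCompl : N.DehnFilling α β γ δ → Option ↥Kᶜ :=
  Quot.lift (Sum.elim some fun x => if x.2 = 0 then none else some (N.gluing α β γ δ x)) (by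
    intro y z h
    obtain ⟨x, hx, rfl, rfl⟩ := N.fillingRel_iff.1 h
    simp [hx])

theorem inc_injective : Function.Injective (N.inc α β γ δ) := fun _ _ h =>
  Option.some_injective _ (congrArg (N.toCompl α β γ δ) h)

theorem inc_eq_solid_iff {y : ↥Kᶜ} {x : Circle × ℂ} :
    N.inc α β γ δ y = N.solid α β γ δ x ↔ x.2 ≠ 0 ∧ y = N.gluing α β γ δ x := by
  constructor
  · intro h
    have h' := congrArg (N.toCompl α β γ δ) h
    by_cases hx : x.2 = 0
    · simp [toCompl, solid, inc, hx] at h'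
    · rw [← N.inc_gluing α β γ δ hx] at h
      exact ⟨hx, N.inc_injective α β γ δ h⟩
  · rintro ⟨hx, rfl⟩
    exact N.inc_gluing α β γ δ hx

theorem isOpenMap_inc : IsOpenMap (N.inc α β γ δ) := by
  intro s hs
  rw [isOpen_iff]
  constructor
  · convert hs
    exact Set.preimage_image_eq _ (N.inc_injective α β γ δ)
  · have e : N.solid α β γ δ ⁻¹' (N.inc α β γ δ '' s) =
        {x : Circle × ℂ | x.2 ≠ 0} ∩ N.gluing α β γ δ ⁻¹' s := by
      ext x
      constructor
      · rintro ⟨y, hy, e⟩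
        obtain ⟨hx, rfl⟩ := (N.inc_eq_solid_iff α β γ δ).1 e
        exact ⟨hx, hy⟩
      · rintro ⟨hx, hy⟩
        exact ⟨_, hy, N.inc_gluing α β γ δ hx⟩
    rw [e]
    exact ContinuousOn.isOpen_inter_preimage
      (fun x hx => (N.continuousAt_gluing hx).continuousWithinAt)
      (isOpen_ne.preimage continuous_snd) hs

include hdet

open Classical in
theorem solid_injective : Function.Injective (N.solid α β γ δ) := by
  -- A left inverse of `solid`: a point in the image of the gluing goes to its unique preimage off
  -- the core.
  let f : N.DehnFilling α β γ δ → Option (Circle × ℂ) :=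
    Quot.lift (Sum.elim (fun y => if h : ∃ x : Circle × ℂ, x.2 ≠ 0 ∧ y = N.gluing α β γ δ x then
      some h.choose else none) some) (by
    intro y z h
    obtain ⟨x, hx, rfl, rfl⟩ := N.fillingRel_iff.1 h
    have H : ∃ x' : Circle × ℂ, x'.2 ≠ 0 ∧ N.gluing α β γ δ x = N.gluing α β γ δ x' := ⟨x, hx, rfl⟩
    rw [Sum.elim_inl, Sum.elim_inr, dif_pos H]
    exact congrArg some (N.gluing_injOn hdet hx H.choose_spec.1 H.choose_spec.2).symm)
  intro x y h
  exact Option.some_injective _ (congrArg f h)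

theorem isOpenMap_solid : IsOpenMap (N.solid α β γ δ) := by
  intro s hs
  rw [isOpen_iff]
  constructor
  · have e : N.inc α β γ δ ⁻¹' (N.solid α β γ δ '' s) =
        N.gluing α β γ δ '' ({x : Circle × ℂ | x.2 ≠ 0} ∩ s) := by
      ext y
      constructor
      · rintro ⟨x, hx, e⟩
        obtain ⟨hx0, rfl⟩ := (N.inc_eq_solid_iff α β γ δ).1 e.symm
        exact ⟨x, ⟨hx0, hx⟩, rfl⟩
      · rintro ⟨x, ⟨hx0, hx⟩, rfl⟩
        exact ⟨x, hx, (N.inc_gluing α β γ δ hx0).symm⟩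
    rw [e]
    exact N.isOpen_image_gluing hdet ((isOpen_ne.preimage continuous_snd).inter hs)
      fun x hx => hx.1
  · convert hs
    exact Set.preimage_image_eq _ (N.solid_injective α β γ δ hdet)

end

end TubularNbhd

/-! ### Extension of local systems over Dehn fillings -/

theorem IsOpenMap.eventually_nhds {X Y : Type*} [TopologicalSpace X] [TopologicalSpace Y]
    {f : X → Y} (hf : IsOpenMap f) {x : X} {P : Y → Prop} (h : ∀ᶠ x' in 𝓝 x, P (f x')) :
    ∀ᶠ y in 𝓝 (f x), P y :=
  hf.nhds_le x h

/-- A local section of the exponential map `ℝ → S¹`. -/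
structure CircleSection where
  /-- The section. -/
  toFun : Circle → ℝ
  /-- Its domain. -/
  dom : Set Circle
  isOpen_dom : IsOpen dom
  continuousOn : ContinuousOn toFun dom
  exp_toFun : ∀ u ∈ dom, Circle.exp (toFun u) = u

theorem CircleSection.exists_mem_dom (u : Circle) : ∃ σ : CircleSection, u ∈ σ.dom := by
  obtain ⟨t, rfl⟩ := Circle.exp_surjective u
  obtain ⟨e, he, h⟩ := isLocalHomeomorph_circleExp t
  refine ⟨⟨e.symm, e.target, e.open_target, e.continuousOn_symm, fun u hu => ?_⟩, ?_⟩
  · rw [h]; exact e.right_inv hu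
  · change Circle.exp t ∈ e.target
    rw [congrFun h t]
    exact e.map_source he

/-- The difference of the sections is continuous with values in 2πℤ, hence locally constant. -/
theorem CircleSection.eventually_sub (σ τ : CircleSection) {u : Circle} (hσ : u ∈ σ.dom)
    (hτ : u ∈ τ.dom) : ∃ k : ℤ, ∀ᶠ u' in 𝓝 u,
      σ.toFun u' = τ.toFun u' + 2 * Real.pi * k := by
  have hex : ∀ u' ∈ σ.dom ∩ τ.dom, ∃ k : ℤ, σ.toFun u' = τ.toFun u' + 2 * Real.pi * k := by
    rintro u' ⟨h1, h2⟩
    have := (σ.exp_toFun u' h1).trans (τ.exp_toFun u' h2).symm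
    obtain ⟨m, hm⟩ := Circle.exp_eq_exp.1 this
    exact ⟨m, by rw [hm]; ring⟩
  obtain ⟨k, hk⟩ := hex u ⟨hσ, hτ⟩
  refine ⟨k, ?_⟩
  have hc : ContinuousAt (fun u' => σ.toFun u' - τ.toFun u') u :=
    (σ.continuousOn.continuousAt (σ.isOpen_dom.mem_nhds hσ)).sub
      (τ.continuousOn.continuousAt (τ.isOpen_dom.mem_nhds hτ))
  have hb := hc.eventually (Metric.ball_mem_nhds _ Real.two_pi_pos)
  filter_upwards [hb, (σ.isOpen_dom.inter τ.isOpen_dom).mem_nhds ⟨hσ, hτ⟩] with u' h1 h2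
  obtain ⟨k', hk'⟩ := hex u' h2
  rw [Real.dist_eq, hk', hk] at h1
  have h3 : τ.toFun u' + 2 * Real.pi * k' - τ.toFun u' - (τ.toFun u + 2 * Real.pi * k - τ.toFun u) =
      2 * Real.pi * ((k' - k : ℤ) : ℝ) := by push_cast; ring
  rw [h3, abs_mul, abs_of_pos Real.two_pi_pos] at h1
  have h4 : |((k' - k : ℤ) : ℝ)| < 1 :=
    lt_of_mul_lt_mul_left (h1.trans_eq (mul_one _).symm) Real.two_pi_pos.le
  rw [← Int.cast_abs] at h4
  have h5 : |k' - k| < 1 := by exact_mod_cast h4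
  have h6 : k' = k := by rw [Int.abs_lt_one_iff] at h5; linarith
  rw [hk', h6]

namespace TubularNbhd

variable {K : Set Sphere3} (N : TubularNbhd K) {α β γ δ : ℤ} (hdet : α * δ - β * γ = 1)
variable {ι G : Type*} [Group G] (L : LocalSystem ι ↥Kᶜ G)

/-- The extension of a local system over a Dehn filling, given a flat function `S` on the universal
cover of the punctured solid torus whose periods in the direction of the meridian are trivial. -/
noncomputable def extend (S : ℝ → ℂ → G) (E : ℤ → G) {ε : ℝ} (hε : 0 < ε)
    (hflat : ∀ t w, w ≠ 0 → ‖w‖ < ε → L.FlatAt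
      (fun x : ℝ × ℂ => N.gluing α β γ δ (Circle.exp x.1, x.2)) (fun x => S x.1 x.2) (t, w))
    (hper : ∀ t w (k : ℤ), S (t + 2 * Real.pi * k) w = S t w * E k) :
    LocalSystem (ι ⊕ CircleSection) (N.DehnFilling α β γ δ) G where
  chart := Sum.elim (fun i => N.inc α β γ δ '' L.chart i)
    fun σ => N.solid α β γ δ '' {x | x.1 ∈ σ.dom ∧ ‖x.2‖ < ε}
  isOpen_chart := by
    rintro (i | σ)
    · exact N.isOpenMap_inc α β γ δ _ (L.isOpen_chart i)
    · exact N.isOpenMap_solid α β γ δ hdet _ ((σ.isOpen_dom.preimage continuous_fst).inter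
        (isOpen_lt (continuous_norm.comp continuous_snd) continuous_const))
  exists_mem_chart := by
    have h1 : ∀ x, ∃ i, N.inc α β γ δ x ∈ N.inc α β γ δ '' L.chart i := fun x =>
      (L.exists_mem_chart x).imp fun i hi => Set.mem_image_of_mem _ hi
    rintro ⟨x | x⟩
    · obtain ⟨i, hi⟩ := h1 x
      exact ⟨Sum.inl i, hi⟩
    · change ∃ i, N.solid α β γ δ x ∈ _
      by_cases hx : x.2 = 0
      · obtain ⟨σ, hσ⟩ := CircleSection.exists_mem_dom x.1
        exact ⟨Sum.inr σ, Set.mem_image_of_mem _ ⟨hσ, by rw [hx, norm_zero]; exact hε⟩⟩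
      · obtain ⟨i, hi⟩ := h1 (N.gluing α β γ δ x)
        exact ⟨Sum.inl i, (N.inc_gluing α β γ δ hx) ▸ hi⟩
  gauge := Sum.elim (fun i => Function.extend (N.inc α β γ δ) (L.gauge i) 1)
    fun σ => Function.extend (N.solid α β γ δ) (fun x => S (σ.toFun x.1) x.2) 1
  -- Core points lie only in charts of the solid torus. So flatness of `S` matters only off the
  -- core, while between two charts of the solid torus the transition is a period `E k`.
  eventually_transition := by
    have hX : ∀ i x, Function.extend (N.inc α β γ δ) (L.gauge i) 1 (N.inc α β γ δ x) =
        L.gauge i x := fun i x => (N.inc_injective α β γ δ).extend_apply _ _ _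
    have hT : ∀ (σ : CircleSection) x, Function.extend (N.solid α β γ δ)
        (fun x => S (σ.toFun x.1) x.2) 1 (N.solid α β γ δ x) = S (σ.toFun x.1) x.2 := fun σ x =>
      (N.solid_injective α β γ δ hdet).extend_apply _ _ _
    have hXT : ∀ i (σ : CircleSection) y, y ∈ N.inc α β γ δ '' L.chart i →
        y ∈ N.solid α β γ δ '' {x | x.1 ∈ σ.dom ∧ ‖x.2‖ < ε} → ∀ᶠ y' in 𝓝 y,
        (Function.extend (N.inc α β γ δ) (L.gauge i) 1 y')⁻¹ * Function.extend (N.solid α β γ δ)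
          (fun x => S (σ.toFun x.1) x.2) 1 y' =
        (Function.extend (N.inc α β γ δ) (L.gauge i) 1 y)⁻¹ * Function.extend (N.solid α β γ δ)
          (fun x => S (σ.toFun x.1) x.2) 1 y := by
      rintro i σ _ ⟨x, hx, rfl⟩ ⟨⟨u, w⟩, ⟨hu, hw⟩, e⟩
      obtain ⟨hw0, rfl⟩ := (N.inc_eq_solid_iff α β γ δ).1 e.symm
      rw [← e]
      refine (N.isOpenMap_solid α β γ δ hdet).eventually_nhds ?_
      have hk : ContinuousAt (fun x : Circle × ℂ => (σ.toFun x.1, x.2)) (u, w) :=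
        ContinuousAt.prodMk (ContinuousAt.comp
          (σ.continuousOn.continuousAt (σ.isOpen_dom.mem_nhds hu)) continuousAt_fst) continuousAt_snd
      have h1 := hk.eventually (hflat (σ.toFun u) w hw0 hw i (by
        simpa only [σ.exp_toFun u hu] using hx))
      filter_upwards [h1, continuousAt_fst.eventually (σ.isOpen_dom.mem_nhds hu),
        continuousAt_snd.eventually (isOpen_ne.mem_nhds hw0)] with x h1 h2 h3
      have h4 : ∀ x : Circle × ℂ, x.1 ∈ σ.dom → x.2 ≠ 0 →
          Function.extend (N.inc α β γ δ) (L.gauge i) 1 (N.solid α β γ δ x) =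
            L.gauge i (N.gluing α β γ δ (Circle.exp (σ.toFun x.1), x.2)) := fun x hx h0 => by
        rw [← N.inc_gluing α β γ δ h0, hX, σ.exp_toFun _ hx]
      rw [hT, hT, h4 x h2 h3, h4 _ hu hw0]
      exact h1
    rintro (i | σ) (j | τ) y hy hy'
    · obtain ⟨x, hx, rfl⟩ := hy
      obtain ⟨x', hx', e⟩ := hy'
      obtain rfl := N.inc_injective α β γ δ e
      refine (N.isOpenMap_inc α β γ δ).eventually_nhds ?_
      filter_upwards [L.eventually_transition i j x' hx hx'] with x h
      simpa only [Sum.elim_inl, hX] using h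
    · filter_upwards [hXT i τ y hy hy'] with y' h
      simpa using congrArg (·⁻¹) h
    · exact hXT j σ y hy' hy
    · obtain ⟨x, hx, rfl⟩ := hy
      obtain ⟨x', hx', e⟩ := hy'
      obtain rfl := N.solid_injective α β γ δ hdet e
      refine (N.isOpenMap_solid α β γ δ hdet).eventually_nhds ?_
      obtain ⟨k, hk⟩ := σ.eventually_sub τ hx.1 hx'.1
      have h1 : ∀ x : Circle × ℂ, σ.toFun x.1 = τ.toFun x.1 + 2 * Real.pi * k →
          (S (τ.toFun x.1) x.2)⁻¹ * S (σ.toFun x.1) x.2 = E k := fun x h => by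
        rw [h, hper, inv_mul_cancel_left]
      filter_upwards [continuousAt_fst.eventually hk] with x h
      simp only [Sum.elim_inr, hT]
      rw [h1 x h, h1 x' hk.self_of_nhds]

/-- On the universal cover of the torus, a flat function of a local system of order two is
periodic in the direction of the preferred longitude. -/
theorem exists_flat_sign (hN : N.IsPreferred) (L : LocalSystem ι ↥Kᶜ ℤˣ) :
    ∃ (e : ℝ × ℂ → ℤˣ) (c : ℤˣ),
      (∀ x, L.FlatAt (fun x : ℝ × ℂ => N.punctured (Circle.exp x.1, Complex.exp x.2)) e x) ∧
      ∀ t z (k l : ℤ), e (t + 2 * Real.pi * k, z + 2 * Real.pi * l * Complex.I) =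
        e (t, z) * c ^ l := by
  have hf : Continuous fun x : ℝ × ℂ => N.punctured (Circle.exp x.1, Complex.exp x.2) :=
    continuous_iff_continuousAt.2 fun x => (N.continuousAt_punctured (Complex.exp_ne_zero _)).comp
      (f := fun x : ℝ × ℂ => (Circle.exp x.1, Complex.exp x.2)) (by fun_prop)
  obtain ⟨e, he⟩ := L.exists_flat hf
  have hshift : ∀ v : ℝ × ℂ, Circle.exp v.1 = 1 → Complex.exp v.2 = 1 →
      ∃ c, ∀ x, e (x + v) = e x * c := by
    intro v h1 h2
    refine LocalSystem.exists_eq_mul_of_flat he fun x => ?_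
    refine ((he (x + v)).comp (k := fun x => x + v) (by fun_prop)).congr
      (Eventually.of_forall fun y => ?_) (Eventually.of_forall fun y => rfl)
    simp [Circle.exp_add, Complex.exp_add, h1, h2]
  -- `c₁` is the period along the longitude and `c` the one along the meridian. The segment from
  -- `(0, 0)` to `(2π, 0)` covers the preferred longitude, which forces `c₁ = 1`.
  obtain ⟨c₁, hc₁⟩ := hshift (2 * Real.pi, 0) (by simp) (by simp)
  obtain ⟨c, hc⟩ := hshift (0, 2 * Real.pi * Complex.I) (by simp) (by simp)
  have hc₁1 : c₁ = 1 := by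
    have h1 := LocalSystem.eq_of_flat_of_abelianization N.longitude hN
      (g := fun t => e (2 * Real.pi * t, 0)) (fun t => by
        refine ((he (2 * Real.pi * (t : ℝ), 0)).comp
          (k := fun t : unitInterval => ((2 * Real.pi * (t : ℝ) : ℝ), (0 : ℂ)))
          (by fun_prop)).congr (Eventually.of_forall fun s => ?_) (Eventually.of_forall fun y => rfl)
        refine Subtype.ext ?_
        rw [Function.comp_apply, coe_punctured _ (Complex.exp_ne_zero _)]
        simp [longitude])
    have h2 := hc₁ (0, 0)
    simp only [Set.Icc.coe_one, mul_one, Set.Icc.coe_zero, mul_zero] at h1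
    simp only [Prod.mk_add_mk, zero_add, add_zero] at h2
    rw [h1] at h2
    exact (left_eq_mul.1 h2)
  subst hc₁1
  have hk : ∀ (k : ℤ) x, e (x + ((2 * Real.pi * k : ℝ), (0 : ℂ))) = e x := by
    intro k
    induction k with
    | zero => intro x; simp only [Int.cast_zero, mul_zero]; exact congrArg e (add_zero x)
    | succ k ih =>
      intro x
      have h1 : x + (2 * Real.pi * ((k + 1 : ℤ) : ℝ), (0 : ℂ)) =
          x + (2 * Real.pi * (k : ℤ), 0) + (2 * Real.pi, 0) := by
        refine Prod.ext ?_ ?_ <;> simp; ring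
      rw [h1, hc₁, mul_one, ih]
    | pred k ih =>
      intro x
      have h1 : x + (2 * Real.pi * ((-k - 1 : ℤ) : ℝ), (0 : ℂ)) + (2 * Real.pi, 0) =
          x + (2 * Real.pi * (-k : ℤ), 0) := by
        refine Prod.ext ?_ ?_ <;> simp; ring
      rw [← mul_one (e _), ← hc₁, h1, ih]
  have hl : ∀ (l : ℤ) x, e (x + ((0 : ℝ), 2 * Real.pi * l * Complex.I)) = e x * c ^ l := by
    intro l
    induction l with
    | zero =>
      intro x
      simp only [Int.cast_zero, mul_zero, zero_mul, zpow_zero, mul_one]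
      exact congrArg e (add_zero x)
    | succ l ih =>
      intro x
      have h1 : x + ((0 : ℝ), 2 * Real.pi * ((l + 1 : ℤ) : ℂ) * Complex.I) =
          x + (0, 2 * Real.pi * (l : ℤ) * Complex.I) + (0, 2 * Real.pi * Complex.I) := by
        refine Prod.ext ?_ ?_ <;> simp; ring
      rw [h1, hc, ih, zpow_add_one, mul_assoc]
    | pred l ih =>
      intro x
      have h1 : x + ((0 : ℝ), 2 * Real.pi * ((-l - 1 : ℤ) : ℂ) * Complex.I) +
          (0, 2 * Real.pi * Complex.I) = x + (0, 2 * Real.pi * (-l : ℤ) * Complex.I) := by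
        refine Prod.ext ?_ ?_ <;> simp; ring
      rw [zpow_sub_one, ← mul_assoc, ← ih x, eq_mul_inv_iff_mul_eq, ← hc, h1]
  refine ⟨e, c, he, fun t z k l => ?_⟩
  have h1 : ((t + 2 * Real.pi * k, z + 2 * Real.pi * l * Complex.I) : ℝ × ℂ) =
      (t, z) + (0, 2 * Real.pi * l * Complex.I) + (2 * Real.pi * k, 0) := by
    refine Prod.ext ?_ ?_ <;> simp
  rw [h1, hk, hl]

include hdet in
/-- A holonomy criterion. If near the knot a local system can be reduced to a subgroup `H`
on which a homomorphism to `ℤˣ` is bijective, then the local system extends over the Dehn fillings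
with even meridian coefficient along a tubular neighbourhood with the preferred framing. -/
theorem exists_extension (hN : N.IsPreferred) (hα : Even α) (sgn : G →* ℤˣ) {H : Subgroup G}
    (hH : ∀ z ∈ H, sgn z = 1 → z = 1) {ρ : G} (hρ : ρ ∈ H) (hsρ : sgn ρ = -1)
    {V : Set Sphere3} (hV : IsOpen V) (hKV : K ⊆ V) (h : ↥Kᶜ → G ⧸ H)
    (hh : ∀ x : ↥Kᶜ, (x : Sphere3) ∈ V → L.FlatAt id h x) :
    ∃ L' : LocalSystem (ι ⊕ CircleSection) (N.DehnFilling α β γ δ) G,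
      (∀ i, L'.chart (Sum.inl i) = N.inc α β γ δ '' L.chart i) ∧
      ∀ i x, L'.gauge (Sum.inl i) (N.inc α β γ δ x) = L.gauge i x := by
  obtain ⟨e₀, c₀, he₀, hper₀⟩ := N.exists_flat_sign hN (L.map sgn)
  -- the flat sign function in the coordinates of the filling
  let e : ℝ → ℂ → ℤˣ := fun t z =>
    e₀ (δ * t + β * z.im, z.re + (γ * t + α * z.im : ℝ) * Complex.I)
  have heflat : ∀ t z, (L.map sgn).FlatAt
      (fun x : ℝ × ℂ => N.gluing α β γ δ (Circle.exp x.1, Complex.exp x.2))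
      (fun x => e x.1 x.2) (t, z) := by
    intro t z
    refine ((he₀ (δ * t + β * z.im, z.re + (γ * t + α * z.im : ℝ) * Complex.I)).comp
      (k := fun x : ℝ × ℂ => ((δ * x.1 + β * x.2.im, x.2.re +
        (γ * x.1 + α * x.2.im : ℝ) * Complex.I) : ℝ × ℂ)) (a := (t, z)) ?_).congr
      (Eventually.of_forall fun x => ?_) (Eventually.of_forall fun x => rfl)
    · fun_prop
    · simp only [Function.comp_apply, gluing, twistedTorusMap_exp]
  have heper : ∀ t z (k l : ℤ), e (t + 2 * Real.pi * k) (z + 2 * Real.pi * l * Complex.I) =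
      e t z * (c₀ ^ γ) ^ k := by
    intro t z k l
    have h1 := hper₀ (δ * t + β * z.im) (z.re + (γ * t + α * z.im : ℝ) * Complex.I)
      (δ * k + β * l) (γ * k + α * l)
    obtain ⟨α', rfl⟩ := hα
    -- The meridian of the solid torus contributes an even power of `c₀`, and `c₀` has square 1.
    have h2 : c₀ ^ (γ * k + (α' + α') * l) = (c₀ ^ γ) ^ k := by
      rw [zpow_add, ← two_mul, mul_assoc 2, zpow_mul c₀ 2, zpow_ofNat, Int.units_sq, one_zpow, mul_one,
        zpow_mul]
    rw [h2] at h1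
    rw [← h1]
    simp only [e]
    congr 1
    refine Prod.ext ?_ ?_ <;> simp <;> ring
  set c := c₀ ^ γ with hc
  obtain ⟨ς, hςH, hςs⟩ : ∃ ς : ℤˣ → G, (∀ u, ς u ∈ H) ∧ ∀ u, sgn (ς u) = u := by
    refine ⟨fun u => if u = 1 then 1 else ρ, fun u => ?_, fun u => ?_⟩
    · dsimp only; split_ifs; exacts [H.one_mem, hρ]
    · rcases Int.units_eq_one_or u with rfl | rfl <;> simp [hsρ]
  -- Since `sgn` is bijective on `H`, an element of `G` amounts to a coset of `H` and a sign:
  -- `huniq` is uniqueness, `pick` existence.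
  have huniq : ∀ g g' : G, (g : G ⧸ H) = g' → sgn g = sgn g' → g = g' := fun g g' h1 h2 => by
    have := hH _ (QuotientGroup.eq.1 h1) (by rw [map_mul, map_inv, h2, inv_mul_cancel])
    rwa [inv_mul_eq_one] at this
  obtain ⟨pick, hpick1, hpick2⟩ : ∃ pick : G ⧸ H → ℤˣ → G,
      (∀ κ u, ((pick κ u : G) : G ⧸ H) = κ) ∧ ∀ κ u, sgn (pick κ u) = u := by
    refine ⟨fun κ u => κ.out * ς ((sgn κ.out)⁻¹ * u), fun κ u => ?_, fun κ u => ?_⟩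
    · rw [QuotientGroup.mk_mul_of_mem _ (hςH _), QuotientGroup.out_eq']
    · rw [map_mul, hςs, mul_inv_cancel_left]
  obtain ⟨ε, hε, hεV⟩ : ∃ ε > 0, ∀ x : Circle × ℂ, ‖x.2‖ < ε → N.toFun x ∈ V := by
    have hopen : IsOpen (N.toFun ⁻¹' V) := hV.preimage N.isOpenEmbedding.continuous
    have hsub : (Set.univ : Set Circle) ×ˢ {(0 : ℂ)} ⊆ N.toFun ⁻¹' V := by
      rintro ⟨u, w⟩ ⟨-, hw⟩
      exact hKV (N.image_core.subset ⟨(u, w), hw, rfl⟩)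
    obtain ⟨s, t, -, ht, hs, h0t, hst⟩ :=
      generalized_tube_lemma isCompact_univ isCompact_singleton hopen hsub
    obtain ⟨ε, hε, hb⟩ := Metric.isOpen_iff.1 ht 0 (h0t rfl)
    refine ⟨ε, hε, fun x hx => hst ⟨hs (Set.mem_univ _), hb ?_⟩⟩
    rwa [mem_ball_zero_iff]
  -- The coset comes from `h` and the sign from `e`; the branch of the logarithm is immaterial
  -- because `e` has no period along the meridian. On the core only the period relation is required,
  -- and the floor provides it.
  let S : ℝ → ℂ → G := fun t w =>
    if w = 0 then ς (c ^ ⌊t / (2 * Real.pi)⌋)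
    else pick (h (N.gluing α β γ δ (Circle.exp t, w))) (e t (Complex.log w))
  refine ⟨N.extend hdet L S (fun k => ς (c ^ k)) hε ?_ ?_, fun i => rfl, fun i x =>
    (N.inc_injective α β γ δ).extend_apply _ _ _⟩
  · intro t w hw hwε i hi
    have hcont : ContinuousAt (fun x : ℝ × ℂ => N.gluing α β γ δ (Circle.exp x.1, x.2)) (t, w) :=
      ContinuousAt.comp (f := fun x : ℝ × ℂ => (Circle.exp x.1, x.2)) (N.continuousAt_gluing hw)
        (by fun_prop)
    have h1 : ∀ᶠ x : ℝ × ℂ in 𝓝 (t, w), _ :=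
      hcont.eventually (hh (N.gluing α β γ δ (Circle.exp t, w)) (by
        rw [gluing, coe_punctured _ (twistedTorusMap_ne_zero _ _ _ _ hw)]
        exact hεV _ (by rwa [norm_twistedTorusMap])) i hi)
    -- A branch of the logarithm continuous at `w`, even when `w` lies on the cut of the principal
    -- branch.
    let lg : ℂ → ℂ := fun w' => Complex.log (w' / w) + Complex.log w
    have hlg : ContinuousAt (fun x : ℝ × ℂ => (x.1, lg x.2)) (t, w) := by
      refine continuousAt_fst.prodMk (ContinuousAt.add (ContinuousAt.clog ?_ ?_) continuousAt_const)
      · exact continuousAt_snd.div_const w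
      · rw [div_self hw]; exact Complex.one_mem_slitPlane
    have hexp : ∀ w', w' ≠ 0 → Complex.exp (lg w') = w' := fun w' hw' => by
      rw [Complex.exp_add, Complex.exp_log (div_ne_zero hw' hw), Complex.exp_log hw,
        div_mul_cancel₀ _ hw]
    have helg : ∀ t' w', w' ≠ 0 → e t' (lg w') = e t' (Complex.log w') := fun t' w' hw' => by
      obtain ⟨n, hn⟩ := Complex.exp_eq_exp_iff_exists_int.1
        ((hexp w' hw').trans (Complex.exp_log hw').symm)
      have := heper t' (Complex.log w') 0 n
      rw [zpow_zero, mul_one, Int.cast_zero, mul_zero, add_zero] at this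
      rw [← this, hn]
      congr 1
      ring
    have h2 := hlg.eventually (heflat t (lg w) i (by
      change N.gluing α β γ δ (Circle.exp t, Complex.exp (lg w)) ∈ L.chart i
      rwa [hexp w hw]))
    filter_upwards [h1, h2, continuousAt_snd.eventually (isOpen_ne.mem_nhds hw)] with x h1 h2 hx
    have hx' : x.2 ≠ 0 := hx
    have hL : ∀ (u : ↥Kᶜ), (L.map sgn).gauge i u = sgn (L.gauge i u) := fun u => rfl
    simp only [hexp _ hx', hexp w hw, helg _ _ hx', helg _ _ hw, hL, smul_eq_mul] at h2
    simp only [S, if_neg hx', if_neg hw, smul_eq_mul]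
    refine huniq _ _ ?_ ?_
    · have hm : ∀ (a : G) κ u, ((a * pick κ u : G) : G ⧸ H) = a • κ := fun a κ u => by
        rw [← hpick1 κ u, hpick1 κ u]
        conv_rhs => rw [← hpick1 κ u]
        rfl
      rw [hm, hm]
      exact h1
    · rw [map_mul, map_mul, hpick2, hpick2, map_inv, map_inv]
      exact h2
  · intro t w k
    have hexp : Circle.exp (t + 2 * Real.pi * k) = Circle.exp t := Circle.exp_eq_exp.2 ⟨k, by ring⟩
    simp only [S, hexp]
    split_ifs with hw
    · refine huniq _ _ ?_ ?_
      · rw [QuotientGroup.eq]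
        exact H.mul_mem (H.inv_mem (hςH _)) (H.mul_mem (hςH _) (hςH _))
      · rw [map_mul, hςs, hςs, hςs, ← zpow_add]
        congr 1
        rw [← Int.floor_add_intCast]
        congr 1
        have := Real.pi_ne_zero
        field_simp
    · refine huniq _ _ ?_ ?_
      · rw [hpick1, QuotientGroup.mk_mul_of_mem _ (hςH _), hpick1]
      · rw [map_mul, hςs, hpick2, hpick2]
        simpa using heper t (Complex.log w) k 0

end TubularNbhd

/-! ### Infinite triangle reflection groups -/

namespace TriangleGroup

open Matrix

/-- The reflections of the Tits representation of a triangle group, in the basis of simple roots;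
`a`, `b`, `c` are twice the cosines of the angles between the mirrors `01`, `12`, `02`. -/
def reflection (a b c : ℝ) : Fin 3 → Matrix (Fin 3) (Fin 3) ℝ :=
  ![!![-1, a, c; 0, 1, 0; 0, 0, 1], !![1, 0, 0; a, -1, b; 0, 0, 1], !![1, 0, 0; 0, 1, 0; c, b, -1]]

variable (a b c : ℝ)

theorem reflection_mul_self (i : Fin 3) : reflection a b c i * reflection a b c i = 1 := by
  fin_cases i <;> ext j k <;> fin_cases j <;> fin_cases k <;>
    simp [reflection, Matrix.mul_apply, Fin.sum_univ_three]

theorem det_reflection (i : Fin 3) : (reflection a b c i).det = -1 := by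
  fin_cases i <;> simp [reflection, Matrix.det_fin_three]

/-- The trigonometric criterion for a finite order. -/
theorem pow_eq_one_of_cubic {A B : Matrix (Fin 3) (Fin 3) ℝ} (hBA : B * A = 1) {n : ℕ} {θ : ℝ}
    (hs : Real.sin θ ≠ 0) (hθ : n * θ = 2 * Real.pi)
    (hA : (A * A - (2 * Real.cos θ) • A + 1) * (A - 1) = 0) : A ^ n = 1 := by
  -- On the range of `A - 1` the matrix `A` is a root of X² - 2 cos θ X + 1, so the powers follow
  -- the recurrence of sin kθ.
  have hkey : ∀ k : ℕ, Real.sin θ • (A ^ k * (A - 1)) =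
      Real.sin (k * θ) • (A * (A - 1)) - Real.sin (k * θ - θ) • (A - 1) := by
    have hsq : A * (A * (A - 1)) = (2 * Real.cos θ) • (A * (A - 1)) - (A - 1) := by
      rw [add_mul, sub_mul, one_mul, smul_mul_assoc, mul_assoc] at hA
      rw [← sub_eq_zero, ← hA]; abel
    intro k
    induction k with
    | zero => simp
    | succ k ih =>
      rw [pow_succ', mul_assoc, ← mul_smul_comm, ih, mul_sub, mul_smul_comm, mul_smul_comm, hsq,
        smul_sub, smul_smul]
      have h1 : Real.sin ((k + 1 : ℕ) * θ - θ) = Real.sin (k * θ) := by congr 1; push_cast; ring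
      have h2 : Real.sin ((k + 1 : ℕ) * θ) =
          Real.sin (k * θ) * (2 * Real.cos θ) - Real.sin (k * θ - θ) := by
        rw [show ((k + 1 : ℕ) : ℝ) * θ = k * θ + θ by push_cast; ring, Real.sin_add, Real.sin_sub]
        ring
      rw [h1, h2, sub_smul]
      abel
  have h1 : (A ^ n - 1) * (A - 1) = 0 := by
    have := hkey n
    rw [hθ, Real.sin_two_pi, zero_smul, zero_sub, Real.sin_two_pi_sub, neg_smul, neg_neg] at this
    rw [sub_mul, one_mul, sub_eq_zero]
    exact smul_right_injective _ hs this
  have hcomm : (A - 1) * (A * A - (2 * Real.cos θ) • A + 1) = 0 := by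
    rw [← hA]
    simp only [sub_mul, mul_sub, add_mul, mul_add, smul_mul_assoc, mul_smul_comm, one_mul, mul_one,
      mul_assoc, smul_sub]
    abel
  have h2 : (A ^ n - 1) * (A * A - (2 * Real.cos θ) • A + 1) = 0 := by
    rw [← geom_sum_mul, mul_assoc, hcomm, mul_zero]
  have hc : 2 - 2 * Real.cos θ ≠ 0 := by
    intro h
    apply hs
    have : Real.cos θ = 1 := by linarith
    have h3 := Real.sin_sq_add_cos_sq θ
    rw [this] at h3
    nlinarith
  -- The two factors of the cubic are coprime: the quadratic one minus `(A - 1)²` is `(2 - 2 cos θ)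
  -- A`, and `A` is invertible.
  have h3 : (2 - 2 * Real.cos θ) • ((A ^ n - 1) * A) = 0 := by
    have e : (2 - 2 * Real.cos θ) • ((A ^ n - 1) * A) =
        (A ^ n - 1) * (A * A - (2 * Real.cos θ) • A + 1) - (A ^ n - 1) * (A - 1) * (A - 1) := by
      rw [mul_assoc _ (A - 1), ← mul_sub, ← mul_smul_comm]
      congr 1
      rw [sub_smul, two_smul]
      noncomm_ring
    rw [e, h1, h2, zero_mul, sub_zero]
  have h4 : (A ^ n - 1) * A = 0 := (smul_eq_zero.1 h3).resolve_left hc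
  have hAB : A * B = 1 := mul_eq_one_comm.1 hBA
  have h5 : A ^ n - 1 = 0 := by
    calc A ^ n - 1 = (A ^ n - 1) * A * B := by rw [mul_assoc, hAB, mul_one]
      _ = 0 := by rw [h4, zero_mul]
  exact sub_eq_zero.1 h5

/-- The product is the identity modulo the plane spanned by the two simple roots. On that plane it
has determinant 1 and trace x² - 2, so the quadratic factor kills the plane by Cayley–Hamilton. -/
theorem cubic_identity (i j : Fin 3) (x : ℝ) (h : (reflection a b c i) i j = x)
    (h' : (reflection a b c j) j i = x) (hij : i ≠ j) :
    let A := reflection a b c i * reflection a b c j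
    (A * A - (x ^ 2 - 2) • A + 1) * (A - 1) = 0 := by
  subst h
  fin_cases i <;> fin_cases j <;> first | exact absurd rfl hij | skip
  all_goals
    ext k l
    fin_cases k <;> fin_cases l <;>
      simp [reflection, Matrix.mul_apply, Fin.sum_univ_three] <;> ring

/-- For x = 2 cos(π/n) the trace x² - 2 is 2 cos(2π/n), so `pow_eq_one_of_cubic` applies with θ =
2π/n. The case n = 2, where sin θ = 0, is computed directly. -/
theorem reflection_mul_pow {i j : Fin 3} (hij : i ≠ j) {n : ℕ} (hn : 2 ≤ n)
    (h : (reflection a b c i) i j = 2 * Real.cos (Real.pi / n))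
    (h' : (reflection a b c j) j i = 2 * Real.cos (Real.pi / n)) :
    (reflection a b c i * reflection a b c j) ^ n = 1 := by
  rcases hn.eq_or_lt with rfl | hn
  · rw [Nat.cast_ofNat, Real.cos_pi_div_two, mul_zero] at h h'
    fin_cases i <;> fin_cases j <;> first | exact absurd rfl hij | skip
    all_goals
      simp [reflection] at h
      subst h
      ext k l
      fin_cases k <;> fin_cases l <;>
        simp [reflection, pow_two, Matrix.mul_apply, Fin.sum_univ_three]
  · have hn0 : (0 : ℝ) < n := by positivity
    have hn3 : (3 : ℝ) ≤ n := by exact_mod_cast hn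
    refine pow_eq_one_of_cubic (B := reflection a b c j * reflection a b c i)
      (θ := 2 * (Real.pi / n)) ?_ ?_ ?_ ?_
    · rw [mul_assoc, ← mul_assoc (reflection a b c i), reflection_mul_self, one_mul,
        reflection_mul_self]
    · refine (Real.sin_pos_of_pos_of_lt_pi (by positivity) ?_).ne'
      rw [mul_div_assoc', div_lt_iff₀ hn0]
      nlinarith [Real.pi_pos]
    · field_simp
    · have := cubic_identity a b c i j _ h h' hij
      convert this using 5
      rw [Real.cos_two_mul]; ring

/-- A coordinate of an orbit of the Coxeter element grows. -/
theorem coxeter_pow_ne {a b c : ℝ} (ha : 0 ≤ a) (hb : 0 < b) (hc : 0 ≤ c)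
    (hs : 4 ≤ a ^ 2 + b ^ 2 + c ^ 2 + a * b * c) {k : ℕ} (hk : k ≠ 0) :
    (reflection a b c 0 * reflection a b c 1 * reflection a b c 2) ^ k ≠ 1 := by
  set s := a ^ 2 + b ^ 2 + c ^ 2 + a * b * c with hsd
  set C := reflection a b c 0 * reflection a b c 1 * reflection a b c 2 with hC
  -- The vector is minus the last column of C + 1. The characteristic polynomial of C is (X + 1)(X²
  -- - (s - 2)X + 1), so the quadratic factor kills this vector.
  let u : ℕ → ℝ := fun k => ((C ^ k) *ᵥ ![a * b + c, b, 0]) 1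
  have hCe : C = !![a ^ 2 + a * b * c + c ^ 2 - 1, a * b ^ 2 - a + b * c, -(a * b) - c;
      a + b * c, b ^ 2 - 1, -b; c, b, -1] := by
    ext i j
    fin_cases i <;> fin_cases j <;>
      simp [hC, reflection] <;> ring
  have hCH : C *ᵥ (C *ᵥ ![a * b + c, b, 0]) =
      (s - 2) • (C *ᵥ ![a * b + c, b, 0]) - ![a * b + c, b, 0] := by
    rw [hCe, hsd]
    ext i
    fin_cases i <;> simp [Matrix.mulVec, dotProduct, Fin.sum_univ_three] <;> ring
  have hrec : ∀ k, u (k + 2) = (s - 2) * u (k + 1) - u k := by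
    intro k
    simp only [u, pow_succ C (k + 1), pow_succ C k, ← Matrix.mulVec_mulVec, hCH, Matrix.mulVec_sub,
      Matrix.mulVec_smul]
    rfl
  have h0 : u 0 = b := by simp [u]
  have h1 : u 1 = b * (s - 1) + a * c := by
    simp [u, hCe, hsd, Matrix.mulVec, dotProduct, Fin.sum_univ_three]
    ring
  -- Since s - 2 ≥ 2, the increments of a positive increasing solution of the recurrence do not
  -- decrease.
  have hmono : ∀ k, 0 < u k ∧ u k < u (k + 1) := by
    intro k
    induction k with
    | zero => rw [zero_add, h0, h1]; exact ⟨hb, by nlinarith [mul_nonneg ha hc]⟩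
    | succ k ih =>
      have h2 : 0 < u (k + 1) := ih.1.trans ih.2
      exact ⟨h2, by rw [hrec]; nlinarith [ih.1, ih.2]⟩
  intro h
  have h3 : u k = u 0 := by simp only [u, h, pow_zero]
  exact hk ((strictMono_nat_of_lt_succ fun k => (hmono k).2).injective h3)

/-- Equality holds for x + y + z = π. In general z ≤ π - (x + y) gives cos z + cos x cos y ≥ sin x
sin y ≥ 0, and squaring yields the claim. -/
theorem four_le_of_angle_sum {x y z : ℝ} (hx : 0 ≤ x) (hy : 0 ≤ y) (hz : 0 ≤ z)
    (h : x + y + z ≤ Real.pi) :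
    4 ≤ (2 * Real.cos x) ^ 2 + (2 * Real.cos y) ^ 2 + (2 * Real.cos z) ^ 2 +
      2 * Real.cos x * (2 * Real.cos y) * (2 * Real.cos z) := by
  have h1 : Real.cos (Real.pi - (x + y)) ≤ Real.cos z :=
    Real.cos_le_cos_of_nonneg_of_le_pi hz (by linarith) (by linarith)
  rw [Real.cos_pi_sub, Real.cos_add] at h1
  have h2 : 0 ≤ Real.sin x * Real.sin y :=
    mul_nonneg (Real.sin_nonneg_of_nonneg_of_le_pi hx (by linarith))
      (Real.sin_nonneg_of_nonneg_of_le_pi hy (by linarith))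
  have h3 : (Real.sin x * Real.sin y) ^ 2 ≤ (Real.cos z + Real.cos x * Real.cos y) ^ 2 :=
    pow_le_pow_left₀ h2 (by linarith) 2
  rw [mul_pow, Real.sin_sq, Real.sin_sq] at h3
  nlinarith

/-- The sign of a unit of `ℝ`. -/
noncomputable def signUnits : ℝˣ →* ℤˣ where
  toFun u := if 0 < (u : ℝ) then 1 else -1
  map_one' := by simp
  map_mul' u v := by
    rcases lt_or_gt_of_ne u.ne_zero with hu | hu <;> rcases lt_or_gt_of_ne v.ne_zero with hv | hv
    · simp [hu.not_gt, hv.not_gt, mul_pos_of_neg_of_neg hu hv]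
    · simp [hu.not_gt, hv, (mul_neg_of_neg_of_pos hu hv).not_gt]
    · simp [hu, hv.not_gt, (mul_neg_of_pos_of_neg hu hv).not_gt]
    · simp [hu, hv]

/-- The reflection group of a Euclidean or hyperbolic triangle. -/
theorem exists_reflection_group {p q m : ℤ} (hp : 3 ≤ |p|) (hq : 3 ≤ |q|) (hm : 2 ≤ |m|)
    (h : 1 / |(p : ℝ)| + 1 / |(q : ℝ)| + 1 / |(m : ℝ)| ≤ 1) :
    ∃ (G : Type) (_ : Group G) (g : Fin 3 → G) (sgn : G →* ℤˣ),
      (∀ i, g i * g i = 1) ∧ (∀ i, sgn (g i) = -1) ∧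
      (g 0 * g 1) ^ p = 1 ∧ (g 1 * g 2) ^ q = 1 ∧ (g 2 * g 0) ^ m = 1 ∧
      (Subgroup.closure (Set.range g) : Set G).Infinite := by
  have key : ∀ n : ℤ, 2 ≤ |n| → (2 : ℕ) ≤ n.natAbs ∧ (0 : ℝ) < |(n : ℝ)| ∧
      ((n.natAbs : ℕ) : ℝ) = |(n : ℝ)| ∧ 0 ≤ Real.pi / |(n : ℝ)| ∧
      0 ≤ 2 * Real.cos (Real.pi / |(n : ℝ)|) := by
    intro n hn
    have h1 : (2 : ℝ) ≤ |(n : ℝ)| := by exact_mod_cast hn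
    refine ⟨by zify; exact hn, by linarith, by rw [Nat.cast_natAbs, Int.cast_abs], by positivity, ?_⟩
    refine mul_nonneg zero_le_two (Real.cos_nonneg_of_neg_pi_div_two_le_of_le ?_ ?_)
    · have := Real.pi_pos
      have : 0 ≤ Real.pi / |(n : ℝ)| := by positivity
      linarith
    · exact div_le_div_of_nonneg_left Real.pi_pos.le zero_lt_two h1
  obtain ⟨hp2, hp0, hpe, hpa, hpc⟩ := key p (by linarith)
  obtain ⟨hq2, hq0, hqe, hqa, -⟩ := key q (by linarith)
  obtain ⟨hm2, hm0, hme, hma, hmc⟩ := key m hm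
  set a := 2 * Real.cos (Real.pi / |(p : ℝ)|) with had
  set b := 2 * Real.cos (Real.pi / |(q : ℝ)|) with hbd
  set c := 2 * Real.cos (Real.pi / |(m : ℝ)|) with hcd
  have hb : 0 < b := by
    refine mul_pos zero_lt_two (Real.cos_pos_of_mem_Ioo ⟨by linarith [Real.pi_pos], ?_⟩)
    have : (3 : ℝ) ≤ |(q : ℝ)| := by exact_mod_cast hq
    exact div_lt_div_of_pos_left Real.pi_pos zero_lt_two (by linarith)
  have hs : 4 ≤ a ^ 2 + b ^ 2 + c ^ 2 + a * b * c := by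
    refine four_le_of_angle_sum hpa hqa hma ?_
    have := mul_le_mul_of_nonneg_left h Real.pi_pos.le
    rw [mul_one] at this
    calc _ = Real.pi * (1 / |(p : ℝ)| + 1 / |(q : ℝ)| + 1 / |(m : ℝ)|) := by ring
      _ ≤ _ := this
  let g : Fin 3 → (Matrix (Fin 3) (Fin 3) ℝ)ˣ := fun i =>
    ⟨reflection a b c i, reflection a b c i, reflection_mul_self a b c i,
      reflection_mul_self a b c i⟩
  have hpow : ∀ (i j : Fin 3) (n : ℤ), ((reflection a b c i * reflection a b c j) ^ n.natAbs = 1) →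
      (g i * g j) ^ n = 1 := by
    intro i j n h
    have h1 : (g i * g j) ^ n.natAbs = 1 := Units.ext (by
      rw [Units.val_pow_eq_pow_val]; exact h)
    rcases Int.natAbs_eq n with e | e
    · rw [e, zpow_natCast, h1]
    · rw [e, _root_.zpow_neg, zpow_natCast, h1, inv_one]
  refine ⟨_, inferInstance, g, signUnits.comp (Units.map Matrix.detMonoidHom), fun i =>
    Units.ext (reflection_mul_self a b c i), fun i => ?_, ?_, ?_, ?_, ?_⟩
  · have : ¬ (0 : ℝ) < (reflection a b c i).det := by rw [det_reflection]; norm_num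
    exact if_neg this
  · exact hpow 0 1 p (reflection_mul_pow a b c (by decide) hp2 (by rw [hpe]; rfl)
      (by rw [hpe]; rfl))
  · exact hpow 1 2 q (reflection_mul_pow a b c (by decide) hq2 (by rw [hqe]; rfl)
      (by rw [hqe]; rfl))
  · exact hpow 2 0 m (reflection_mul_pow a b c (by decide) hm2 (by rw [hme]; rfl)
      (by rw [hme]; rfl))
  · have hmem : ∀ i, g i ∈ Subgroup.closure (Set.range g) := fun i =>
      Subgroup.subset_closure (Set.mem_range_self i)
    have hinj : Function.Injective fun k : ℕ => (g 0 * g 1 * g 2) ^ k := by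
      rw [injective_pow_iff_not_isOfFinOrder, isOfFinOrder_iff_pow_eq_one]
      rintro ⟨k, hk, h⟩
      refine coxeter_pow_ne hpc hb hmc hs hk.ne' ?_
      have := congrArg Units.val h
      rwa [Units.val_pow_eq_pow_val] at this
    exact (Set.infinite_range_of_injective hinj).mono (by
      rintro _ ⟨k, rfl⟩
      exact Subgroup.pow_mem _ (mul_mem (mul_mem (hmem 0) (hmem 1)) (hmem 2)) k)

end TriangleGroup

/-! ### Alternating words in a dihedral group -/

/-- Alternating products of two involutions `x` and `y`: the elements
`…, x * y, x, 1, y, …`, extended to the left by alternating factors. -/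
def alternatingProd {G : Type*} [Group G] (x y : G) (k : ℤ) : G :=
  (x * y) ^ (k / 2) * if Even k then 1 else x

section alternatingProd

variable {G : Type*} [Group G] {x y : G}

theorem alternatingProd_two_mul (k : ℤ) : alternatingProd x y (2 * k) = (x * y) ^ k := by
  simp [alternatingProd]

theorem alternatingProd_two_mul_add_one (k : ℤ) :
    alternatingProd x y (2 * k + 1) = (x * y) ^ k * x := by
  rw [alternatingProd, if_neg (by simp), show (2 * k + 1) / 2 = k by omega]

@[simp] theorem alternatingProd_zero : alternatingProd x y 0 = 1 := by
  simp [alternatingProd]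

theorem alternatingProd_add_two (k : ℤ) :
    alternatingProd x y (k + 2) = x * y * alternatingProd x y k := by
  rw [alternatingProd, alternatingProd, show (k + 2) / 2 = 1 + k / 2 by omega, zpow_add, zpow_one,
    mul_assoc]
  simp

variable (hx : x * x = 1) (hy : y * y = 1)

include hx in
-- This is the matching on the left of a column, where the floors in front and behind differ by 2.
theorem mul_alternatingProd_sub_one (k : ℤ) :
    y * alternatingProd x y (k - 1) = x * alternatingProd x y (k + 1) := by
  rw [show k + 1 = k - 1 + 2 by ring, alternatingProd_add_two, mul_assoc, ← mul_assoc x x, hx,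
    one_mul]

theorem alternatingProd_eq_sub_one_mul (k : ℤ) :
    alternatingProd x y k = alternatingProd x y (k - 1) * if Even k then y else x := by
  rcases Int.even_or_odd' k with ⟨l, rfl | rfl⟩
  · rw [if_pos (by simp), alternatingProd_two_mul, show 2 * l - 1 = 2 * (l - 1) + 1 by ring,
      alternatingProd_two_mul_add_one, mul_assoc, ← zpow_add_one, sub_add_cancel]
  · rw [if_neg (by simp), alternatingProd_two_mul_add_one, add_sub_cancel_right,
      alternatingProd_two_mul]

include hx hy in
theorem inv_mul_of_involutions : (x * y)⁻¹ = y * x := by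
  rw [mul_inv_rev, inv_eq_of_mul_eq_one_right hx, inv_eq_of_mul_eq_one_right hy]

include hx in
theorem mul_zpow_mul_self (k : ℤ) : x * (x * y) ^ k * x = (y * x) ^ k := by
  have h : y * x = x * (x * y) * x⁻¹ := by
    rw [← mul_assoc x x, hx, one_mul, inv_eq_of_mul_eq_one_right hx]
  rw [h, conj_zpow, inv_eq_of_mul_eq_one_right hx]

include hx hy in
-- This matches the front and back gauges at an end of a column; it is how the relation `(x * y) ^ n
-- = 1` enters the local system.
theorem mul_alternatingProd_of_zpow_eq_one {n : ℤ} (h : (x * y) ^ n = 1) :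
    y * alternatingProd x y (n - 1) = alternatingProd x y n := by
  have hinv : ∀ l : ℤ, (y * x) ^ l = (x * y) ^ (-l) := fun l => by
    rw [← inv_mul_of_involutions hx hy, inv_zpow, zpow_neg]
  rw [mul_alternatingProd_sub_one hx]
  rcases Int.even_or_odd' n with ⟨l, rfl | rfl⟩
  · rw [alternatingProd_two_mul_add_one, alternatingProd_two_mul, ← mul_assoc,
      mul_zpow_mul_self hx, hinv, zpow_neg, inv_eq_iff_mul_eq_one, ← zpow_add, ← two_mul, h]
  · rw [show 2 * l + 1 + 1 = 2 * (l + 1) by ring, alternatingProd_two_mul,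
      alternatingProd_two_mul_add_one, ← mul_left_inj x, mul_zpow_mul_self hx, mul_assoc _ x x, hx,
      mul_one, hinv, zpow_neg, inv_eq_iff_mul_eq_one, ← zpow_add, show l + 1 + l = 2 * l + 1 by ring,
      h]

include hx hy in
theorem alternatingProd_mul_self_of_odd {n : ℤ} (hn : Odd n) :
    alternatingProd x y n * alternatingProd x y n = 1 := by
  obtain ⟨l, rfl⟩ := hn
  rw [alternatingProd_two_mul_add_one, mul_assoc, ← mul_assoc x, mul_zpow_mul_self hx,
    ← inv_mul_of_involutions hx hy, inv_zpow, mul_inv_cancel]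

include hx hy in
-- For odd n the two reflections are conjugate by the alternating word of length n, which therefore
-- carries cosets fixed by one to cosets fixed by the other.
theorem mul_alternatingProd_comm_of_odd {n : ℤ} (hn : Odd n) (h : (x * y) ^ n = 1) :
    x * alternatingProd x y n = alternatingProd x y n * y := by
  obtain ⟨l, rfl⟩ := hn
  rw [alternatingProd_two_mul_add_one, ← mul_assoc, mul_zpow_mul_self hx,
    ← inv_mul_of_involutions hx hy, inv_zpow, inv_eq_iff_mul_eq_one, mul_assoc _ x y, ← zpow_add_one,
    ← zpow_add, show l + (l + 1) = 2 * l + 1 by ring, h]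

end alternatingProd

/-! ### Geometry and gauge of one twisted column -/

theorem eventually_floor_eq {A : Type*} [TopologicalSpace A] {f : A → ℝ} {a : A}
    (hf : ContinuousAt f a) {k : ℤ} (h1 : (k : ℝ) < f a) (h2 : f a < k + 1) :
    ∀ᶠ a' in 𝓝 a, ⌊f a'⌋ = k := by
  filter_upwards [hf.eventually (lt_mem_nhds h1), hf.eventually (gt_mem_nhds h2)] with a' h3 h4
  exact Int.floor_eq_iff.2 ⟨h3.le, h4⟩

theorem eventually_floor_eq_floor {A : Type*} [TopologicalSpace A] {f : A → ℝ} {a : A}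
    (hf : ContinuousAt f a) (h : ∀ k : ℤ, f a ≠ k) : ∀ᶠ a' in 𝓝 a, ⌊f a'⌋ = ⌊f a⌋ :=
  eventually_floor_eq hf (lt_of_le_of_ne (Int.floor_le _) (h _).symm) (Int.lt_floor_add_one _)

theorem eventually_floor_eq_or {A : Type*} [TopologicalSpace A] {f : A → ℝ} {a : A}
    (hf : ContinuousAt f a) {k : ℤ} (h1 : (k : ℝ) - 1 < f a) (h2 : f a < k + 1) :
    ∀ᶠ a' in 𝓝 a, ⌊f a'⌋ = k ∨ ⌊f a'⌋ = k - 1 := by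
  filter_upwards [hf.eventually (lt_mem_nhds h1), hf.eventually (gt_mem_nhds h2)] with a' h3 h4
  rcases le_or_gt (k : ℝ) (f a') with h | h
  · exact Or.inl (Int.floor_eq_iff.2 ⟨h, h4⟩)
  · exact Or.inr (Int.floor_eq_iff.2 ⟨by push_cast; exact h3.le, by push_cast; linarith⟩)

namespace Pretzel

/-- The square of the distance to the axis of the column centred at `c`. -/
def sqRadius (c : ℝ) (P : Space3) : ℝ := (P 0 - c) ^ 2 + P 1 ^ 2

/-- The number of half twists of a column up to the height of `P`. -/
noncomputable def turns (n : ℤ) (P : Space3) : ℝ := n * (max (-1) (min 1 (P 2)) + 1) / 2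

/-- The component of `P` perpendicular to the diameter joining the strands of a column. -/
noncomputable def offset (c : ℝ) (n : ℤ) (P : Space3) : ℝ :=
  (P 0 - c) * Real.sin (Real.pi * turns n P) - P 1 * Real.cos (Real.pi * turns n P)

/-- The component of `P` along the diameter joining the strands of a column. -/
noncomputable def along (c : ℝ) (n : ℤ) (P : Space3) : ℝ :=
  (P 0 - c) * Real.cos (Real.pi * turns n P) + P 1 * Real.sin (Real.pi * turns n P)

/-- The unoriented angle of `P` around the axis of a column, in half turns. -/
noncomputable def angle (c : ℝ) (P : Space3) : ℝ :=
  Real.arccos ((P 0 - c) / √(sqRadius c P)) / Real.pi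

variable {c : ℝ} {n : ℤ} {P : Space3}

@[fun_prop]
theorem continuous_sqRadius : Continuous (sqRadius c) := by unfold sqRadius; fun_prop

@[fun_prop]
theorem continuous_turns : Continuous (turns n) := by unfold turns; fun_prop

@[fun_prop]
theorem continuous_offset : Continuous (offset c n) := by unfold offset; fun_prop

@[fun_prop]
theorem continuous_along : Continuous (along c n) := by unfold along; fun_prop

theorem continuousAt_angle (h : 0 < sqRadius c P) : ContinuousAt (angle c) P := by
  unfold angle
  refine ContinuousAt.div_const (Real.continuous_arccos.continuousAt.comp ?_) _
  refine ContinuousAt.div (by fun_prop) (by fun_prop) (Real.sqrt_pos.2 h).ne'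

theorem angle_nonneg : 0 ≤ angle c P := div_nonneg (Real.arccos_nonneg _) Real.pi_pos.le

theorem angle_le_one : angle c P ≤ 1 := div_le_one_of_le₀ (Real.arccos_le_pi _) Real.pi_pos.le

theorem pi_mul_angle : Real.pi * angle c P = Real.arccos ((P 0 - c) / √(sqRadius c P)) :=
  mul_div_cancel₀ _ Real.pi_ne_zero

theorem sqrt_mul_cos (h : 0 < sqRadius c P) :
    √(sqRadius c P) * Real.cos (Real.pi * angle c P) = P 0 - c := by
  have h1 : |P 0 - c| ≤ √(sqRadius c P) := Real.abs_le_sqrt (by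
    unfold sqRadius; nlinarith [sq_nonneg (P 1)])
  have h2 := Real.sqrt_pos.2 h
  rw [abs_le] at h1
  rw [pi_mul_angle, Real.cos_arccos, mul_div_cancel₀ _ h2.ne']
  · rw [le_div_iff₀ h2]; linarith
  · rw [div_le_iff₀ h2]; linarith

theorem sqrt_mul_sin (h : 0 < sqRadius c P) :
    √(sqRadius c P) * Real.sin (Real.pi * angle c P) = |P 1| := by
  have h1 : 0 ≤ √(sqRadius c P) * Real.sin (Real.pi * angle c P) := by
    rw [pi_mul_angle, Real.sin_arccos]; positivity
  rw [← abs_of_nonneg h1, ← sq_eq_sq_iff_abs_eq_abs, mul_pow, Real.sin_sq, mul_sub, ← mul_pow,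
    sqrt_mul_cos h, Real.sq_sqrt h.le, sqRadius]
  ring

/-- In polar coordinates the point is at angle π · `angle` in front and -π · `angle` behind. So the
surface `offset = 0` is where `turns - angle`, respectively `turns + angle`, is an integer. -/
theorem offset_eq_front (h : 0 < sqRadius c P) (hY : 0 ≤ P 1) :
    offset c n P = √(sqRadius c P) * Real.sin (Real.pi * (turns n P - angle c P)) := by
  have h1 := sqrt_mul_cos h
  have h2 := sqrt_mul_sin h
  rw [abs_of_nonneg hY] at h2
  rw [offset, ← h1, ← h2, mul_sub, Real.sin_sub]
  ring

theorem along_eq_front (h : 0 < sqRadius c P) (hY : 0 ≤ P 1) :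
    along c n P = √(sqRadius c P) * Real.cos (Real.pi * (turns n P - angle c P)) := by
  have h1 := sqrt_mul_cos h
  have h2 := sqrt_mul_sin h
  rw [abs_of_nonneg hY] at h2
  rw [along, ← h1, ← h2, mul_sub, Real.cos_sub]
  ring

theorem offset_eq_back (h : 0 < sqRadius c P) (hY : P 1 ≤ 0) :
    offset c n P = √(sqRadius c P) * Real.sin (Real.pi * (turns n P + angle c P)) := by
  have h1 := sqrt_mul_cos h
  have h2 := sqrt_mul_sin h
  rw [abs_of_nonpos hY, eq_neg_iff_add_eq_zero, add_comm, ← eq_neg_iff_add_eq_zero] at h2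
  rw [offset, ← h1, h2, mul_add, Real.sin_add]
  ring

theorem along_eq_back (h : 0 < sqRadius c P) (hY : P 1 ≤ 0) :
    along c n P = √(sqRadius c P) * Real.cos (Real.pi * (turns n P + angle c P)) := by
  have h1 := sqrt_mul_cos h
  have h2 := sqrt_mul_sin h
  rw [abs_of_nonpos hY, eq_neg_iff_add_eq_zero, add_comm, ← eq_neg_iff_add_eq_zero] at h2
  rw [along, ← h1, h2, mul_add, Real.cos_add]
  ring

theorem angle_mem_Ioo (hY : P 1 ≠ 0) : angle c P ∈ Set.Ioo (0 : ℝ) 1 := by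
  have h : 0 < sqRadius c P := by unfold sqRadius; positivity
  have h2 := sqrt_mul_sin h
  refine ⟨lt_of_le_of_ne angle_nonneg fun e => ?_, lt_of_le_of_ne angle_le_one fun e => ?_⟩
  · rw [← e] at h2; simp at h2; exact hY (abs_eq_zero.1 h2.symm)
  · rw [e] at h2; simp at h2; exact hY (abs_eq_zero.1 h2.symm)

theorem angle_eq_zero (hY : P 1 = 0) (hX : c < P 0) : angle c P = 0 := by
  have : √(sqRadius c P) = P 0 - c := by
    rw [sqRadius, hY]; simpa using Real.sqrt_sq (sub_nonneg.2 hX.le)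
  rw [angle, this, div_self (sub_pos.2 hX).ne', Real.arccos_one, zero_div]

theorem angle_eq_one (hY : P 1 = 0) (hX : P 0 < c) : angle c P = 1 := by
  have : √(sqRadius c P) = -(P 0 - c) := by
    rw [sqRadius, hY, ← neg_sq]; simpa using Real.sqrt_sq (sub_nonneg.2 hX.le)
  rw [angle, this, div_neg, div_self (sub_neg.2 hX).ne, Real.arccos_neg_one,
    div_self Real.pi_ne_zero]

theorem turns_of_one_le (h : 1 ≤ P 2) : turns n P = n := by
  rw [turns, min_eq_left h]; norm_num

theorem turns_of_le_neg_one (h : P 2 ≤ -1) : turns n P = 0 := by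
  rw [turns, min_eq_right (by linarith), max_eq_left h]; norm_num

theorem sin_pi_mul_int (k : ℤ) : Real.sin (Real.pi * k) = 0 := by
  rw [mul_comm]; exact Real.sin_int_mul_pi k

theorem sin_pi_mul_ne_zero {t : ℝ} (h : Real.sin (Real.pi * t) ≠ 0) (k : ℤ) : t ≠ k := by
  rintro rfl
  exact h (sin_pi_mul_int k)

theorem exists_int_of_sin_eq_zero {t : ℝ} (h : Real.sin (Real.pi * t) = 0) : ∃ k : ℤ, t = k := by
  obtain ⟨k, hk⟩ := Real.sin_eq_zero_iff.1 h
  exact ⟨k, mul_left_cancel₀ Real.pi_ne_zero (by rw [← hk, mul_comm])⟩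

/-- Beyond the ends `turns` is frozen at an integer, so the swept surface is the plane of
projection. -/
theorem offset_of_one_le_abs (h : 1 ≤ |P 2|) : offset c n P = 0 ↔ P 1 = 0 := by
  have h0 : ∃ k : ℤ, turns n P = k := by
    rcases le_abs.1 h with h | h
    · exact ⟨n, turns_of_one_le h⟩
    · exact ⟨0, by rw [turns_of_le_neg_one (by linarith), Int.cast_zero]⟩
  obtain ⟨k, hk⟩ := h0
  have h1 : Real.cos (Real.pi * k) ≠ 0 := by
    intro h2
    have := Real.sin_sq_add_cos_sq (Real.pi * k)
    rw [h2, sin_pi_mul_int] at this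
    norm_num at this
  rw [offset, hk, sin_pi_mul_int, mul_zero, zero_sub, neg_eq_zero, mul_eq_zero, or_iff_left h1]

/-- The gauge of a column, with generators `x` on its left and `y` on its right. -/
noncomputable def columnGauge {G : Type*} [Group G] (x y : G) (c : ℝ) (n : ℤ) (P : Space3) : G :=
  if 1 ≤ P 2 then alternatingProd x y n else if P 2 ≤ -1 then 1 else
  if 0 ≤ P 1 then y * alternatingProd x y ⌊turns n P - angle c P⌋
  else alternatingProd x y ⌊turns n P + angle c P⌋

section columnGauge

variable {G : Type*} [Group G] {x y : G}

theorem columnGauge_front (h : |P 2| < 1) (hY : 0 ≤ P 1) :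
    columnGauge x y c n P = y * alternatingProd x y ⌊turns n P - angle c P⌋ := by
  rw [abs_lt] at h
  rw [columnGauge, if_neg (by linarith), if_neg (by linarith), if_pos hY]

theorem columnGauge_back (h : |P 2| < 1) (hY : P 1 < 0) :
    columnGauge x y c n P = alternatingProd x y ⌊turns n P + angle c P⌋ := by
  rw [abs_lt] at h
  rw [columnGauge, if_neg (by linarith), if_neg (by linarith), if_neg (by linarith)]

theorem eventually_columnGauge_of_one_lt_abs (h : 1 < |P 2|) :
    ∀ᶠ P' in 𝓝 P, columnGauge x y c n P' = columnGauge x y c n P := by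
  have hc : ContinuousAt (fun P : Space3 => P 2) P := by fun_prop
  rcases lt_abs.1 h with h | h
  · filter_upwards [hc.eventually (lt_mem_nhds h)] with P' h'
    rw [columnGauge, columnGauge, if_pos h'.le, if_pos h.le]
  · filter_upwards [hc.eventually (gt_mem_nhds (show P 2 < -1 by linarith))] with P' h'
    rw [columnGauge, columnGauge, if_neg (by linarith), if_pos h'.le, if_neg (by linarith),
      if_pos (by linarith)]

variable (hx : x * x = 1) (hy : y * y = 1) (hn : (x * y) ^ n = 1)

theorem continuousAt_front (hr : 0 < sqRadius c P) :
    ContinuousAt (fun P => turns n P - angle c P) P :=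
  (continuous_turns.continuousAt).sub (continuousAt_angle hr)

theorem continuousAt_back (hr : 0 < sqRadius c P) :
    ContinuousAt (fun P => turns n P + angle c P) P :=
  (continuous_turns.continuousAt).add (continuousAt_angle hr)

include hx hy hn in
-- The floors jump only on `offset = 0`, and at the heights ±1 the front and back values agree with
-- the constant beyond the end.
theorem eventually_columnGauge_of_ne_zero (hY : P 1 ≠ 0) (h : 1 ≤ |P 2| ∨ offset c n P ≠ 0) :
    ∀ᶠ P' in 𝓝 P, columnGauge x y c n P' = columnGauge x y c n P := by
  have hr : 0 < sqRadius c P := by unfold sqRadius; positivity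
  have hc1 : ContinuousAt (fun P : Space3 => P 1) P := by fun_prop
  have hc2 : ContinuousAt (fun P : Space3 => P 2) P := by fun_prop
  have hc2' : ContinuousAt (fun P : Space3 => |P 2|) P := by fun_prop
  obtain ⟨hA0, hA1⟩ := angle_mem_Ioo (c := c) hY
  rcases lt_trichotomy 1 |P 2| with h1 | h1 | h1
  · exact eventually_columnGauge_of_one_lt_abs h1
  · obtain ⟨N, hN, hN', hside⟩ : ∃ N : ℤ, turns n P = N ∧
        y * alternatingProd x y (N - 1) = alternatingProd x y N ∧
        ∀ᶠ P' in 𝓝 P, 1 ≤ |P' 2| → columnGauge x y c n P' = alternatingProd x y N := by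
      rcases eq_or_eq_neg_of_abs_eq h1.symm with h2 | h2
      · refine ⟨n, turns_of_one_le h2.ge, mul_alternatingProd_of_zpow_eq_one hx hy hn, ?_⟩
        filter_upwards [hc2.eventually (lt_mem_nhds (show -1 < P 2 by linarith))] with P' h3 h4
        rw [columnGauge, if_pos]
        rcases le_abs.1 h4 with h4 | h4 <;> linarith
      · refine ⟨0, by rw [turns_of_le_neg_one h2.le, Int.cast_zero],
          mul_alternatingProd_of_zpow_eq_one hx hy (zpow_zero _), ?_⟩
        filter_upwards [hc2.eventually (gt_mem_nhds (show P 2 < 1 by linarith))] with P' h3 h4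
        rw [columnGauge, if_neg h3.not_ge, if_pos, alternatingProd_zero]
        rcases le_abs.1 h4 with h4 | h4 <;> linarith
    suffices h3 : ∀ᶠ P' in 𝓝 P, columnGauge x y c n P' = alternatingProd x y N by
      filter_upwards [h3] with P' h4
      rw [h4, h3.self_of_nhds]
    rcases lt_or_gt_of_ne hY with hY | hY
    · filter_upwards [hside, hc1.eventually (gt_mem_nhds hY), eventually_floor_eq
        (continuousAt_back hr) (k := N) (by linarith) (by linarith)] with P' h3 h4 h5
      rcases le_or_gt 1 |P' 2| with h6 | h6
      · exact h3 h6
      · rw [columnGauge_back h6 h4, h5]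
    · filter_upwards [hside, hc1.eventually (lt_mem_nhds hY), eventually_floor_eq
        (continuousAt_front hr) (k := N - 1) (by push_cast; linarith)
        (by push_cast; linarith)] with P' h3 h4 h5
      rcases le_or_gt 1 |P' 2| with h6 | h6
      · exact h3 h6
      · rw [columnGauge_front h6 h4.le, h5, hN']
  · have h := h.resolve_left h1.not_ge
    rcases lt_or_gt_of_ne hY with hY | hY
    · have hs : ∀ k : ℤ, turns n P + angle c P ≠ k := by
        rw [offset_eq_back hr hY.le] at h
        exact sin_pi_mul_ne_zero (right_ne_zero_of_mul h)
      filter_upwards [hc1.eventually (gt_mem_nhds hY), hc2'.eventually (gt_mem_nhds h1),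
        eventually_floor_eq_floor (continuousAt_back hr) hs] with P' h4 h6 h5
      rw [columnGauge_back h6 h4, h5, columnGauge_back h1 hY]
    · have hs : ∀ k : ℤ, turns n P - angle c P ≠ k := by
        rw [offset_eq_front hr hY.le] at h
        exact sin_pi_mul_ne_zero (right_ne_zero_of_mul h)
      filter_upwards [hc1.eventually (lt_mem_nhds hY), hc2'.eventually (gt_mem_nhds h1),
        eventually_floor_eq_floor (continuousAt_front hr) hs] with P' h4 h6 h5
      rw [columnGauge_front h6 h4.le, h5, columnGauge_front h1 hY.le]

include hy in
/-- On the right of a column the gauge jumps across the plane of projection by `y`. -/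
theorem eventually_columnGauge_right (hY : P 1 = 0) (hX : c < P 0) (hZ : |P 2| < 1)
    (h : offset c n P ≠ 0) : ∀ᶠ P' in 𝓝 P,
      columnGauge x y c n P' = (if P' 1 < 0 then y else 1) * columnGauge x y c n P := by
  have hr : 0 < sqRadius c P := by unfold sqRadius; nlinarith [sq_nonneg (P 1)]
  have hc2' : ContinuousAt (fun P : Space3 => |P 2|) P := by fun_prop
  have hA := angle_eq_zero hY hX
  have hs : ∀ k : ℤ, turns n P - angle c P ≠ k := by
    rw [offset_eq_front hr hY.ge] at h
    exact sin_pi_mul_ne_zero (right_ne_zero_of_mul h)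
  have hs' : ∀ k : ℤ, turns n P + angle c P ≠ k := by
    rw [hA] at hs ⊢; simpa using hs
  filter_upwards [hc2'.eventually (gt_mem_nhds hZ),
    eventually_floor_eq_floor (continuousAt_front hr) hs,
    eventually_floor_eq_floor (continuousAt_back hr) hs'] with P' h3 h4 h5
  rw [columnGauge_front hZ hY.ge]
  split_ifs with h6
  · rw [columnGauge_back h3 h6, h5, ← mul_assoc, hy, one_mul, hA, sub_zero, add_zero]
  · rw [columnGauge_front h3 (not_lt.1 h6), h4, one_mul]

include hx in
/-- On the left of a column the gauge jumps across the plane of projection by `x`. -/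
theorem eventually_columnGauge_left (hY : P 1 = 0) (hX : P 0 < c) (hZ : |P 2| < 1)
    (h : offset c n P ≠ 0) : ∀ᶠ P' in 𝓝 P,
      columnGauge x y c n P' = (if P' 1 < 0 then x else 1) * columnGauge x y c n P := by
  have hr : 0 < sqRadius c P := by unfold sqRadius; nlinarith [sq_nonneg (P 1)]
  have hc2' : ContinuousAt (fun P : Space3 => |P 2|) P := by fun_prop
  have hA := angle_eq_one hY hX
  have hs : ∀ k : ℤ, turns n P - angle c P ≠ k := by
    rw [offset_eq_front hr hY.ge] at h
    exact sin_pi_mul_ne_zero (right_ne_zero_of_mul h)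
  have hs' : ∀ k : ℤ, turns n P + angle c P ≠ k := by
    rw [offset_eq_back hr hY.le] at h
    exact sin_pi_mul_ne_zero (right_ne_zero_of_mul h)
  filter_upwards [hc2'.eventually (gt_mem_nhds hZ),
    eventually_floor_eq_floor (continuousAt_front hr) hs,
    eventually_floor_eq_floor (continuousAt_back hr) hs'] with P' h3 h4 h5
  rw [columnGauge_front hZ hY.ge]
  split_ifs with h6
  · rw [columnGauge_back h3 h6, h5, hA, Int.floor_sub_one, Int.floor_add_one,
      mul_alternatingProd_sub_one hx, ← mul_assoc, hx, one_mul]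
  · rw [columnGauge_front h3 (not_lt.1 h6), h4, one_mul]

end columnGauge

end Pretzel

/-! ### Charts and gauges on the complement of the standard pretzel link -/

namespace Pretzel

/-- The position of the axis of each column. -/
def centre : Fin 3 → ℝ := ![-3, 0, 3]

/-- The regions of the plane of projection cut out by the diagram, other than those inside the
columns: the one between the top and bottom arcs, the outer one, and the two between
adjacent columns. -/
inductive Region
  | inner
  | outer
  | left
  | right

/-- The regions adjacent to columns; column `j` lies between the regions `j` and `j + 1`. -/
def Region.ofFin : Fin 3 → Region := ![.outer, .left, .right]

/-- The points of a region; only the first and third coordinates matter. -/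
def Region.Contains : Region → Space3 → Prop
  | .inner, P => |P 0| < 4 ∧ 1 < |P 2| ∧ |P 2| < 2
  | .outer, P => 4 < |P 0| ∨ 2 < |P 2|
  | .left, P => |P 2| < 1 ∧ -2 < P 0 ∧ P 0 < -1
  | .right, P => |P 2| < 1 ∧ 1 < P 0 ∧ P 0 < 2

/-- The points outside the columns that can be seen from both sides of the plane of projection
through a region. -/
def regionChart (R : Region) : Set Space3 :=
  {P | (∀ j, 1 < sqRadius (centre j) P ∨ 1 < |P 2|) ∧ (P 1 ≠ 0 ∨ R.Contains P)}

/-- A neighbourhood of a column, cut along the surface swept out by the prolonged diameters. -/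
def columnChart (n : Fin 3 → ℤ) (j : Fin 3) : Set Space3 :=
  {P | sqRadius (centre j) P < 2 ∧ |P 2| < 3 / 2 ∧
    (sqRadius (centre j) P < 1 ∨ offset (centre j) (n j) P ≠ 0)}

/-- The charts of the complement of a pretzel link. -/
def chart (n : Fin 3 → ℤ) : Region ⊕ Fin 3 → Set Space3 :=
  Sum.elim regionChart (columnChart n)

theorem Region.isOpen_contains (R : Region) : IsOpen {P | R.Contains P} := by
  have h0 : Continuous fun P : Space3 => P 0 := by fun_prop
  have h2 : Continuous fun P : Space3 => |P 2| := by fun_prop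
  cases R
  · exact (isOpen_lt h0.abs continuous_const).inter
      ((isOpen_lt continuous_const h2).inter (isOpen_lt h2 continuous_const))
  · exact (isOpen_lt continuous_const h0.abs).union (isOpen_lt continuous_const h2)
  · exact (isOpen_lt h2 continuous_const).inter
      ((isOpen_lt continuous_const h0).inter (isOpen_lt h0 continuous_const))
  · exact (isOpen_lt h2 continuous_const).inter
      ((isOpen_lt continuous_const h0).inter (isOpen_lt h0 continuous_const))

theorem isOpen_chart (n : Fin 3 → ℤ) (i : Region ⊕ Fin 3) : IsOpen (chart n i) := by
  have h1 : Continuous fun P : Space3 => P 1 := by fun_prop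
  have h2 : Continuous fun P : Space3 => |P 2| := by fun_prop
  match i with
  | .inl R =>
    refine IsOpen.inter ?_ (IsOpen.union (isOpen_ne_fun h1 continuous_const) (Region.isOpen_contains R))
    have : {P : Space3 | ∀ j, 1 < sqRadius (centre j) P ∨ 1 < |P 2|} =
        ⋂ j, {P : Space3 | 1 < sqRadius (centre j) P ∨ 1 < |P 2|} := by
      ext; simp
    change IsOpen {P : Space3 | ∀ j, 1 < sqRadius (centre j) P ∨ 1 < |P 2|}
    rw [this]
    exact isOpen_iInter_of_finite fun j => (isOpen_lt continuous_const continuous_sqRadius).union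
      (isOpen_lt continuous_const h2)
  | .inr j =>
    exact (isOpen_lt continuous_sqRadius continuous_const).inter ((isOpen_lt h2 continuous_const).inter
      ((isOpen_lt continuous_sqRadius continuous_const).union
        (isOpen_ne_fun continuous_offset continuous_const)))

theorem sub_sq_le_sqRadius (c : ℝ) (P : Space3) : (P 0 - c) ^ 2 ≤ sqRadius c P := by
  unfold sqRadius; nlinarith [sq_nonneg (P 1)]

theorem abs_sub_centre_lt {j : Fin 3} {P : Space3} (h : sqRadius (centre j) P < 2) :
    |P 0 - centre j| < 3 / 2 :=
  abs_lt_of_sq_lt_sq ((sub_sq_le_sqRadius _ _).trans_lt (h.trans (by norm_num))) (by norm_num)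

theorem centre_injOn {i j : Fin 3} {P : Space3} (hi : sqRadius (centre i) P < 2)
    (hj : sqRadius (centre j) P < 2) : i = j := by
  have h1 := abs_lt.1 (abs_sub_centre_lt hi)
  have h2 := abs_lt.1 (abs_sub_centre_lt hj)
  fin_cases i <;> fin_cases j <;> simp [centre] at h1 h2 ⊢ <;> linarith

theorem Region.eq_of_contains {R R' : Region} {P : Space3} (h : R.Contains P)
    (h' : R'.Contains P) : R = R' := by
  by_contra hne
  cases R <;> cases R' <;> first
    | exact hne rfl
    | (simp only [Region.Contains, lt_abs, abs_lt] at h h'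
       grind)

section gauge

variable {G : Type*} [Group G]

/-- The generator corresponding to a region. -/
def Region.elem (g : Fin 3 → G) : Region → G
  | .inner => 1
  | .outer => g 0
  | .left => g 1
  | .right => g 2

@[simp] theorem Region.elem_ofFin (g : Fin 3 → G) (j : Fin 3) : (ofFin j).elem g = g j := by
  fin_cases j <;> rfl

/-- The gauge of a region: crossing the plane of projection through it costs a generator. -/
noncomputable def regionGauge (g : Fin 3 → G) (R : Region) (P : Space3) : G :=
  if P 1 < 0 then R.elem g else 1

/-- The gauges of the charts of the complement of a pretzel link. -/
noncomputable def gauge (g : Fin 3 → G) (n : Fin 3 → ℤ) : Region ⊕ Fin 3 → Space3 → G :=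
  Sum.elim (regionGauge g) fun j => columnGauge (g j) (g (j + 1)) (centre j) (n j)

variable {g : Fin 3 → G} {n : Fin 3 → ℤ}

theorem eventually_regionGauge_of_ne_zero {R : Region} {P : Space3} (h : P 1 ≠ 0) :
    ∀ᶠ P' in 𝓝 P, regionGauge g R P' = regionGauge g R P := by
  have hc1 : ContinuousAt (fun P : Space3 => P 1) P := by fun_prop
  rcases lt_or_gt_of_ne h with h | h
  · filter_upwards [hc1.eventually (gt_mem_nhds h)] with P' h'
    rw [regionGauge, regionGauge, if_pos h', if_pos h]
  · filter_upwards [hc1.eventually (lt_mem_nhds h)] with P' h'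
    rw [regionGauge, regionGauge, if_neg h'.not_gt, if_neg h.not_gt]

theorem region_eq_inner {R : Region} {j : Fin 3} {P : Space3} (hR : R.Contains P)
    (hr : sqRadius (centre j) P < 1) (h1 : 1 < |P 2|) (h2 : |P 2| < 3 / 2) : R = .inner := by
  have h3 : |P 0 - centre j| < 1 := by
    simpa using abs_lt_of_sq_lt_sq ((sub_sq_le_sqRadius _ _).trans_lt
      (hr.trans_eq (one_pow 2).symm)) one_pos.le
  refine Region.eq_of_contains hR ⟨?_, h1, by linarith⟩
  rw [abs_lt] at h3 ⊢
  fin_cases j <;> simp [centre] at h3 <;> constructor <;> linarith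

theorem region_eq_right {R : Region} {j : Fin 3} {P : Space3} (hR : R.Contains P)
    (h0 : centre j + 1 < P 0) (h2 : sqRadius (centre j) P < 2) (hZ : |P 2| < 1) :
    R = .ofFin (j + 1) := by
  have h3 := abs_lt.1 (abs_sub_centre_lt h2)
  refine Region.eq_of_contains hR ?_
  fin_cases j <;> simp [centre, Region.ofFin, Region.Contains, lt_abs] at h3 h0 ⊢ <;> grind

theorem region_eq_left {R : Region} {j : Fin 3} {P : Space3} (hR : R.Contains P)
    (h0 : P 0 < centre j - 1) (h2 : sqRadius (centre j) P < 2) (hZ : |P 2| < 1) :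
    R = .ofFin j := by
  have h3 := abs_lt.1 (abs_sub_centre_lt h2)
  refine Region.eq_of_contains hR ?_
  fin_cases j <;> simp [centre, Region.ofFin, Region.Contains, lt_abs] at h3 h0 ⊢ <;> grind

theorem lt_or_gt_of_one_lt_sqRadius {c : ℝ} {P : Space3} (hY : P 1 = 0) (h : 1 < sqRadius c P) :
    c + 1 < P 0 ∨ P 0 < c - 1 := by
  have h1 : 1 < |P 0 - c| := by
    rw [sqRadius, hY, zero_pow two_ne_zero, add_zero, ← sq_abs] at h
    exact (one_lt_sq_iff₀ (abs_nonneg _)).1 h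
  rcases lt_abs.1 h1 with h1 | h1
  · left; linarith
  · right; linarith

variable (hg : ∀ i, g i * g i = 1) (hn : ∀ j, (g j * g (j + 1)) ^ n j = 1)

include hg hn in
-- Across the plane of projection both gauges acquire the same left factor, which cancels: 1 in the
-- inner region, `g (j + 1)` on the right of the column and `g j` on its left.
theorem eventually_column_region {R : Region} {j : Fin 3} {P : Space3}
    (hR : P ∈ regionChart R) (hj : P ∈ columnChart n j) :
    ∀ᶠ P' in 𝓝 P, (columnGauge (g j) (g (j + 1)) (centre j) (n j) P')⁻¹ * regionGauge g R P' =
      (columnGauge (g j) (g (j + 1)) (centre j) (n j) P)⁻¹ * regionGauge g R P := by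
  obtain ⟨hR1, hR2⟩ := hR
  obtain ⟨hj1, hj2, hj3⟩ := hj
  by_cases hY : P 1 = 0
  · have hR2 := hR2.resolve_left (by simp [hY])
    rcases lt_or_ge 1 |P 2| with hZ | hZ
    · have hr : sqRadius (centre j) P < 1 :=
        hj3.resolve_right fun h => h ((offset_of_one_le_abs hZ.le).2 hY)
      obtain rfl := region_eq_inner hR2 hr hZ hj2
      have h0 : ∀ᶠ P' in 𝓝 P, columnGauge (g j) (g (j + 1)) (centre j) (n j) P' =
          columnGauge (g j) (g (j + 1)) (centre j) (n j) P := eventually_columnGauge_of_one_lt_abs hZ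
      filter_upwards [h0] with P' h
      simp [h, regionGauge, Region.elem]
    · have hr := (hR1 j).resolve_right hZ.not_gt
      have ho := hj3.resolve_left hr.not_gt
      have hZ' : |P 2| < 1 := by
        by_contra h
        exact ho ((offset_of_one_le_abs (not_lt.1 h)).2 hY)
      rcases lt_or_gt_of_one_lt_sqRadius hY hr with hX | hX
      · obtain rfl := region_eq_right hR2 hX hj1 hZ'
        filter_upwards [eventually_columnGauge_right (x := g j) (hg (j + 1)) hY
          (by linarith : centre j < P 0) hZ' ho] with P' h
        rw [h, regionGauge, regionGauge, if_neg (by simp [hY] : ¬ P 1 < 0)]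
        split_ifs <;> simp
      · obtain rfl := region_eq_left hR2 hX hj1 hZ'
        filter_upwards [eventually_columnGauge_left (y := g (j + 1)) (hg j) hY
          (by linarith : P 0 < centre j) hZ' ho] with P' h
        rw [h, regionGauge, regionGauge, if_neg (by simp [hY] : ¬ P 1 < 0)]
        split_ifs <;> simp
  · have ho : 1 ≤ |P 2| ∨ offset (centre j) (n j) P ≠ 0 := by
      rcases hR1 j with h | h
      · exact Or.inr (hj3.resolve_left h.not_gt)
      · exact Or.inl h.le
    filter_upwards [eventually_columnGauge_of_ne_zero (hg j) (hg (j + 1)) (hn j) hY ho,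
      eventually_regionGauge_of_ne_zero (g := g) (R := R) hY] with P' h1 h2
    rw [h1, h2]

include hg hn in
theorem eventually_gauge {i i' : Region ⊕ Fin 3} {P : Space3} (hi : P ∈ chart n i)
    (hi' : P ∈ chart n i') :
    ∀ᶠ P' in 𝓝 P, (gauge g n i' P')⁻¹ * gauge g n i P' = (gauge g n i' P)⁻¹ * gauge g n i P := by
  rcases i with R | j <;> rcases i' with R' | j'
  · by_cases hY : P 1 = 0
    · obtain rfl := Region.eq_of_contains (hi.2.resolve_left (by simp [hY]))
        (hi'.2.resolve_left (by simp [hY]))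
      simp
    · filter_upwards [eventually_regionGauge_of_ne_zero (g := g) (R := R) hY,
        eventually_regionGauge_of_ne_zero (g := g) (R := R') hY] with P' h1 h2
      simp only [gauge, Sum.elim_inl, h1, h2]
  · exact eventually_column_region hg hn hi hi'
  · filter_upwards [eventually_column_region hg hn hi' hi] with P' h
    have := congrArg (·⁻¹) h
    simp only [mul_inv_rev, inv_inv] at this
    exact this
  · obtain rfl := centre_injOn hi.1 hi'.1
    simp

end gauge

/-- The points of the arcs of a pretzel link. -/
def IsArcPoint (P : Space3) : Prop :=
  P 1 = 0 ∧ (|P 2| = 1 ∧ (-2 ≤ P 0 ∧ P 0 ≤ -1 ∨ 1 ≤ P 0 ∧ P 0 ≤ 2) ∨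
    |P 0| = 4 ∧ 1 ≤ |P 2| ∧ |P 2| ≤ 2 ∨ |P 0| ≤ 4 ∧ |P 2| = 2)

/-- The points of the twisted columns of a pretzel link. -/
def IsHelixPoint (n : Fin 3 → ℤ) (j : Fin 3) (P : Space3) : Prop :=
  |P 2| ≤ 1 ∧ sqRadius (centre j) P = 1 ∧ offset (centre j) (n j) P = 0

theorem mem_segment_iff {a a' b b' : ℝ} {P : Space3} :
    P ∈ segment ℝ !₂[a, 0, b] !₂[a', 0, b'] ↔ P 1 = 0 ∧ ∃ t ∈ Set.Icc (0 : ℝ) 1,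
      P 0 = a + t * (a' - a) ∧ P 2 = b + t * (b' - b) := by
  rw [segment_eq_image']
  constructor
  · rintro ⟨t, ht, rfl⟩
    exact ⟨by simp, t, ht, by simp, by simp⟩
  · rintro ⟨h1, t, ht, h0, h2⟩
    refine ⟨t, ht, ?_⟩
    ext i
    fin_cases i <;> simp [h0, h1, h2]

theorem mem_closingArcs_iff {e : ℝ} (he : e = 1 ∨ e = -1) {P : Space3} :
    P ∈ closingArcs e ↔ P 1 = 0 ∧ (P 2 = e ∧ (-2 ≤ P 0 ∧ P 0 ≤ -1 ∨ 1 ≤ P 0 ∧ P 0 ≤ 2) ∨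
      |P 0| = 4 ∧ 1 ≤ e * P 2 ∧ e * P 2 ≤ 2 ∨ |P 0| ≤ 4 ∧ P 2 = 2 * e) := by
  simp only [closingArcs, Set.mem_union, mem_segment_iff, Set.mem_Icc]
  constructor
  · rintro ((((⟨h1, t, ⟨ht0, ht1⟩, h0, h2⟩ | ⟨h1, t, ⟨ht0, ht1⟩, h0, h2⟩) |
      ⟨h1, t, ⟨ht0, ht1⟩, h0, h2⟩) | ⟨h1, t, ⟨ht0, ht1⟩, h0, h2⟩) | ⟨h1, t, ⟨ht0, ht1⟩, h0, h2⟩) <;>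
      refine ⟨h1, ?_⟩
    · left; exact ⟨by linarith, Or.inl ⟨by linarith, by linarith⟩⟩
    · left; exact ⟨by linarith, Or.inr ⟨by linarith, by linarith⟩⟩
    · right; left
      refine ⟨by rw [h0]; norm_num, ?_⟩
      rcases he with rfl | rfl <;> constructor <;> linarith
    · right; right
      refine ⟨abs_le.2 ⟨by linarith, by linarith⟩, by linarith⟩
    · right; left
      refine ⟨by rw [h0]; norm_num, ?_⟩
      rcases he with rfl | rfl <;> constructor <;> linarith
  · rintro ⟨h1, ⟨h2, ⟨h3, h4⟩ | ⟨h3, h4⟩⟩ | ⟨h2, h3, h4⟩ | ⟨h2, h3⟩⟩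
    · exact Or.inl <| Or.inl <| Or.inl <| Or.inl ⟨h1, P 0 + 2, ⟨by linarith, by linarith⟩,
        by ring, by rw [h2]; ring⟩
    · exact Or.inl <| Or.inl <| Or.inl <| Or.inr ⟨h1, P 0 - 1, ⟨by linarith, by linarith⟩,
        by ring, by rw [h2]; ring⟩
    · have hee : e * e = 1 := by rcases he with rfl | rfl <;> norm_num
      rcases eq_or_eq_neg_of_abs_eq h2 with h2 | h2
      · refine Or.inr ⟨h1, 2 - e * P 2, ⟨by linarith, by linarith⟩, by rw [h2]; ring, ?_⟩
        linear_combination (-P 2) * hee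
      · refine Or.inl <| Or.inl <| Or.inr ⟨h1, e * P 2 - 1, ⟨by linarith, by linarith⟩,
          by rw [h2]; ring, ?_⟩
        linear_combination (-P 2) * hee
    · rw [abs_le] at h2
      exact Or.inl <| Or.inr ⟨h1, (P 0 + 4) / 8, ⟨by linarith, by linarith⟩, by ring, by rw [h3]; ring⟩

theorem turns_of_abs_le_one {n : ℤ} {P : Space3} (h : |P 2| ≤ 1) :
    turns n P = n * (P 2 + 1) / 2 := by
  rw [abs_le] at h
  rw [turns, min_eq_right h.2, max_eq_right h.1]

theorem mem_twistColumn_iff {n : Fin 3 → ℤ} {j : Fin 3} {P : Space3} :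
    P ∈ twistColumn (centre j) (n j) ↔ IsHelixPoint n j P := by
  have key : ∀ P : Space3, |P 2| ≤ 1 →
      Real.pi * n j * (P 2 + 1) / 2 = Real.pi * turns (n j) P := fun P h => by
    rw [turns_of_abs_le_one h]; ring
  constructor
  · rintro ⟨t, ht, ε, hε, h⟩
    have h0 : P 0 = centre j + ε * Real.cos (Real.pi * n j * (t + 1) / 2) := by rw [h]; rfl
    have h1 : P 1 = ε * Real.sin (Real.pi * n j * (t + 1) / 2) := by rw [h]; rfl
    have h2 : P 2 = t := by rw [h]; rfl
    subst h2
    have hZ := abs_le.2 ht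
    rw [key P hZ] at h0 h1
    have hεε : ε * ε = 1 := by rcases hε with rfl | rfl <;> norm_num
    refine ⟨hZ, ?_, ?_⟩
    · rw [sqRadius, h0, h1]
      linear_combination hεε + ε * ε * Real.sin_sq_add_cos_sq (Real.pi * turns (n j) P)
    · rw [offset, h0, h1]; ring
  · rintro ⟨hZ, h1, h2⟩
    have hsc := Real.sin_sq_add_cos_sq (Real.pi * turns (n j) P)
    unfold offset sqRadius at *
    set s := Real.sin (Real.pi * turns (n j) P)
    set k := Real.cos (Real.pi * turns (n j) P)
    set ε := (P 0 - centre j) * k + P 1 * s with hε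
    have hεε : ε * ε = 1 := by
      rw [hε]
      linear_combination ((P 0 - centre j) ^ 2 + P 1 ^ 2) * hsc + h1 -
        ((P 0 - centre j) * s - P 1 * k) * h2
    refine ⟨P 2, abs_le.1 hZ, ε, ?_, ?_⟩
    · rcases mul_self_eq_one_iff.1 hεε with h | h <;> simp [h]
    · rw [key P hZ]
      ext i
      fin_cases i
      · change P 0 = centre j + ε * k
        rw [hε]
        linear_combination (-(P 0 - centre j)) * hsc + s * h2
      · change P 1 = ε * s
        rw [hε]
        linear_combination (-P 1) * hsc - k * h2
      · rfl

theorem isArcPoint_iff {P : Space3} :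
    IsArcPoint P ↔ P ∈ closingArcs 1 ∨ P ∈ closingArcs (-1) := by
  rw [mem_closingArcs_iff (Or.inl rfl), mem_closingArcs_iff (Or.inr rfl), IsArcPoint, ← and_or_left]
  refine and_congr_right fun _ => ?_
  generalize |P 0| = A
  have h := abs_cases (P 2)
  generalize |P 2| = B at *
  generalize P 0 = x
  generalize P 2 = z at *
  simp only [le_antisymm_iff] at h ⊢
  grind

theorem mem_standardPretzel_iff {n : Fin 3 → ℤ} {P : Space3} :
    P ∈ standardPretzel (n 0) (n 1) (n 2) ↔ IsArcPoint P ∨ ∃ j, IsHelixPoint n j P := by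
  have h0 : P ∈ twistColumn (-3) (n 0) ↔ IsHelixPoint n 0 P := mem_twistColumn_iff (j := 0)
  have h1 : P ∈ twistColumn 0 (n 1) ↔ IsHelixPoint n 1 P := mem_twistColumn_iff (j := 1)
  have h2 : P ∈ twistColumn 3 (n 2) ↔ IsHelixPoint n 2 P := mem_twistColumn_iff (j := 2)
  rw [isArcPoint_iff]
  constructor
  · rintro ((((h | h) | h) | h) | h)
    · exact Or.inr ⟨0, h0.1 h⟩
    · exact Or.inr ⟨1, h1.1 h⟩
    · exact Or.inr ⟨2, h2.1 h⟩
    · exact Or.inl (Or.inl h)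
    · exact Or.inl (Or.inr h)
  · rintro ((h | h) | ⟨j, h⟩)
    · exact Or.inl (Or.inr h)
    · exact Or.inr h
    · refine Or.inl (Or.inl ?_)
      fin_cases j
      · exact Or.inl (Or.inl (h0.2 h))
      · exact Or.inl (Or.inr (h1.2 h))
      · exact Or.inr (h2.2 h)

/-- With `notMem_of_mem_chart`, the charts cover exactly the complement: column charts take care of
the closed solid columns, region charts of the rest. -/
theorem exists_mem_chart {n : Fin 3 → ℤ} {P : Space3} (h : ¬ IsArcPoint P)
    (h' : ∀ j, ¬ IsHelixPoint n j P) : ∃ i, P ∈ chart n i := by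
  by_cases hr : ∃ j, sqRadius (centre j) P ≤ 1 ∧ |P 2| ≤ 1
  · obtain ⟨j, hj, hZ⟩ := hr
    refine ⟨.inr j, by linarith, by linarith, ?_⟩
    rcases hj.lt_or_eq with hj | hj
    · exact Or.inl hj
    · exact Or.inr fun ho => h' j ⟨hZ, hj, ho⟩
  · push Not at hr
    have hr' : ∀ j, 1 < sqRadius (centre j) P ∨ 1 < |P 2| := fun j => by
      rcases le_or_gt (sqRadius (centre j) P) 1 with h | h
      · exact Or.inr (hr j h)
      · exact Or.inl h
    by_cases hY : P 1 = 0
    · suffices ∃ R : Region, R.Contains P from this.imp' Sum.inl fun R hR => ⟨hr', Or.inr hR⟩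
      by_contra! hR
      have h0 := hR .inner
      have h1 := hR .outer
      have h2 := hR .left
      have h3 := hR .right
      have hX : |P 2| ≤ 1 → ∀ j, centre j + 1 < P 0 ∨ P 0 < centre j - 1 := fun hZ j =>
        lt_or_gt_of_one_lt_sqRadius hY ((hr' j).resolve_right hZ.not_gt)
      have hX0 := fun h => hX h 0
      have hX1 := fun h => hX h 1
      have hX2 := fun h => hX h 2
      simp only [Region.Contains, centre, Fin.isValue, Matrix.cons_val] at h0 h1 h2 h3 hX0 hX1 hX2
      simp only [IsArcPoint, hY, true_and] at h
      clear hX hr hr' h' hR hY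
      have hA := abs_cases (P 0)
      generalize |P 0| = A at *
      generalize |P 2| = B at *
      generalize P 0 = x at *
      simp only [le_antisymm_iff] at h hA
      grind
    · exact ⟨.inl .inner, hr', Or.inl hY⟩

theorem notMem_of_mem_chart {n : Fin 3 → ℤ} {P : Space3} {i : Region ⊕ Fin 3}
    (hi : P ∈ chart n i) : P ∉ standardPretzel (n 0) (n 1) (n 2) := by
  rw [mem_standardPretzel_iff]
  rintro (⟨hY, h⟩ | ⟨j, hZ, hr, ho⟩)
  · rcases i with R | j
    · have hR := hi.2.resolve_left (by simp [hY])
      clear hi hY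
      have hA := abs_cases (P 0)
      simp only [le_antisymm_iff] at h hA
      cases R <;> simp only [Region.Contains] at hR <;> generalize |P 0| = A at * <;>
        generalize |P 2| = B at * <;> generalize P 0 = x at * <;> grind
    · obtain ⟨h1, h2, h3⟩ := hi
      have hZ : 1 ≤ |P 2| := by
        rcases h with h | h | h
        · exact h.1.ge
        · exact h.2.1
        · linarith [h.2]
      have h3 := h3.resolve_right fun ho => ho ((offset_of_one_le_abs hZ).2 hY)
      have h4 : |P 0 - centre j| < 1 := by
        simpa using abs_lt_of_sq_lt_sq ((sub_sq_le_sqRadius _ _).trans_lt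
          (h3.trans_eq (one_pow 2).symm)) one_pos.le
      rw [abs_lt] at h4
      have h5 : centre j - 1 < P 0 := by linarith
      have h6 : P 0 < centre j + 1 := by linarith
      clear h3 h1 hY h4
      have hA := abs_cases (P 0)
      simp only [le_antisymm_iff] at h hA
      fin_cases j <;> simp only [centre, Fin.isValue, Fin.zero_eta, Fin.mk_one, Fin.reduceFinMk,
          Matrix.cons_val] at h5 h6 <;> generalize |P 0| = A at * <;>
        generalize |P 2| = B at * <;> generalize P 0 = x at * <;> grind
  · rcases i with R | j'
    · rcases hi.1 j with h | h <;> linarith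
    · obtain rfl := centre_injOn hi.1 (show sqRadius (centre j) P < 2 by linarith)
      rcases hi.2.2 with h | h
      · linarith
      · exact h ho

end Pretzel

/-! ### The local system on the knot complement -/

namespace Pretzel

section localSystem

variable {G : Type*} [Group G] {g : Fin 3 → G} {n : Fin 3 → ℤ}

/-- The charts in the one-point compactification; the point at infinity is in the outer region. -/
def compactChart (n : Fin 3 → ℤ) (i : Region ⊕ Fin 3) : Set (OnePoint Space3) :=
  {Q | Q.elim (i = .inl .outer) (· ∈ chart n i)}

/-- The gauges in the one-point compactification. -/
noncomputable def compactGauge (g : Fin 3 → G) (n : Fin 3 → ℤ) (i : Region ⊕ Fin 3)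
    (Q : OnePoint Space3) : G :=
  Q.elim 1 (gauge g n i)

@[simp] theorem coe_mem_compactChart {i : Region ⊕ Fin 3} {P : Space3} :
    (P : OnePoint Space3) ∈ compactChart n i ↔ P ∈ chart n i := Iff.rfl

@[simp] theorem infty_mem_compactChart {i : Region ⊕ Fin 3} :
    (OnePoint.infty : OnePoint Space3) ∈ compactChart n i ↔ i = .inl .outer := Iff.rfl

theorem norm_le_of_abs_le {P : Space3} (h0 : |P 0| ≤ 4) (h1 : |P 1| ≤ 1) (h2 : |P 2| ≤ 2) :
    ‖P‖ ≤ 5 := by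
  rw [EuclideanSpace.norm_eq, Fin.sum_univ_three]
  refine Real.sqrt_le_iff.2 ⟨by norm_num, ?_⟩
  simp only [Real.norm_eq_abs]
  nlinarith [abs_nonneg (P 0), abs_nonneg (P 1), abs_nonneg (P 2)]

/-- Boundedness of the complement makes the outer chart, with infinity added, open in the
compactification. -/
theorem norm_le_of_notMem_outer {P : Space3} (h : P ∉ regionChart .outer) : ‖P‖ ≤ 5 := by
  by_cases hr : ∃ j, sqRadius (centre j) P ≤ 1 ∧ |P 2| ≤ 1
  · obtain ⟨j, hj, hZ⟩ := hr
    have h0 : |P 0 - centre j| ≤ 1 := by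
      rw [← sq_le_one_iff_abs_le_one]
      exact (sub_sq_le_sqRadius _ _).trans hj
    have h1 : |P 1| ≤ 1 := by
      rw [← sq_le_one_iff_abs_le_one]
      unfold sqRadius at hj
      nlinarith [sq_nonneg (P 0 - centre j)]
    have h3 : |centre j| ≤ 3 := by fin_cases j <;> simp [centre]
    refine norm_le_of_abs_le ?_ h1 (by linarith)
    calc |P 0| = |(P 0 - centre j) + centre j| := by rw [sub_add_cancel]
      _ ≤ |P 0 - centre j| + |centre j| := abs_add_le _ _
      _ ≤ 4 := by linarith
  · push Not at hr
    have hr' : ∀ j, 1 < sqRadius (centre j) P ∨ 1 < |P 2| := fun j => by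
      rcases le_or_gt (sqRadius (centre j) P) 1 with h | h
      · exact Or.inr (hr j h)
      · exact Or.inl h
    have h1 : ¬ (P 1 ≠ 0 ∨ Region.outer.Contains P) := fun h1 => h ⟨hr', h1⟩
    simp only [Region.Contains, not_or, not_not, not_lt] at h1
    exact norm_le_of_abs_le h1.2.1 (by simp [h1.1]) h1.2.2

theorem isOpen_compactChart (i : Region ⊕ Fin 3) : IsOpen (compactChart n i) := by
  by_cases hi : i = .inl .outer
  · subst hi
    rw [OnePoint.isOpen_iff_of_mem (by simp)]
    have h1 : IsClosed (chart n (.inl .outer))ᶜ := (isOpen_chart n _).isClosed_compl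
    refine ⟨h1, Metric.isCompact_of_isClosed_isBounded h1 ?_⟩
    refine Metric.isBounded_closedBall (x := (0 : Space3)) (r := 5) |>.subset fun P hP => ?_
    rw [mem_closedBall_zero_iff]
    exact norm_le_of_notMem_outer hP
  · rw [OnePoint.isOpen_iff_of_notMem (by simpa using hi)]
    exact isOpen_chart n i

theorem exists_mem_compactChart {Q : OnePoint Space3}
    (hQ : Q ∉ (fun P : Space3 => (P : OnePoint Space3)) '' standardPretzel (n 0) (n 1) (n 2)) :
    ∃ i, Q ∈ compactChart n i := by
  induction Q using OnePoint.rec with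
  | infty => exact ⟨.inl .outer, rfl⟩
  | coe P =>
    have hP : P ∉ standardPretzel (n 0) (n 1) (n 2) := fun h => hQ ⟨P, h, rfl⟩
    rw [mem_standardPretzel_iff, not_or, not_exists] at hP
    exact exists_mem_chart hP.1 hP.2

theorem notMem_of_mem_compactChart {i : Region ⊕ Fin 3} {Q : OnePoint Space3}
    (hQ : Q ∈ compactChart n i) :
    Q ∉ (fun P : Space3 => (P : OnePoint Space3)) '' standardPretzel (n 0) (n 1) (n 2) := by
  rintro ⟨P, hP, rfl⟩
  exact notMem_of_mem_chart (coe_mem_compactChart.1 hQ) hP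

theorem eventually_compactGauge (hg : ∀ i, g i * g i = 1) (hn : ∀ j, (g j * g (j + 1)) ^ n j = 1)
    {i i' : Region ⊕ Fin 3} {Q : OnePoint Space3} (hi : Q ∈ compactChart n i)
    (hi' : Q ∈ compactChart n i') :
    ∀ᶠ Q' in 𝓝 Q, (compactGauge g n i' Q')⁻¹ * compactGauge g n i Q' =
      (compactGauge g n i' Q)⁻¹ * compactGauge g n i Q := by
  induction Q using OnePoint.rec with
  -- Only the outer chart contains infinity, so the default gauge value there plays no role.
  | infty =>
    obtain rfl := infty_mem_compactChart.1 hi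
    obtain rfl := infty_mem_compactChart.1 hi'
    simp
  | coe P =>
    rw [OnePoint.nhds_coe_eq, eventually_map]
    exact eventually_gauge hg hn hi hi'

/-- The local system on the complement of a pretzel link. -/
noncomputable def localSystem (hg : ∀ i, g i * g i = 1) (hn : ∀ j, (g j * g (j + 1)) ^ n j = 1)
    {A : Type*} [TopologicalSpace A] {ψ : A → OnePoint Space3} (hψ : Continuous ψ)
    (hK : ∀ a, ψ a ∉ (fun P : Space3 => (P : OnePoint Space3)) '' standardPretzel (n 0) (n 1) (n 2)) :
    LocalSystem (Region ⊕ Fin 3) A G where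
  chart i := ψ ⁻¹' compactChart n i
  isOpen_chart i := (isOpen_compactChart i).preimage hψ
  exists_mem_chart a := exists_mem_compactChart (hK a)
  gauge i a := compactGauge g n i (ψ a)
  eventually_transition _ _ _ hi hj :=
    hψ.continuousAt.eventually (eventually_compactGauge hg hn hi hj)

end localSystem

/-! ### A coset-valued section near the knot -/

section flatSection

/-- A neighbourhood of a column. -/
def nearColumn (j : Fin 3) : Set Space3 := {P | sqRadius (centre j) P < 2 ∧ |P 2| < 3 / 2}

theorem isOpen_nearColumn (j : Fin 3) : IsOpen (nearColumn j) :=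
  (isOpen_lt continuous_sqRadius continuous_const).inter
    (isOpen_lt (by fun_prop : Continuous fun P : Space3 => |P 2|) continuous_const)

/-- A neighbourhood of the arcs in the closure of the outer region (`0`) and of the
arcs between adjacent columns. -/
def nearArc : Fin 3 → Set Space3 :=
  ![{P | 7 / 2 < |P 0| ∨ 7 / 4 < |P 2|}, {P | -5 / 2 < P 0 ∧ P 0 < -1 / 2 ∧ |P 2| < 5 / 4},
    {P | 1 / 2 < P 0 ∧ P 0 < 5 / 2 ∧ |P 2| < 5 / 4}]

theorem isOpen_nearArc (i : Fin 3) : IsOpen (nearArc i) := by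
  have h0 : Continuous fun P : Space3 => P 0 := by fun_prop
  have h2 : Continuous fun P : Space3 => |P 2| := by fun_prop
  fin_cases i
  · exact (isOpen_lt continuous_const h0.abs).union (isOpen_lt continuous_const h2)
  · exact (isOpen_lt continuous_const h0).inter
      ((isOpen_lt h0 continuous_const).inter (isOpen_lt h2 continuous_const))
  · exact (isOpen_lt continuous_const h0).inter
      ((isOpen_lt h0 continuous_const).inter (isOpen_lt h2 continuous_const))

/-- The arc to which a point outside the columns is assigned. -/
noncomputable def arcLabel (P : Space3) : Fin 3 :=
  if 7 / 2 < |P 0| ∨ 7 / 4 < |P 2| then 0 else if P 0 < 0 then 1 else 2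

theorem arcLabel_eq {i : Fin 3} {P : Space3} (h : P ∈ nearArc i) : arcLabel P = i := by
  unfold arcLabel
  fin_cases i
  · exact if_pos h
  · obtain ⟨h1, h2, h3⟩ : -5 / 2 < P 0 ∧ P 0 < -1 / 2 ∧ |P 2| < 5 / 4 := h
    refine (if_neg ?_).trans (if_pos (by linarith))
    rw [abs_of_neg (by linarith : P 0 < 0)]
    rintro (h | h) <;> linarith
  · obtain ⟨h1, h2, h3⟩ : 1 / 2 < P 0 ∧ P 0 < 5 / 2 ∧ |P 2| < 5 / 4 := h
    refine (if_neg ?_).trans (if_neg (by linarith))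
    rw [abs_of_pos (by linarith : 0 < P 0)]
    rintro (h | h) <;> linarith

theorem region_of_nearArc {R : Region} {i : Fin 3} {P : Space3} (hR : R.Contains P)
    (h : P ∈ nearArc i) : R = .inner ∨ R = .ofFin i := by
  have key : R ≠ .inner → R.Contains P → (Region.ofFin i).Contains P := by
    have hA := abs_cases (P 0)
    simp only [le_antisymm_iff] at hA
    fin_cases i
    · replace h : 7 / 2 < |P 0| ∨ 7 / 4 < |P 2| := h
      cases R <;> simp [Region.ofFin, Region.Contains] <;> grind
    · replace h : -5 / 2 < P 0 ∧ P 0 < -1 / 2 ∧ |P 2| < 5 / 4 := h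
      cases R <;> simp [Region.ofFin, Region.Contains] <;> grind
    · replace h : 1 / 2 < P 0 ∧ P 0 < 5 / 2 ∧ |P 2| < 5 / 4 := h
      cases R <;> simp [Region.ofFin, Region.Contains] <;> grind
  by_cases h0 : R = .inner
  · exact Or.inl h0
  · exact Or.inr (Region.eq_of_contains hR (key h0 hR))

variable {G : Type*} [Group G] {g : Fin 3 → G} {n : Fin 3 → ℤ}
variable {S : Type*} [MulAction G S] {κ : Fin 3 → S}

/-- The value of the flat section near a column. -/
noncomputable def columnValue (g : Fin 3 → G) (n : Fin 3 → ℤ) (κ : Fin 3 → S) (j : Fin 3)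
    (P : Space3) : S :=
  columnGauge (g j) (g (j + 1)) (centre j) (n j) P •
    κ (if 0 < along (centre j) (n j) P then j + 1 else j)

open Classical in
/-- A section over the complement of a pretzel link, flat near the link. -/
noncomputable def nearSection (g : Fin 3 → G) (n : Fin 3 → ℤ) (κ : Fin 3 → S) (P : Space3) : S :=
  if h : ∃ j, P ∈ nearColumn j then columnValue g n κ h.choose P else κ (arcLabel P)

theorem nearSection_of_mem {j : Fin 3} {P : Space3} (h : P ∈ nearColumn j) :
    nearSection g n κ P = columnValue g n κ j P := by
  have h' : ∃ j, P ∈ nearColumn j := ⟨j, h⟩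
  rw [nearSection, dif_pos h', centre_injOn h'.choose_spec.1 h.1]

theorem nearSection_of_forall_notMem {P : Space3} (h : ∀ j, P ∉ nearColumn j) :
    nearSection g n κ P = κ (arcLabel P) :=
  dif_neg (not_exists.2 h)

/-- Crossing the prolonged diameter at a strand changes the word by a final reflection that fixes
the coset carried by that strand; the parity of k tells which strand it is. -/
theorem alternatingProd_smul {j : Fin 3} (hκ : ∀ i, g i • κ i = κ i) {p : Prop} [Decidable p] {k : ℤ}
    (h : p ↔ Even k) :
    alternatingProd (g j) (g (j + 1)) k • κ (if p then j + 1 else j) =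
      alternatingProd (g j) (g (j + 1)) (k - 1) • κ (if p then j + 1 else j) := by
  rw [alternatingProd_eq_sub_one_mul, mul_smul]
  congr 1
  by_cases hk : Even k
  · rw [if_pos hk, if_pos (h.2 hk), hκ]
  · rw [if_neg hk, if_neg (mt h.1 hk), hκ]

theorem cos_pi_mul_int_pos_iff (k : ℤ) : 0 < Real.cos (Real.pi * k) ↔ Even k := by
  rw [mul_comm, Real.cos_int_mul_pi]
  rcases Int.even_or_odd k with h | h
  · simp [h, h.neg_one_zpow]
  · simp [h.neg_one_zpow, Int.not_even_iff_odd.2 h]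

theorem exists_index_front {c : ℝ} {n : ℤ} {P : Space3} (hr : 0 < sqRadius c P) (hY : 0 ≤ P 1)
    (ho : offset c n P = 0) : ∃ k : ℤ, turns n P - angle c P = k ∧ (0 < along c n P ↔ Even k) := by
  have h1 := Real.sqrt_pos.2 hr
  rw [offset_eq_front hr hY] at ho
  obtain ⟨k, hk⟩ := exists_int_of_sin_eq_zero ((mul_eq_zero.1 ho).resolve_left h1.ne')
  refine ⟨k, hk, ?_⟩
  rw [along_eq_front hr hY, hk, mul_pos_iff_of_pos_left h1, cos_pi_mul_int_pos_iff]

theorem exists_index_back {c : ℝ} {n : ℤ} {P : Space3} (hr : 0 < sqRadius c P) (hY : P 1 ≤ 0)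
    (ho : offset c n P = 0) : ∃ k : ℤ, turns n P + angle c P = k ∧ (0 < along c n P ↔ Even k) := by
  have h1 := Real.sqrt_pos.2 hr
  rw [offset_eq_back hr hY] at ho
  obtain ⟨k, hk⟩ := exists_int_of_sin_eq_zero ((mul_eq_zero.1 ho).resolve_left h1.ne')
  refine ⟨k, hk, ?_⟩
  rw [along_eq_back hr hY, hk, mul_pos_iff_of_pos_left h1, cos_pi_mul_int_pos_iff]

theorem eventually_along_pos_iff {c : ℝ} {n : ℤ} {P : Space3} (h : along c n P ≠ 0) :
    ∀ᶠ P' in 𝓝 P, 0 < along c n P' ↔ 0 < along c n P := by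
  have hc : ContinuousAt (along c n) P := by fun_prop
  rcases lt_or_gt_of_ne h with h | h
  · filter_upwards [hc.eventually (gt_mem_nhds h)] with P' h'
    simp [h'.not_gt, h.not_gt]
  · filter_upwards [hc.eventually (lt_mem_nhds h)] with P' h'
    simp [h', h]

/-- Over the surface swept out by the prolonged diameters, the section is flat in the gauge of the
regions. -/
theorem eventually_columnValue_region (hg : ∀ i, g i * g i = 1) (hκ : ∀ i, g i • κ i = κ i)
    {j : Fin 3} {R : Region} {P : Space3} (hR : P ∈ regionChart R) (hj : P ∈ nearColumn j)
    (hZ : |P 2| < 1) (ho : offset (centre j) (n j) P = 0) (ha : along (centre j) (n j) P ≠ 0) :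
    ∀ᶠ P' in 𝓝 P, (regionGauge g R P')⁻¹ • columnValue g n κ j P' =
      (regionGauge g R P)⁻¹ • columnValue g n κ j P := by
  have hr1 := (hR.1 j).resolve_right hZ.not_gt
  have hr : 0 < sqRadius (centre j) P := by linarith
  have hc1 : ContinuousAt (fun P : Space3 => P 1) P := by fun_prop
  have hc2 : ContinuousAt (fun P : Space3 => |P 2|) P := by fun_prop
  have ev2 := hc2.eventually (gt_mem_nhds hZ)
  -- Near the swept surface the floor takes two values, which act alike on the coset; so the section
  -- is the region gauge applied to a constant.
  obtain ⟨s, hs⟩ : ∃ s, ∀ᶠ P' in 𝓝 P, (0 < along (centre j) (n j) P' ↔ 0 < along (centre j) (n j) P) →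
      columnValue g n κ j P' = regionGauge g R P' • s := by
    rcases lt_trichotomy (P 1) 0 with hY | hY | hY
    · obtain ⟨k, hk, hp⟩ := exists_index_back hr hY.le ho
      refine ⟨(regionGauge g R P)⁻¹ • alternatingProd (g j) (g (j + 1)) k •
        κ (if 0 < along (centre j) (n j) P then j + 1 else j), ?_⟩
      filter_upwards [ev2, hc1.eventually (gt_mem_nhds hY),
        eventually_regionGauge_of_ne_zero (g := g) (R := R) hY.ne,
        eventually_floor_eq_or (continuousAt_back hr) (k := k) (by linarith) (by linarith)]
        with P' e2 e1 eR ek e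
      rw [eR, smul_inv_smul, columnValue, columnGauge_back e2 e1, if_congr e rfl rfl]
      rcases ek with ek | ek
      · rw [ek]
      · rw [ek, ← alternatingProd_smul hκ hp]
    · rcases lt_or_gt_of_one_lt_sqRadius hY hr1 with hX | hX
      · obtain rfl := region_eq_right (hR.2.resolve_left (by simp [hY])) hX hj.1 hZ
        obtain ⟨k, hk, hp⟩ := exists_index_front hr hY.ge ho
        have hA := angle_eq_zero hY (by linarith : centre j < P 0)
        refine ⟨g (j + 1) • alternatingProd (g j) (g (j + 1)) k •
          κ (if 0 < along (centre j) (n j) P then j + 1 else j), ?_⟩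
        filter_upwards [ev2,
          eventually_floor_eq_or (continuousAt_front hr) (k := k) (by linarith) (by linarith),
          eventually_floor_eq_or (continuousAt_back hr) (k := k) (by linarith) (by linarith)]
          with P' e2 ek ek' e
        rw [columnValue, if_congr e rfl rfl, regionGauge, Region.elem_ofFin]
        by_cases h1 : P' 1 < 0
        · rw [if_pos h1, columnGauge_back e2 h1, ← mul_smul (g (j + 1)), hg, one_smul]
          rcases ek' with ek | ek
          · rw [ek]
          · rw [ek, ← alternatingProd_smul hκ hp]
        · rw [if_neg h1, columnGauge_front e2 (not_lt.1 h1), mul_smul, one_smul]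
          rcases ek with ek | ek
          · rw [ek]
          · rw [ek, ← alternatingProd_smul hκ hp]
      · obtain rfl := region_eq_left (hR.2.resolve_left (by simp [hY])) hX hj.1 hZ
        obtain ⟨k, hk, hp⟩ := exists_index_front hr hY.ge ho
        have hA := angle_eq_one hY (by linarith : P 0 < centre j)
        -- The angle is 1 on the left, so the floor behind is near `k + 2` when the one in front is
        -- near `k`.
        have hp' : 0 < along (centre j) (n j) P ↔ Even (k + 2) := by
          rw [hp]; simp
        refine ⟨g (j + 1) • alternatingProd (g j) (g (j + 1)) k •
          κ (if 0 < along (centre j) (n j) P then j + 1 else j), ?_⟩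
        filter_upwards [ev2,
          eventually_floor_eq_or (continuousAt_front hr) (k := k) (by linarith) (by linarith),
          eventually_floor_eq_or (continuousAt_back hr) (k := k + 2) (by push_cast; linarith)
            (by push_cast; linarith)]
          with P' e2 ek ek' e
        rw [columnValue, if_congr e rfl rfl, regionGauge, Region.elem_ofFin]
        by_cases h1 : P' 1 < 0
        · rw [if_pos h1, columnGauge_back e2 h1, ← mul_smul, ← mul_smul,
            ← alternatingProd_add_two]
          rcases ek' with ek | ek
          · rw [ek]
          · rw [ek, ← alternatingProd_smul hκ hp']
        · rw [if_neg h1, columnGauge_front e2 (not_lt.1 h1), mul_smul, one_smul]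
          rcases ek with ek | ek
          · rw [ek]
          · rw [ek, ← alternatingProd_smul hκ hp]
    · obtain ⟨k, hk, hp⟩ := exists_index_front hr hY.le ho
      refine ⟨(regionGauge g R P)⁻¹ • g (j + 1) • alternatingProd (g j) (g (j + 1)) k •
        κ (if 0 < along (centre j) (n j) P then j + 1 else j), ?_⟩
      filter_upwards [ev2, hc1.eventually (lt_mem_nhds hY),
        eventually_regionGauge_of_ne_zero (g := g) (R := R) hY.ne',
        eventually_floor_eq_or (continuousAt_front hr) (k := k) (by linarith) (by linarith)]
        with P' e2 e1 eR ek e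
      rw [eR, smul_inv_smul, columnValue, columnGauge_front e2 e1.le, if_congr e rfl rfl, mul_smul]
      rcases ek with ek | ek
      · rw [ek]
      · rw [ek, ← alternatingProd_smul hκ hp]
  have hs0 := hs.self_of_nhds Iff.rfl
  filter_upwards [hs, eventually_along_pos_iff ha] with P' h1 h2
  rw [h1 h2, hs0, inv_smul_smul, inv_smul_smul]

end flatSection

end Pretzel

/-! ### Matching the section along columns and arcs -/

namespace Pretzel

variable {G : Type*} [Group G] {g : Fin 3 → G} {n : Fin 3 → ℤ}
variable {S : Type*} [MulAction G S] {κ : Fin 3 → S}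

theorem cos_sin_bound {x : ℝ} (hx : |x| ≤ 2 / 5) :
    9 / 10 ≤ Real.cos x ∧ |Real.sin x| ≤ 2 / 5 := by
  refine ⟨?_, Real.abs_sin_le_abs.trans hx⟩
  have h1 := Real.one_sub_sq_div_two_le_cos (x := x)
  have h2 : x ^ 2 ≤ (2 / 5) ^ 2 := sq_le_sq' (abs_le.1 hx).1 (abs_le.1 hx).2
  linarith

theorem cos_pi_mul_int (k : ℤ) : Real.cos (Real.pi * k) = if Even k then 1 else -1 := by
  rw [mul_comm, Real.cos_int_mul_pi]
  split_ifs with h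
  · exact h.neg_one_zpow
  · exact (Int.not_even_iff_odd.1 h).neg_one_zpow

/-- Near the ends of a column the strands are close to the plane of projection. -/
theorem exists_along_eq {c : ℝ} {m N : ℤ} {P : Space3} (hN : |turns m P - N| < 1 / 8) :
    ∃ u v : ℝ, 9 / 10 ≤ u ∧ |v| ≤ 2 / 5 ∧
      along c m P = (if Even N then 1 else -1) * ((P 0 - c) * u + P 1 * v) := by
  -- This is π/8 < 2/5.
  have h1 : |Real.pi * (turns m P - N)| ≤ 2 / 5 := by
    rw [abs_mul, abs_of_pos Real.pi_pos]
    nlinarith [Real.pi_lt_d2, abs_nonneg (turns m P - N), Real.pi_pos]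
  obtain ⟨h2, h3⟩ := cos_sin_bound h1
  refine ⟨_, _, h2, h3, ?_⟩
  have h4 : Real.pi * turns m P = Real.pi * N + Real.pi * (turns m P - N) := by ring
  rw [along, h4, Real.cos_add, Real.sin_add, sin_pi_mul_int, cos_pi_mul_int]
  ring

theorem angle_lt_half {c : ℝ} {P : Space3} (h : c < P 0) : angle c P < 1 / 2 := by
  have hr : 0 < sqRadius c P := by unfold sqRadius; nlinarith [sq_nonneg (P 1)]
  by_contra! hA
  have h1 := sqrt_mul_cos hr
  have h2 : Real.cos (Real.pi * angle c P) ≤ 0 :=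
    Real.cos_nonpos_of_pi_div_two_le_of_le (by nlinarith [Real.pi_pos])
      (by nlinarith [Real.pi_pos, angle_le_one (c := c) (P := P)])
  nlinarith [Real.sqrt_nonneg (sqRadius c P)]

theorem half_lt_angle {c : ℝ} {P : Space3} (h : P 0 < c) : 1 / 2 < angle c P := by
  have hr : 0 < sqRadius c P := by unfold sqRadius; nlinarith [sq_nonneg (P 1)]
  by_contra! hA
  have h1 := sqrt_mul_cos hr
  have h2 : 0 ≤ Real.cos (Real.pi * angle c P) :=
    Real.cos_nonneg_of_neg_pi_div_two_le_of_le
      (by nlinarith [Real.pi_pos, angle_nonneg (c := c) (P := P)]) (by nlinarith [Real.pi_pos])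
  nlinarith [Real.sqrt_nonneg (sqRadius c P)]

theorem floor_eq_or {t : ℝ} {k : ℤ} (h1 : (k : ℝ) - 1 ≤ t) (h2 : t < k + 1) :
    ⌊t⌋ = k ∨ ⌊t⌋ = k - 1 := by
  rcases le_or_gt (k : ℝ) t with h | h
  · exact Or.inl (Int.floor_eq_iff.2 ⟨h, h2⟩)
  · exact Or.inr (Int.floor_eq_iff.2 ⟨by push_cast; exact h1, by push_cast; linarith⟩)

/-- The heights at which a column is nearly untwisted. -/
def NearEnd (g : Fin 3 → G) (n : Fin 3 → ℤ) (j : Fin 3) (N : ℤ) (P : Space3) : Prop :=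
  |turns (n j) P - N| < 1 / 8 ∧
    (1 ≤ |P 2| → columnGauge (g j) (g (j + 1)) (centre j) (n j) P =
      alternatingProd (g j) (g (j + 1)) N)

/-- Here the angle is below 1/2, so the floors in front and behind are `N` or `N - 1`. Both words
act alike on the coset, and the extra front factor `g (j + 1)` fixes `κ (j + 1)`. -/
theorem columnValue_right (hκ : ∀ i, g i • κ i = κ i) {j : Fin 3} {N : ℤ} {P : Space3}
    (hN : NearEnd g n j N P)
    (hT : alternatingProd (g j) (g (j + 1)) N • κ (if Even N then j + 1 else j) = κ (j + 1))
    (hX : centre j + 1 / 2 < P 0) (hY : |P 1| < 1 / 2) :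
    along (centre j) (n j) P ≠ 0 ∧ columnValue g n κ j P = κ (j + 1) := by
  obtain ⟨h1, h2⟩ := hN
  obtain ⟨u, v, hu, hv, ha⟩ := exists_along_eq (c := centre j) h1
  have hpos : 0 < (P 0 - centre j) * u + P 1 * v := by
    have : |P 1 * v| ≤ 1 / 2 * (2 / 5) := by rw [abs_mul]; gcongr
    nlinarith [(abs_le.1 this).1]
  generalize (P 0 - centre j) * u + P 1 * v = w at ha hpos
  have hp : 0 < along (centre j) (n j) P ↔ Even N := by
    rw [ha]; split_ifs with h <;> simp [h, hpos, hpos.le]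
  have hne : along (centre j) (n j) P ≠ 0 := by
    rw [ha]; split_ifs with h <;> simp [hpos.ne']
  refine ⟨hne, ?_⟩
  rw [← if_congr hp rfl rfl] at hT
  have hA := angle_lt_half (by linarith : centre j < P 0)
  have hA0 := angle_nonneg (c := centre j) (P := P)
  rw [abs_lt] at h1
  have key : ∀ {k : ℤ}, k = N ∨ k = N - 1 → alternatingProd (g j) (g (j + 1)) k •
      κ (if 0 < along (centre j) (n j) P then j + 1 else j) = κ (j + 1) := by
    rintro _ (rfl | rfl)
    · exact hT
    · rw [← alternatingProd_smul hκ hp, hT]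
  unfold columnValue
  rcases le_or_gt 1 |P 2| with hZ | hZ
  · rw [h2 hZ, hT]
  · rcases le_or_gt 0 (P 1) with hY | hY
    · rw [columnGauge_front hZ hY, mul_smul, key (floor_eq_or (by linarith) (by linarith)), hκ]
    · rw [columnGauge_back hZ hY, key (floor_eq_or (by linarith) (by linarith))]

/-- Here the angle exceeds 1/2: the floors are `N - 1` or `N - 2` in front and `N` or `N + 1`
behind. Each pair acts alike on the coset, and `hN'` identifies front with back. -/
theorem columnValue_left (hκ : ∀ i, g i • κ i = κ i) {j : Fin 3} {N : ℤ} {P : Space3}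
    (hN : NearEnd g n j N P)
    (hN' : g (j + 1) * alternatingProd (g j) (g (j + 1)) (N - 1) =
      alternatingProd (g j) (g (j + 1)) N)
    (hT : alternatingProd (g j) (g (j + 1)) N • κ (if Even N then j else j + 1) = κ j)
    (hX : P 0 < centre j - 1 / 2) (hY : |P 1| < 1 / 2) :
    along (centre j) (n j) P ≠ 0 ∧ columnValue g n κ j P = κ j := by
  obtain ⟨h1, h2⟩ := hN
  obtain ⟨u, v, hu, hv, ha⟩ := exists_along_eq (c := centre j) h1
  have hneg : (P 0 - centre j) * u + P 1 * v < 0 := by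
    have : |P 1 * v| ≤ 1 / 2 * (2 / 5) := by rw [abs_mul]; gcongr
    nlinarith [(abs_le.1 this).2]
  generalize (P 0 - centre j) * u + P 1 * v = w at ha hneg
  have hp : 0 < along (centre j) (n j) P ↔ ¬ Even N := by
    rw [ha]; split_ifs with h <;> simp only [one_mul, neg_mul, h] <;> simp <;> linarith
  have hne : along (centre j) (n j) P ≠ 0 := by
    rw [ha]; split_ifs with h <;> simp [hneg.ne]
  refine ⟨hne, ?_⟩
  have hp1 : 0 < along (centre j) (n j) P ↔ Even (N - 1) := by
    rw [hp, Int.even_sub_one]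
  have hp2 : 0 < along (centre j) (n j) P ↔ Even (N + 1) := by
    rw [hp, Int.even_add_one]
  rw [← ite_not, ← if_congr hp rfl rfl] at hT
  have hA := half_lt_angle (by linarith : P 0 < centre j)
  have hA0 := angle_le_one (c := centre j) (P := P)
  rw [abs_lt] at h1
  unfold columnValue
  rcases le_or_gt 1 |P 2| with hZ | hZ
  · rw [h2 hZ, hT]
  · rcases le_or_gt 0 (P 1) with hY | hY
    · have e : alternatingProd (g j) (g (j + 1)) ⌊turns (n j) P - angle (centre j) P⌋ •
          κ (if 0 < along (centre j) (n j) P then j + 1 else j) =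
          alternatingProd (g j) (g (j + 1)) (N - 1) •
          κ (if 0 < along (centre j) (n j) P then j + 1 else j) := by
        rcases floor_eq_or (k := N - 1) (t := turns (n j) P - angle (centre j) P)
          (by push_cast; linarith) (by push_cast; linarith) with h | h
        · rw [h]
        · rw [h, ← alternatingProd_smul hκ hp1]
      rw [columnGauge_front hZ hY, mul_smul, e, ← mul_smul, hN', hT]
    · have e : alternatingProd (g j) (g (j + 1)) ⌊turns (n j) P + angle (centre j) P⌋ •
          κ (if 0 < along (centre j) (n j) P then j + 1 else j) =
          alternatingProd (g j) (g (j + 1)) N •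
          κ (if 0 < along (centre j) (n j) P then j + 1 else j) := by
        rcases floor_eq_or (k := N + 1) (t := turns (n j) P + angle (centre j) P)
          (by push_cast; linarith) (by push_cast; linarith) with h | h
        · rw [h, alternatingProd_smul hκ hp2, add_sub_cancel_right]
        · rw [h, add_sub_cancel_right]
      rw [columnGauge_back hZ hY, e, hT]

/-- The cosets `κ` are compatible with the twisting of the columns. -/
structure IsCompatible (g : Fin 3 → G) (n : Fin 3 → ℤ) (κ : Fin 3 → S) : Prop where
  mul_self : ∀ i, g i * g i = 1
  zpow : ∀ j, (g j * g (j + 1)) ^ n j = 1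
  smul : ∀ i, g i • κ i = κ i
  -- The strand ending at the top right starts at the bottom right if `n j` is even and at the
  -- bottom left if it is odd.
  right : ∀ j, alternatingProd (g j) (g (j + 1)) (n j) • κ (if Even (n j) then j + 1 else j) =
    κ (j + 1)
  left : ∀ j, alternatingProd (g j) (g (j + 1)) (n j) • κ (if Even (n j) then j else j + 1) = κ j

/-- A thin neighbourhood of an arc. -/
def arcNbhd (η : ℝ) (i : Fin 3) : Set Space3 := {P | |P 1| < 1 / 2 ∧ 1 - η < |P 2|} ∩ nearArc i

theorem isOpen_arcNbhd (η : ℝ) (i : Fin 3) : IsOpen (arcNbhd η i) :=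
  ((isOpen_lt (by fun_prop : Continuous fun P : Space3 => |P 1|) continuous_const).inter
    (isOpen_lt continuous_const (by fun_prop : Continuous fun P : Space3 => |P 2|))).inter
    (isOpen_nearArc i)

/-- Within distance η of an end the twist deviates from its end value by less than 1/8 of a half
turn; `N` is `n j` at the top and 0 at the bottom. -/
theorem exists_nearEnd (H : IsCompatible g n κ) {j : Fin 3} {η : ℝ} (hη : |(n j : ℝ)| * η < 1 / 4)
    (hη1 : η ≤ 1) {P : Space3} (hZ : 1 - η < |P 2|) : ∃ N, NearEnd g n j N P ∧
      g (j + 1) * alternatingProd (g j) (g (j + 1)) (N - 1) = alternatingProd (g j) (g (j + 1)) N ∧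
      alternatingProd (g j) (g (j + 1)) N • κ (if Even N then j + 1 else j) = κ (j + 1) ∧
      alternatingProd (g j) (g (j + 1)) N • κ (if Even N then j else j + 1) = κ j := by
  have hb : ∀ s : ℝ, |s| ≤ η → |(n j : ℝ) * s / 2| < 1 / 8 := fun s hs => by
    rw [abs_div, abs_mul, abs_two]
    have := mul_le_mul_of_nonneg_left hs (abs_nonneg (n j : ℝ))
    linarith
  rcases lt_abs.1 hZ with h | h
  · refine ⟨n j, ⟨?_, fun h1 => ?_⟩, mul_alternatingProd_of_zpow_eq_one (H.mul_self _)
      (H.mul_self _) (H.zpow j), H.right j, H.left j⟩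
    · rcases le_or_gt 1 (P 2) with h1 | h1
      · rw [turns_of_one_le h1]; norm_num
      · rw [turns_of_abs_le_one (abs_le.2 ⟨by linarith, h1.le⟩)]
        have := hb (P 2 - 1) (abs_le.2 ⟨by linarith, by linarith⟩)
        rwa [show (n j : ℝ) * (P 2 + 1) / 2 - n j = n j * (P 2 - 1) / 2 by ring]
    · refine if_pos ?_
      rcases le_abs.1 h1 with h1 | h1 <;> linarith
  · refine ⟨0, ⟨?_, fun h1 => ?_⟩, mul_alternatingProd_of_zpow_eq_one (H.mul_self _)
      (H.mul_self _) (zpow_zero _), by simp, by simp⟩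
    · rw [Int.cast_zero, sub_zero]
      rcases le_or_gt (P 2) (-1) with h1 | h1
      · rw [turns_of_le_neg_one h1]; norm_num
      · rw [turns_of_abs_le_one (abs_le.2 ⟨by linarith, by linarith⟩)]
        exact hb (P 2 + 1) (abs_le.2 ⟨by linarith, by linarith⟩)
    · have h3 : P 2 ≤ -1 := by rcases le_abs.1 h1 with h1 | h1 <;> linarith
      rw [columnGauge, if_neg (by linarith), if_pos h3, alternatingProd_zero]

theorem nearArc_near_column {i j : Fin 3} {P : Space3} (hi : P ∈ nearArc i) (hj : P ∈ nearColumn j) :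
    (i = j + 1 ∧ centre j + 1 / 2 < P 0) ∨ (i = j ∧ P 0 < centre j - 1 / 2) := by
  have h1 := abs_lt.1 (abs_sub_centre_lt hj.1)
  have h2 := hj.2
  fin_cases i
  · have h : 7 / 2 < |P 0| := Or.resolve_right hi (by linarith)
    rw [lt_abs] at h
    fin_cases j <;> simp [centre] at h1 ⊢ <;> rcases h with h | h <;> linarith
  · obtain ⟨h3, h4, h5⟩ : -5 / 2 < P 0 ∧ P 0 < -1 / 2 ∧ |P 2| < 5 / 4 := hi
    fin_cases j <;> simp [centre] at h1 ⊢ <;> linarith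
  · obtain ⟨h3, h4, h5⟩ : 1 / 2 < P 0 ∧ P 0 < 5 / 2 ∧ |P 2| < 5 / 4 := hi
    fin_cases j <;> simp [centre] at h1 ⊢ <;> linarith

theorem columnValue_of_arcNbhd (H : IsCompatible g n κ) {i j : Fin 3} {η : ℝ}
    (hη : |(n j : ℝ)| * η < 1 / 4) (hη1 : η ≤ 1) {P : Space3} (hi : P ∈ arcNbhd η i)
    (hj : P ∈ nearColumn j) : along (centre j) (n j) P ≠ 0 ∧ columnValue g n κ j P = κ i := by
  obtain ⟨N, hN, h1, h2, h3⟩ := exists_nearEnd H hη hη1 hi.1.2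
  rcases nearArc_near_column hi.2 hj with ⟨rfl, hX⟩ | ⟨rfl, hX⟩
  · exact columnValue_right H.smul hN h2 hX hi.1.1
  · exact columnValue_left H.smul hN h1 h3 hX hi.1.1

theorem nearSection_of_arcNbhd (H : IsCompatible g n κ) {i : Fin 3} {η : ℝ}
    (hη : ∀ j, |(n j : ℝ)| * η < 1 / 4) (hη1 : η ≤ 1) {P : Space3} (hi : P ∈ arcNbhd η i) :
    nearSection g n κ P = κ i := by
  by_cases h : ∃ j, P ∈ nearColumn j
  · obtain ⟨j, hj⟩ := h
    rw [nearSection_of_mem hj]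
    exact (columnValue_of_arcNbhd H (hη j) hη1 hi hj).2
  · rw [nearSection_of_forall_notMem (not_exists.1 h), arcLabel_eq hi.2]

/-- A neighbourhood of the open strands of a column. -/
def strandNbhd (n : Fin 3 → ℤ) (j : Fin 3) : Set Space3 :=
  nearColumn j ∩ {P | |P 2| < 1 ∧ along (centre j) (n j) P ≠ 0}

theorem isOpen_strandNbhd (j : Fin 3) : IsOpen (strandNbhd n j) :=
  (isOpen_nearColumn j).inter
    ((isOpen_lt (by fun_prop : Continuous fun P : Space3 => |P 2|) continuous_const).inter
      (isOpen_ne_fun continuous_along continuous_const))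

/-- In a column chart each strand carries a fixed coset. In a region chart the section near an arc
is constant and fixed by the generators of the adjacent regions, and over the swept surface
`eventually_columnValue_region` applies. -/
theorem eventually_nearSection (H : IsCompatible g n κ) {η : ℝ}
    (hη : ∀ j, |(n j : ℝ)| * η < 1 / 4) (hη1 : η ≤ 1) {P : Space3}
    (hP : (∃ i, P ∈ arcNbhd η i) ∨ ∃ j, P ∈ strandNbhd n j) (hc : ∃ i, P ∈ chart n i) :
    ∃ i, P ∈ chart n i ∧ ∀ᶠ P' in 𝓝 P, (gauge g n i P')⁻¹ • nearSection g n κ P' =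
      (gauge g n i P)⁻¹ • nearSection g n κ P := by
  have hsec : ∀ {j}, P ∈ nearColumn j → ∀ᶠ P' in 𝓝 P,
      nearSection g n κ P' = columnValue g n κ j P' := fun {j} hj => by
    filter_upwards [(isOpen_nearColumn j).mem_nhds hj] with P' h
    exact nearSection_of_mem h
  by_cases hcol : ∃ j, P ∈ columnChart n j
  · obtain ⟨j, hj⟩ := hcol
    have hj' : P ∈ nearColumn j := ⟨hj.1, hj.2.1⟩
    refine ⟨.inr j, hj, ?_⟩
    have ha : along (centre j) (n j) P ≠ 0 := by
      rcases hP with ⟨i, hi⟩ | ⟨j', hj''⟩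
      · exact (columnValue_of_arcNbhd H (hη j) hη1 hi hj').1
      · obtain rfl := centre_injOn hj.1 hj''.1.1
        exact hj''.2.2
    filter_upwards [hsec hj', eventually_along_pos_iff ha] with P' h1 h2
    rw [h1, nearSection_of_mem hj', columnValue, columnValue, if_congr h2 rfl rfl]
    exact (inv_smul_smul _ _).trans (inv_smul_smul _ _).symm
  · obtain ⟨R | j, hR⟩ := hc
    swap
    · exact absurd ⟨j, hR⟩ hcol
    refine ⟨.inl R, hR, ?_⟩
    change ∀ᶠ P' in 𝓝 P, (regionGauge g R P')⁻¹ • nearSection g n κ P' =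
      (regionGauge g R P)⁻¹ • nearSection g n κ P
    rcases hP with ⟨i, hi⟩ | ⟨j, hj⟩
    · have hev : ∀ᶠ P' in 𝓝 P, nearSection g n κ P' = κ i := by
        filter_upwards [(isOpen_arcNbhd η i).mem_nhds hi] with P' h
        exact nearSection_of_arcNbhd H hη hη1 h
      by_cases hY : P 1 = 0
      · have hfix : ∀ P', (regionGauge g R P')⁻¹ • κ i = κ i := fun P' => by
          rw [inv_smul_eq_iff, regionGauge]
          split_ifs
          · rcases region_of_nearArc (hR.2.resolve_left (by simp [hY])) hi.2 with rfl | rfl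
            · exact (one_smul G (κ i)).symm
            · rw [Region.elem_ofFin, H.smul]
          · rw [one_smul]
        filter_upwards [hev] with P' h
        rw [h, hev.self_of_nhds, hfix, hfix]
      · filter_upwards [hev, eventually_regionGauge_of_ne_zero (g := g) (R := R) hY] with P' h h'
        rw [h, hev.self_of_nhds, h']
    · have hoff : offset (centre j) (n j) P = 0 := by
        by_contra h
        exact hcol ⟨j, hj.1.1, hj.1.2, Or.inr h⟩
      filter_upwards [hsec hj.1, eventually_columnValue_region H.mul_self H.smul hR hj.1 hj.2.1
        hoff hj.2.2] with P' h1 h2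
      rw [h1, h2, nearSection_of_mem hj.1]

theorem along_sq_add_offset_sq (c : ℝ) (m : ℤ) (P : Space3) :
    along c m P ^ 2 + offset c m P ^ 2 = sqRadius c P := by
  unfold along offset sqRadius
  linear_combination ((P 0 - c) ^ 2 + P 1 ^ 2) * Real.sin_sq_add_cos_sq (Real.pi * turns m P)

theorem mem_nbhd_of_mem_standardPretzel {η : ℝ} (hη : 0 < η) {P : Space3}
    (hP : P ∈ standardPretzel (n 0) (n 1) (n 2)) :
    (∃ i, P ∈ arcNbhd η i) ∨ ∃ j, P ∈ strandNbhd n j := by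
  have key : P 1 = 0 → 1 ≤ |P 2| → (∃ i, P ∈ nearArc i) → ∃ i, P ∈ arcNbhd η i :=
    fun h1 h2 ⟨i, hi⟩ => ⟨i, ⟨by simp [h1], by linarith⟩, hi⟩
  rcases mem_standardPretzel_iff.1 hP with ⟨hY, h⟩ | ⟨j, hZ, hr, ho⟩
  · left
    rcases h with ⟨h, ⟨h1, h2⟩ | ⟨h1, h2⟩⟩ | ⟨h1, h2, h3⟩ | ⟨h1, h2⟩
    · exact key hY h.ge ⟨1, by linarith, by linarith, by linarith⟩
    · exact key hY h.ge ⟨2, by linarith, by linarith, by linarith⟩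
    · exact key hY h2 ⟨0, Or.inl (by rw [h1]; norm_num)⟩
    · exact key hY (by linarith) ⟨0, Or.inr (by rw [h2]; norm_num)⟩
  · rcases hZ.lt_or_eq with hZ | hZ
    · right
      refine ⟨j, ⟨by linarith, by linarith⟩, hZ, fun ha => ?_⟩
      have := along_sq_add_offset_sq (centre j) (n j) P
      rw [ha, ho, hr] at this
      norm_num at this
    · left
      have hY := (offset_of_one_le_abs hZ.ge).1 ho
      refine key hY hZ.ge ?_
      rw [sqRadius, hY, zero_pow two_ne_zero, add_zero, pow_two, mul_self_eq_one_iff] at hr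
      rcases hr with hr | hr
      · refine ⟨j + 1, ?_⟩
        fin_cases j <;> simp [centre] at hr
        · exact ⟨by linarith, by linarith, by linarith⟩
        · exact ⟨by linarith, by linarith, by linarith⟩
        · exact Or.inl (lt_abs.2 (Or.inl (by linarith)))
      · refine ⟨j, ?_⟩
        fin_cases j <;> simp [centre] at hr
        · exact Or.inl (lt_abs.2 (Or.inr (by linarith)))
        · exact ⟨by linarith, by linarith, by linarith⟩
        · exact ⟨by linarith, by linarith, by linarith⟩

end Pretzel

/-! ### Paths in the complement and their transport -/

namespace Pretzel

theorem joinedIn_of_forall {s : Set Space3} {P Q : Space3}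
    (h : ∀ t ∈ Set.Icc (0 : ℝ) 1, ∀ R : Space3, (∀ i, R i = P i + t * (Q i - P i)) → R ∈ s) :
    JoinedIn s P Q := by
  refine JoinedIn.of_segment_subset fun R hR => ?_
  rw [segment_eq_image'] at hR
  obtain ⟨t, ht, rfl⟩ := hR
  exact h t ht _ fun i => by simp

theorem Region.contains_congr {R : Region} {P Q : Space3} (h0 : Q 0 = P 0) (h2 : Q 2 = P 2) :
    R.Contains Q ↔ R.Contains P := by
  cases R <;> simp only [Region.Contains, h0, h2]

/-- Moving away from the plane of projection increases the distance to the axes of the columns. -/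
theorem mem_regionChart_of_abs_le {R : Region} {P Q : Space3} (hP : P ∈ regionChart R)
    (h0 : Q 0 = P 0) (h2 : Q 2 = P 2) (h1 : |P 1| ≤ |Q 1|) : Q ∈ regionChart R := by
  constructor
  · refine fun j => (hP.1 j).imp (fun h => h.trans_le ?_) fun h => by rwa [h2]
    rw [sqRadius, sqRadius, h0]
    gcongr 1
    exact sq_le_sq.2 h1
  · by_cases hQ : Q 1 = 0
    · have hP1 : P 1 = 0 := by simpa [hQ] using h1
      exact Or.inr ((Region.contains_congr h0 h2).2 (hP.2.resolve_left (by simp [hP1])))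
    · exact Or.inl hQ

theorem mem_inner_of_one_lt_abs {P : Space3} (h : 1 < |P 1|) : P ∈ regionChart .inner := by
  have h1 : 1 < P 1 ^ 2 := by rw [← sq_abs]; exact one_lt_pow₀ h two_ne_zero
  refine ⟨fun j => Or.inl ?_, Or.inl fun h0 => ?_⟩
  · unfold sqRadius; nlinarith [sq_nonneg (P 0 - centre j)]
  · simp [h0] at h1
    linarith

/-- A point of the plane of projection in each region. -/
noncomputable def Region.point : Region → ℝ × ℝ
  | .inner => (0, 3 / 2)
  | .outer => (5, 0)
  | .left => (-3 / 2, 0)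
  | .right => (3 / 2, 0)

theorem Region.point_mem_regionChart (R : Region) (y : ℝ) :
    !₂[R.point.1, y, R.point.2] ∈ regionChart R := by
  refine mem_regionChart_of_abs_le (P := !₂[R.point.1, 0, R.point.2]) ?_ rfl rfl (by simp)
  refine ⟨fun j => ?_, Or.inr ?_⟩
  · cases R <;> fin_cases j <;> simp [sqRadius, centre, Region.point] <;> norm_num [lt_abs]
  · cases R <;> simp [Region.point, Region.Contains] <;> norm_num [abs_of_pos, lt_abs]

theorem joinedIn_point (R : Region) :
    JoinedIn (regionChart R) !₂[R.point.1, 3, R.point.2] !₂[R.point.1, -3, R.point.2] := by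
  refine joinedIn_of_forall fun t ht Q hQ => ?_
  exact mem_regionChart_of_abs_le (R.point_mem_regionChart 0) (by simp [hQ]) (by simp [hQ])
    (by simp)

theorem joinedIn_front {P Q : Space3} (hP : 1 < P 1) (hQ : 1 < Q 1) :
    JoinedIn (regionChart .inner) P Q := by
  refine joinedIn_of_forall fun t ht R hR => mem_inner_of_one_lt_abs (lt_abs.2 (Or.inl ?_))
  rw [hR]
  have h1 := mul_nonneg (sub_nonneg.2 ht.2) (sub_pos.2 hP).le
  rcases ht.1.eq_or_lt with rfl | h
  · linarith
  · nlinarith [mul_pos h (sub_pos.2 hQ)]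

theorem joinedIn_back {P Q : Space3} (hP : P 1 < -1) (hQ : Q 1 < -1) :
    JoinedIn (regionChart .inner) P Q := by
  refine joinedIn_of_forall fun t ht R hR => mem_inner_of_one_lt_abs (lt_abs.2 (Or.inr ?_))
  rw [hR]
  have h1 := mul_nonneg (sub_nonneg.2 ht.2) (sub_pos.2 hP).le
  rcases ht.1.eq_or_lt with rfl | h
  · linarith
  · nlinarith [mul_pos h (sub_pos.2 hQ)]

/-- The base point, in front of the plane of projection. -/
noncomputable def frontPoint : Space3 := !₂[0, 3, 0]

section transport

variable {G : Type*} [Group G] {g : Fin 3 → G} {n : Fin 3 → ℤ}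
variable {ι B : Type*} [TopologicalSpace B] (L : LocalSystem ι B G) {e : Space3 → B}
  {σ : Region ⊕ Fin 3 → ι}
  (he : ∀ i, ContinuousOn e (chart n i)) (hchart : ∀ i, ∀ P ∈ chart n i, e P ∈ L.chart (σ i))
  (hgauge : ∀ i, ∀ P ∈ chart n i, L.gauge (σ i) (e P) = gauge g n i P)

include he hchart hgauge

theorem joined_pt_of_joinedIn {i : Region ⊕ Fin 3} {P Q : Space3} (h : JoinedIn (chart n i) P Q)
    (v : G) : Joined (L.pt (e P) (gauge g n i P * v)) (L.pt (e Q) (gauge g n i Q * v)) := by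
  obtain ⟨γ, hγ⟩ := h
  have hc : ContinuousOn e (Set.range γ) := (he i).mono (Set.range_subset_iff.2 hγ)
  have hP : P ∈ chart n i := by simpa using hγ 0
  have hQ : Q ∈ chart n i := by simpa using hγ 1
  rw [← hgauge i P hP, ← hgauge i Q hQ]
  exact L.joined_pt_of_chart (γ.map' hc) (i := σ i) (fun t => hchart i _ (hγ t)) v

/-- The path runs in front of the plane to the region R, through it, and behind the plane to a
common point; the middle leg contributes the generator of R. -/
theorem joined_pt_elem (R : Region) (v : G) :
    Joined (L.pt (e frontPoint) v) (L.pt (e !₂[0, -3, 0]) (R.elem g * v)) := by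
  have key : ∀ {R : Region} {P Q : Space3}, JoinedIn (regionChart R) P Q → ∀ v,
      Joined (L.pt (e P) (regionGauge g R P * v)) (L.pt (e Q) (regionGauge g R Q * v)) :=
    fun {R} _ _ h v => joined_pt_of_joinedIn L he hchart hgauge (i := .inl R) h v
  have h1 := key (joinedIn_front (P := frontPoint) (Q := !₂[R.point.1, 3, R.point.2])
    (by simp [frontPoint]) (by simp)) v
  have h2 := key (joinedIn_point R) v
  have h3 := key (joinedIn_back (P := !₂[R.point.1, -3, R.point.2]) (Q := !₂[0, -3, 0])
    (by norm_num) (by norm_num)) (R.elem g * v)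
  have hi : Region.inner.elem g = 1 := rfl
  norm_num [regionGauge, frontPoint, hi] at h1 h2 h3
  exact (h1.trans h2).trans h3

/-- Returning to the front through the inner region, whose generator is 1, gives paths realizing
each `g i`; these compose and reverse. -/
theorem joined_pt_of_mem_closure {c : G} (hc : c ∈ Subgroup.closure (Set.range g)) (v : G) :
    Joined (L.pt (e frontPoint) v) (L.pt (e frontPoint) (c * v)) := by
  induction hc using Subgroup.closure_induction generalizing v with
  | mem x hx =>
    obtain ⟨i, rfl⟩ := hx
    have h1 := joined_pt_elem L he hchart hgauge (Region.ofFin i) v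
    have h2 := joined_pt_elem L he hchart hgauge .inner (g i * v)
    rw [Region.elem_ofFin] at h1
    simp only [Region.elem, one_mul] at h2
    exact h1.trans h2.symm
  | one => rw [one_mul]
  | mul x y _ _ hx hy => rw [mul_assoc]; exact (hy v).trans (hx (y * v))
  | inv x _ hx => simpa using (hx (x⁻¹ * v)).symm

end transport

section connected

variable {n : Fin 3 → ℤ}

theorem joinedIn_frontPoint_of_region {s : Set Space3} (hs : ∀ i, chart n i ⊆ s) {R : Region}
    {P : Space3} (hP : P ∈ regionChart R) : JoinedIn s P frontPoint := by
  have hs' : ∀ {R}, regionChart R ⊆ s := fun {R} => hs (.inl R)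
  have h1 : JoinedIn s !₂[0, 3, 3 / 2] frontPoint :=
    (joinedIn_front (by simp) (by simp [frontPoint])).mono hs'
  have h2 : JoinedIn s !₂[0, 3, 3 / 2] !₂[0, -3, 3 / 2] := (joinedIn_point .inner).mono hs'
  rcases le_or_gt 0 (P 1) with hY | hY
  · have h3 : JoinedIn s P !₂[P 0, P 1 + 3, P 2] := by
      refine (joinedIn_of_forall fun t ht Q hQ => ?_).mono (hs' (R := R))
      refine mem_regionChart_of_abs_le hP (by simp [hQ]) (by simp [hQ]) ?_
      simp only [hQ]
      simp
      rw [abs_of_nonneg hY, abs_of_nonneg (by linarith [ht.1])]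
      linarith [ht.1]
    exact h3.trans ((joinedIn_front (by simp; linarith) (by simp)).mono hs' |>.trans h1)
  · have h3 : JoinedIn s P !₂[P 0, P 1 - 3, P 2] := by
      refine (joinedIn_of_forall fun t ht Q hQ => ?_).mono (hs' (R := R))
      refine mem_regionChart_of_abs_le hP (by simp [hQ]) (by simp [hQ]) ?_
      simp only [hQ]
      simp
      rw [abs_of_neg hY, abs_of_neg (by linarith [ht.1])]
      linarith [ht.1]
    exact h3.trans ((joinedIn_back (by simp; linarith) (by norm_num)).mono hs' |>.trans
      (h2.symm.trans h1))

theorem joinedIn_frontPoint {s : Set Space3} (hs : ∀ i, chart n i ⊆ s) {i : Region ⊕ Fin 3}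
    {P : Space3} (hP : P ∈ chart n i) : JoinedIn s P frontPoint := by
  rcases i with R | j
  · exact joinedIn_frontPoint_of_region hs hP
  · obtain ⟨h1, h2, h3⟩ := hP
    have hs' : columnChart n j ⊆ s := hs (.inr j)
    -- Radial contraction to the axis multiplies `offset` by `1 - t`, so it stays in the chart.
    have e1 : JoinedIn s P !₂[centre j, 0, P 2] := by
      refine (joinedIn_of_forall fun t ht Q hQ => ?_).mono hs'
      have q0 : Q 0 = P 0 + t * (centre j - P 0) := by simp [hQ]
      have q1 : Q 1 = (1 - t) * P 1 := by simp [hQ]; ring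
      have q2 : Q 2 = P 2 := by simp [hQ]
      have hr : sqRadius (centre j) Q = (1 - t) ^ 2 * sqRadius (centre j) P := by
        rw [sqRadius, sqRadius, q0, q1]; ring
      have ht2 : (1 - t) ^ 2 ≤ 1 := by nlinarith [ht.1, ht.2]
      have hr0 : 0 ≤ sqRadius (centre j) P := by unfold sqRadius; positivity
      have hr1 : sqRadius (centre j) Q ≤ sqRadius (centre j) P := by
        rw [hr]; exact mul_le_of_le_one_left hr0 ht2
      refine ⟨hr1.trans_lt h1, by rwa [q2], ?_⟩
      rcases h3 with h3 | h3
      · exact Or.inl (hr1.trans_lt h3)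
      · by_cases ht1 : t = 1
        · left; rw [hr, ht1]; norm_num
        · right
          have : offset (centre j) (n j) Q = (1 - t) * offset (centre j) (n j) P := by
            simp only [offset, turns, q0, q1, q2]; ring
          rw [this]
          exact mul_ne_zero (sub_ne_zero.2 (Ne.symm ht1)) h3
    -- The axis leads to height 5/4, which is above the column and inside the inner region.
    have e2 : JoinedIn s !₂[centre j, 0, P 2] !₂[centre j, 0, 5 / 4] := by
      refine (joinedIn_of_forall fun t ht Q hQ => ?_).mono hs'
      have q0 : Q 0 = centre j := by simp [hQ]
      have q1 : Q 1 = 0 := by simp [hQ]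
      have q2 : Q 2 = P 2 + t * (5 / 4 - P 2) := by simp [hQ]
      have hr : sqRadius (centre j) Q = 0 := by rw [sqRadius, q0, q1]; ring
      refine ⟨by rw [hr]; norm_num, ?_, Or.inl (by rw [hr]; norm_num)⟩
      rw [abs_lt] at h2 ⊢
      rw [q2]
      constructor <;> nlinarith [ht.1, ht.2]
    refine e1.trans (e2.trans (joinedIn_frontPoint_of_region hs (R := .inner) ?_))
    refine ⟨fun _ => Or.inr ?_, Or.inr ⟨?_, ?_, ?_⟩⟩
    · simp; norm_num [lt_abs]
    · fin_cases j <;> norm_num [centre]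
    · simp; norm_num [lt_abs]
    · simp; norm_num [abs_of_pos]

/-- The complement of a pretzel link is path connected. -/
theorem joinedIn_compl [LocallyPathConnectedSpace (OnePoint Space3)] {Q : OnePoint Space3}
    (hQ : Q ∉ (fun P : Space3 => (P : OnePoint Space3)) '' standardPretzel (n 0) (n 1) (n 2)) :
    JoinedIn ((fun P : Space3 => (P : OnePoint Space3)) '' standardPretzel (n 0) (n 1) (n 2))ᶜ Q
      frontPoint := by
  have hcoe : ∀ {i} {P : Space3}, P ∈ chart n i →
      JoinedIn ((fun P : Space3 => (P : OnePoint Space3)) '' standardPretzel (n 0) (n 1) (n 2))ᶜ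
        (P : OnePoint Space3) frontPoint := fun {i P} hP => by
    have h := joinedIn_frontPoint (s := (standardPretzel (n 0) (n 1) (n 2))ᶜ)
      (fun i P hP => notMem_of_mem_chart hP) hP
    refine (h.map OnePoint.continuous_coe).mono ?_
    rintro _ ⟨P, hP, rfl⟩ ⟨P', hP', h⟩
    exact hP (OnePoint.coe_injective h ▸ hP')
  induction Q using OnePoint.rec with
  | coe P =>
    obtain ⟨i, hi⟩ := exists_mem_compactChart hQ
    exact hcoe (coe_mem_compactChart.1 hi)
  | infty =>
    -- A path connected neighbourhood of infinity inside the outer chart contains finite points.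
    have h1 := pathComponentIn_mem_nhds ((isOpen_compactChart (n := n) (.inl .outer)).mem_nhds
      (infty_mem_compactChart.2 rfl))
    obtain ⟨_, h2, ⟨P, rfl⟩⟩ := mem_closure_iff_nhds.1
      (OnePoint.denseRange_coe (X := Space3) OnePoint.infty) _ h1
    have h3 : JoinedIn (compactChart n (.inl .outer)) OnePoint.infty (P : OnePoint Space3) := h2
    exact (h3.mono fun Q hQ => notMem_of_mem_compactChart hQ).trans
      (hcoe (coe_mem_compactChart.1 h3.target_mem))

end connected

end Pretzel

/-! ### Compatible cosets and numerical preliminaries -/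

namespace Pretzel

/-- `g 1` is the reflection shared by the two odd columns. Its trivial coset is carried across them
by their words, and the even column imposes no further condition since its word is `(g 2 * g 0) ^ m
= 1`. -/
theorem exists_isCompatible {G : Type*} [Group G] {g : Fin 3 → G} {p q r m : ℤ} (hp : Odd p)
    (hq : Odd q) (hr : r = 2 * m) (hg : ∀ i, g i * g i = 1) (h0 : (g 0 * g 1) ^ p = 1)
    (h1 : (g 1 * g 2) ^ q = 1) (h2 : (g 2 * g 0) ^ m = 1) :
    ∃ κ : Fin 3 → G ⧸ Subgroup.zpowers (g 1), IsCompatible g ![p, q, r] κ := by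
  let o : G ⧸ Subgroup.zpowers (g 1) := ((1 : G) : G ⧸ Subgroup.zpowers (g 1))
  have ho : g 1 • o = o := by
    change ((g 1 * 1 : G) : G ⧸ Subgroup.zpowers (g 1)) = ((1 : G) : G ⧸ Subgroup.zpowers (g 1))
    rw [QuotientGroup.eq, mul_one, mul_one]
    exact inv_mem (Subgroup.mem_zpowers _)
  have hpE := Int.not_even_iff_odd.2 hp
  have hqE := Int.not_even_iff_odd.2 hq
  have hrE : Even r := by rw [hr]; simp
  have hpp := alternatingProd_mul_self_of_odd (hg 0) (hg 1) hp
  have hqq := alternatingProd_mul_self_of_odd (hg 1) (hg 2) hq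
  have hpc := mul_alternatingProd_comm_of_odd (hg 0) (hg 1) hp h0
  have hqc := mul_alternatingProd_comm_of_odd (hg 1) (hg 2) hq h1
  have hr1 : alternatingProd (g 2) (g 0) r = 1 := by rw [hr, alternatingProd_two_mul, h2]
  have hqc' : g 2 * alternatingProd (g 1) (g 2) q = alternatingProd (g 1) (g 2) q * g 1 := by
    calc _ = alternatingProd (g 1) (g 2) q * (alternatingProd (g 1) (g 2) q * g 2) *
          alternatingProd (g 1) (g 2) q := by rw [← mul_assoc, hqq, one_mul]
      _ = _ := by rw [← hqc, mul_assoc, mul_assoc, hqq, mul_one]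
  refine ⟨![alternatingProd (g 0) (g 1) p • o, o, alternatingProd (g 1) (g 2) q • o], hg, ?_, ?_,
    ?_, ?_⟩
  · intro j
    fin_cases j
    · exact h0
    · exact h1
    · change (g 2 * g 0) ^ r = 1
      rw [hr, mul_comm, zpow_mul, h2, one_zpow]
  · intro i
    fin_cases i
    · change g 0 • alternatingProd (g 0) (g 1) p • o = alternatingProd (g 0) (g 1) p • o
      rw [← mul_smul, hpc, mul_smul, ho]
    · exact ho
    · change g 2 • alternatingProd (g 1) (g 2) q • o = alternatingProd (g 1) (g 2) q • o
      rw [← mul_smul, hqc', mul_smul, ho]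
  · intro j
    fin_cases j
    · refine (congrArg _ (congrArg _ (if_neg hpE))).trans ?_
      change alternatingProd (g 0) (g 1) p • alternatingProd (g 0) (g 1) p • o = o
      rw [← mul_smul, hpp, one_smul]
    · exact congrArg _ (congrArg _ (if_neg hqE))
    · refine (congrArg _ (congrArg _ (if_pos hrE))).trans ?_
      change alternatingProd (g 2) (g 0) r • alternatingProd (g 0) (g 1) p • o = _
      rw [hr1, one_smul]
      rfl
  · intro j
    fin_cases j
    · exact congrArg _ (congrArg _ (if_neg hpE))
    · refine (congrArg _ (congrArg _ (if_neg hqE))).trans ?_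
      change alternatingProd (g 1) (g 2) q • alternatingProd (g 1) (g 2) q • o = o
      rw [← mul_smul, hqq, one_smul]
    · refine (congrArg _ (congrArg _ (if_pos hrE))).trans ?_
      change alternatingProd (g 2) (g 0) r • alternatingProd (g 1) (g 2) q • o = _
      rw [hr1, one_smul]
      rfl

theorem exists_thickness (n : Fin 3 → ℤ) :
    ∃ η : ℝ, 0 < η ∧ η ≤ 1 ∧ ∀ j, |(n j : ℝ)| * η < 1 / 4 := by
  have hM : 0 ≤ ∑ j, |(n j : ℝ)| := Finset.sum_nonneg fun _ _ => abs_nonneg _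
  refine ⟨1 / (4 * (∑ j, |(n j : ℝ)| + 1)), by positivity, ?_, fun j => ?_⟩
  · rw [div_le_one (by positivity)]
    linarith
  · have hj : |(n j : ℝ)| ≤ ∑ j, |(n j : ℝ)| :=
      Finset.single_le_sum (f := fun j => |(n j : ℝ)|) (fun _ _ => abs_nonneg _)
        (Finset.mem_univ j)
    rw [mul_one_div, div_lt_div_iff₀ (by positivity) (by norm_num)]
    linarith

end Pretzel

theorem three_le_abs_of_odd {p q m : ℤ} (hp : Odd p) (hq : q ≠ 0)
    (h : 1 / |(p : ℝ)| + 1 / |(q : ℝ)| + 1 / |(m : ℝ)| ≤ 1) : 3 ≤ |p| := by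
  by_contra! h3
  obtain ⟨k, rfl⟩ := hp
  have h1 : |2 * k + 1| = 1 := by
    rcases abs_cases (2 * k + 1) with ⟨e, e'⟩ | ⟨e, e'⟩ <;> omega
  have h2 : |((2 * k + 1 : ℤ) : ℝ)| = 1 := by exact_mod_cast h1
  have h4 : 0 < 1 / |(q : ℝ)| := by positivity
  have h5 : 0 ≤ 1 / |(m : ℝ)| := by positivity
  rw [h2] at h
  linarith

namespace TubularNbhd

variable {K : Set Sphere3} (N : TubularNbhd K) (α β γ δ : ℤ)

/-- Every point of a Dehn filling can be joined to a point of the knot complement. -/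
theorem exists_joined_inc (y : N.DehnFilling α β γ δ) : ∃ x, Joined y (N.inc α β γ δ x) := by
  induction y using Quot.ind with
  | mk y =>
    rcases y with x | ⟨u, w⟩
    · exact ⟨x, Joined.refl _⟩
    · refine ⟨N.gluing α β γ δ (u, 1), ?_⟩
      rw [N.inc_gluing α β γ δ (x := (u, 1)) one_ne_zero]
      obtain ⟨ρ⟩ := PathConnectedSpace.joined w 1
      exact ⟨((Path.refl u).prod ρ).map (N.continuous_solid α β γ δ)⟩

end TubularNbhd

/-! ### Proof of the theorem -/

open Pretzel

theorem lemma4p1 (p q r m : ℤ) (hp : Odd p) (hq : Odd q) (hr : r = 2 * m) (hm : m ≠ 0)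
    (hpqm : 1 / |(p : ℝ)| + 1 / |(q : ℝ)| + 1 / |(m : ℝ)| ≤ 1)
    (K : Set Sphere3) (hK : IsPretzel p q r K)
    (N : TubularNbhd K) (hN : N.IsPreferred)
    (a b c d : ℤ) (hb : Odd b) (hdet : (2 * a) * d - b * c = 1)
    (x : N.DehnFilling (2 * a) b c d) :
    Infinite (FundamentalGroup (N.DehnFilling (2 * a) b c d) x) := by
  have hp3 := three_le_abs_of_odd hp (by rintro rfl; simp at hq) hpqm
  have hq3 := three_le_abs_of_odd (p := q) (q := p) hq (by rintro rfl; simp at hp)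
    (by rwa [add_comm (1 / |(q : ℝ)|)])
  have hm2 : 2 ≤ |m| := by
    by_contra! h
    have h1 : |m| = 1 := by
      have := abs_pos.2 hm
      omega
    have h2 : |(m : ℝ)| = 1 := by exact_mod_cast h1
    have h3 : (0 : ℝ) < |(p : ℝ)| := by
      have : (3 : ℝ) ≤ |(p : ℝ)| := by exact_mod_cast hp3
      linarith
    have h4 : (0 : ℝ) < 1 / |(p : ℝ)| := by positivity
    have h5 : 0 ≤ 1 / |(q : ℝ)| := by positivity
    rw [h2] at hpqm
    linarith
  obtain ⟨G, _, g, sgn, hg, hsg, h0, h1, h2, hinf⟩ :=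
    TriangleGroup.exists_reflection_group hp3 hq3 hm2 hpqm
  obtain ⟨κ, H⟩ := exists_isCompatible hp hq hr hg h0 h1 h2
  obtain ⟨η, hη0, hη1, hη⟩ := exists_thickness ![p, q, r]
  obtain ⟨Φ, hΦ⟩ := hK
  set n : Fin 3 → ℤ := ![p, q, r] with hn
  set std : Set (OnePoint Space3) :=
    (fun P : Space3 => (P : OnePoint Space3)) '' standardPretzel (n 0) (n 1) (n 2) with hstd
  have hΦ' : Φ '' std = K := hΦ
  have hmemK : ∀ Q, Φ Q ∈ Kᶜ ↔ Q ∉ std := fun Q => by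
    rw [← hΦ', Set.mem_compl_iff, Φ.injective.mem_set_image]
  let ψ : ↥Kᶜ → OnePoint Space3 := fun y => Φ.symm y
  have hψc : Continuous ψ := Φ.symm.continuous.comp continuous_subtype_val
  have hψ : ∀ y, ψ y ∉ std := fun y => by
    rw [← hmemK]
    simp [ψ]
  let L := localSystem H.mul_self H.zpow hψc hψ
  let U : Set Space3 := (⋃ i, arcNbhd η i) ∪ ⋃ j, strandNbhd n j
  have hU : IsOpen U := (isOpen_iUnion fun i => isOpen_arcNbhd η i).union
    (isOpen_iUnion fun j => isOpen_strandNbhd j)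
  let V : Set Sphere3 := Φ '' ((fun P : Space3 => (P : OnePoint Space3)) '' U)
  -- The value at infinity is arbitrary, since `V` contains only images of finite points.
  let h : ↥Kᶜ → G ⧸ Subgroup.zpowers (g 1) := fun y => (ψ y).elim (κ 0) (nearSection g n κ)
  -- `g 1` is an involution of sign -1, so the sign detects the elements of the group it generates.
  have hH : ∀ z ∈ Subgroup.zpowers (g 1), sgn z = 1 → z = 1 := by
    intro z hz hs
    obtain ⟨k, rfl⟩ := Subgroup.mem_zpowers_iff.1 hz
    rcases Int.even_or_odd' k with ⟨l, rfl | rfl⟩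
    · rw [zpow_mul, zpow_two, hg, one_zpow]
    · rw [map_zpow, hsg, zpow_add, zpow_mul] at hs
      simp at hs
  have hVo : IsOpen V := Φ.isOpenMap _ (OnePoint.isOpenMap_coe _ hU)
  have hKV : K ⊆ V := by
    rw [← hΦ']
    refine Set.image_mono (Set.image_mono fun P hP => ?_)
    rcases mem_nbhd_of_mem_standardPretzel hη0 hP with ⟨i, hi⟩ | ⟨j, hj⟩
    · exact Or.inl (Set.mem_iUnion.2 ⟨i, hi⟩)
    · exact Or.inr (Set.mem_iUnion.2 ⟨j, hj⟩)
  have hflat : ∀ y : ↥Kᶜ, (y : Sphere3) ∈ V → L.FlatAt id h y := by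
    rintro y ⟨_, ⟨P, hP, rfl⟩, hy⟩
    have hyP : ψ y = P := by rw [← Φ.symm_apply_apply (P : OnePoint Space3)]; exact congrArg _ hy.symm
    have hPc : ∃ i, P ∈ chart n i := by
      have := exists_mem_compactChart (hψ y)
      rwa [hyP] at this
    obtain ⟨i, hi, hev⟩ := eventually_nearSection H hη hη1
      (hP.imp Set.mem_iUnion.1 Set.mem_iUnion.1) hPc
    refine LocalSystem.FlatAt.of_chart (i := i) continuousAt_id ?_ ?_
    · change ψ y ∈ compactChart n i
      rw [hyP]
      exact hi
    · have h3 : ∀ᶠ Q in 𝓝 (ψ y), (compactGauge g n i Q)⁻¹ • Q.elim (κ 0) (nearSection g n κ) =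
          (compactGauge g n i (ψ y))⁻¹ • (ψ y).elim (κ 0) (nearSection g n κ) := by
        rw [hyP, OnePoint.nhds_coe_eq, eventually_map]
        exact hev
      exact hψc.continuousAt.eventually h3
  obtain ⟨L', hchart, hgauge⟩ := N.exists_extension hdet L hN (even_two_mul a) sgn hH
    (Subgroup.mem_zpowers _) (hsg 1) hVo hKV h hflat
  have hloc : LocallyPathConnectedSpace (OnePoint Space3) :=
    have := ChartedSpace.locallyPathConnectedSpace (EuclideanSpace ℝ (Fin 3)) Sphere3
    Φ.isOpenEmbedding.locallyPathConnectedSpace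
  have hf : Φ (frontPoint : OnePoint Space3) ∈ Kᶜ := by
    -- The end of any such path, here one from infinity, is off the link.
    have := joinedIn_compl (n := n) (Q := OnePoint.infty) (by rintro ⟨P, -, h⟩; simp at h)
    exact (hmemK _).2 this.target_mem
  -- The default value `x` occurs only on the link, outside all charts.
  let e : Space3 → N.DehnFilling (2 * a) b c d := fun P =>
    open Classical in
    if h : Φ (P : OnePoint Space3) ∈ Kᶜ then N.inc _ _ _ _ ⟨_, h⟩ else x
  have he : ∀ {P : Space3} (h : Φ (P : OnePoint Space3) ∈ Kᶜ), e P = N.inc _ _ _ _ ⟨_, h⟩ :=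
    fun h => dif_pos h
  have hcK : ∀ {i} {P : Space3}, P ∈ chart n i → Φ (P : OnePoint Space3) ∈ Kᶜ := fun h =>
    (hmemK _).2 (notMem_of_mem_compactChart (coe_mem_compactChart.2 h))
  have hinc : Infinite (FundamentalGroup (N.DehnFilling (2 * a) b c d) (e frontPoint)) := by
    refine L'.infinite_fundamentalGroup _ hinf fun z hz => ?_
    have := joined_pt_of_mem_closure (n := n) L' (e := e) (σ := Sum.inl) ?_ ?_ ?_ hz 1
    · rwa [mul_one] at this
    · intro i
      rw [continuousOn_iff_continuous_domRestrict]
      have h3 : (chart n i).domRestrict e = fun P : chart n i =>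
          N.inc _ _ _ _ ⟨Φ (P.1 : OnePoint Space3), hcK P.2⟩ :=
        funext fun P => he (hcK P.2)
      rw [h3]
      refine (N.continuous_inc _ _ _ _).comp (Continuous.subtype_mk ?_ _)
      exact Φ.continuous.comp (OnePoint.continuous_coe.comp continuous_subtype_val)
    · intro i P hP
      rw [hchart, he (hcK hP)]
      refine Set.mem_image_of_mem _ ?_
      change Φ.symm (Φ P) ∈ compactChart n i
      rw [Φ.symm_apply_apply]
      exact hP
    · intro i P hP
      rw [he (hcK hP), hgauge]
      change compactGauge g n i (Φ.symm (Φ P)) = _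
      rw [Φ.symm_apply_apply]
      rfl
  -- The filling is path connected, so infiniteness passes to the given base point.
  obtain ⟨y, hy⟩ := N.exists_joined_inc (2 * a) b c d x
  have hy' : Joined (N.inc (2 * a) b c d y) (e frontPoint) := by
    obtain ⟨ρ, hρ⟩ := joinedIn_compl (n := n) (hψ y)
    have h3 : ∀ t, Φ (ρ t) ∈ Kᶜ := fun t => (hmemK _).2 (hρ t)
    refine ⟨⟨⟨fun t => N.inc _ _ _ _ ⟨Φ (ρ t), h3 t⟩, ?_⟩, ?_, ?_⟩⟩
    · exact (N.continuous_inc _ _ _ _).comp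
        ((Φ.continuous.comp ρ.continuous).subtype_mk _)
    · refine congrArg (N.inc _ _ _ _) (Subtype.ext ?_)
      simp [ψ]
    · rw [he hf]
      refine congrArg (N.inc _ _ _ _) (Subtype.ext ?_)
      simp
  obtain ⟨ρ⟩ := (hy.trans hy').symm
  exact (FundamentalGroup.fundamentalGroupMulEquivOfPath ρ).toEquiv.infinite_iff.1 hinc
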